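/- Let $n\ge 1$, let $\Omega\subset\mathbb R^n$ be a bounded domain with $C^2$ boundary, let $T>0$ and $Q=\Omega\times(0,T)$, and let $$L_0u=-\sum_{i,j=1}^n D_j(a^{ij}D_iu)+\sum_{i=1}^n b^iD_iu-\sum_{i=1}^n D_i(b^iu)+cu,$$ where $a^{ij}=a^{ji}$ and $b^i$ are Lipschitz on $\overline\Omega$, $c\in L^\infty(\Omega)$, and $\lambda^*|\xi|^2\le\sum_{i,j}a^{ij}(x)\xi_i\xi_j\le\frac1{\lambda^*}|\xi|^2$ for all $x\in\overline\Omega$, $\xi\in\mathbb R^n$, with some constant $\lambda^*>0$. Write $(\cdot,\cdot)$ and $\|\cdot\|$ for the inner product and norm of $L^2(\Omega)$, and let $$B_0(v,w)=\int_\Omega\Big(\sum_{i,j}a^{ij}D_iv\,D_jw+\sum_i b^i(D_iv\,w+v\,D_iw)+cvw\Big)dx,\qquad v,w\in H^1_0(\Omega).$$ Let $q>\frac{n+2}2$ and $M\ge0$, and let $\mathcal M_q$ be the set of all $e\in L^\infty(0,T;L^q(\Omega))$ with $\operatorname{ess\,sup}_{t\in(0,T)}\|e(\cdot,t)\|_{L^q(\Omega)}\le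 M$. Then there are an integer $\mathcal K_0\ge0$ and a constant $C$, depending only on $L_0$, $M$, $\Omega$ (and on the fixed $T$ and $q$), such that the following holds. Let $X_1,X_2,\dots$ be any orthonormal basis of $L^2(\Omega)$ consisting of Dirichlet eigenfunctions of $L_0$, that is, $X_j\in H^1_0(\Omega)$ and $B_0(X_j,w)=\lambda_j(X_j,w)$ for all $w\in H^1_0(\Omega)$, with $\lambda_1\le\lambda_2\le\cdots$. Then for every $e\in\mathcal M_q$, $f\in L^2(Q)$, $\mathcal K\ge\mathcal K_0$ and $a_I=(a_1,\dots,a_{\mathcal K})\in\mathbb R^{\mathcal K}$, there is exactly one $u\in C([0,T];L^2(\Omega))\cap L^2(0,T;H^1_0(\Omega))$ such that 1. $u$ is a weak solution of $u_t+L_0u+eu=f$ in $Q$, $u=0$ on $\partial\Omega\times(0,T)$: for all $t\in[0,T]$ and all $\varphi\in L^2(0,T;H^1_0(\Omega))$ with $\varphi_t\in L^2(Q)$, $$(u(t),\varphi(t))-\int_0^t(u,\varphi_\tau)\,d\tau+\int_0^t\Big(B_0(u,\varphi)+\int_\Omega eu\varphi\,dx\Big)d\tau=(u(0),\varphi(0))+\int_0^t(f,\varphi)\,d\tau;$$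 2. $(u(0),X_j)=a_j$ for $1\le j\le\mathcal K$; 3. $(u(0),X_j)=(u(T),X_j)$ for all $j\ge\mathcal K+1$. Moreover, this solution satisfies $$\sup_{t\in[0,T]}\|u(\cdot,t)\|^2+\int_0^T\|\nabla u(\cdot,t)\|^2\,dt\le C\Big(|a_I|^2+\int_Qf^2\,dx\,dt\Big).$$ -/

import Mathlib

open Set MeasureTheory
open scoped ENNReal NNReal Topology ContDiff

namespace ApproxPeriodic

/-- The space `ℝⁿ` with its Euclidean norm. -/
abbrev Space (n : ℕ) : Type := EuclideanSpace ℝ (Fin n)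

/-- The real Hilbert space `L²(Ω)`. -/
abbrev L2 {n : ℕ} (Ω : Set (Space n)) : Type := Lp ℝ 2 (volume.restrict Ω)

/-- The real Hilbert space `L²(Ω; ℝⁿ)` of square integrable vector fields. -/
abbrev L2vec {n : ℕ} (Ω : Set (Space n)) : Type := Lp (Space n) 2 (volume.restrict Ω)

/-- A bounded domain with `C²` boundary: near each boundary point the domain is the sublevel set
`{ρ < 0}` of a `C²` function whose differential does not vanish at that point. -/
structure IsC2Domain {n : ℕ} (Ω : Set (Space n)) : Prop where
  isOpen : IsOpen Ω
  isConnected : IsConnected Ω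
  isBounded : Bornology.IsBounded Ω
  boundary : ∀ x ∈ frontier Ω, ∃ U ∈ 𝓝 x, ∃ ρ : Space n → ℝ,
    ContDiff ℝ 2 ρ ∧ fderiv ℝ ρ x ≠ 0 ∧ Ω ∩ U = {y ∈ U | ρ y < 0}

/-- `HasGrad Ω v g` says that `v ∈ H¹₀(Ω)` and that `g` is the weak gradient of `v`: the pair
`(v, g)` is a limit in `L²(Ω) × L²(Ω; ℝⁿ)` of pairs `(φ, ∇φ)` with `φ ∈ C_c^∞(Ω)`. -/
def HasGrad {n : ℕ} (Ω : Set (Space n)) (v : L2 Ω) (g : L2vec Ω) : Prop :=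
  (v, g) ∈ closure {p : L2 Ω × L2vec Ω | ∃ φ : Space n → ℝ,
    ContDiff ℝ ∞ φ ∧ HasCompactSupport φ ∧ tsupport φ ⊆ Ω ∧
      p.1 =ᵐ[volume.restrict Ω] φ ∧ p.2 =ᵐ[volume.restrict Ω] gradient φ}

/-- The coefficients of the symmetric second order operator
`L₀ u = -∑ D_j (a^{ij} D_i u) + ∑ b^i D_i u - ∑ D_i (b^i u) + c u`:
`a` symmetric, Lipschitz and uniformly elliptic, `b` Lipschitz, `c` bounded. -/
structure EllipticOperator {n : ℕ} (Ω : Set (Space n)) where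
  a : Fin n → Fin n → Space n → ℝ
  b : Fin n → Space n → ℝ
  c : Space n → ℝ
  /-- The ellipticity constant. -/
  ell : ℝ
  ell_pos : 0 < ell
  a_lipschitz : ∀ i j, ∃ k : ℝ≥0, LipschitzOnWith k (a i j) (closure Ω)
  a_symm : ∀ i j, ∀ x ∈ closure Ω, a i j x = a j i x
  a_lower : ∀ x ∈ closure Ω, ∀ ξ : Space n, ell * ‖ξ‖ ^ 2 ≤ ∑ i, ∑ j, a i j x * ξ i * ξ j
  a_upper : ∀ x ∈ closure Ω, ∀ ξ : Space n, ∑ i, ∑ j, a i j x * ξ i * ξ j ≤ (1 / ell) * ‖ξ‖ ^ 2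
  b_lipschitz : ∀ i, ∃ k : ℝ≥0, LipschitzOnWith k (b i) (closure Ω)
  c_bounded : MemLp c ∞ (volume.restrict Ω)

/-- The bilinear form `(L₀ v, w)` on `H¹₀(Ω)`, where `g = ∇v` and `h = ∇w`; the terms in divergence
form are integrated by parts. -/
noncomputable def EllipticOperator.form {n : ℕ} {Ω : Set (Space n)} (L₀ : EllipticOperator Ω)
    (v : L2 Ω) (g : L2vec Ω) (w : L2 Ω) (h : L2vec Ω) : ℝ :=
  ∫ x in Ω, ((∑ i, ∑ j, L₀.a i j x * g x i * h x j)
    + (∑ i, L₀.b i x * g x i * w x) + (∑ i, L₀.b i x * v x * h x i)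
    + L₀.c x * v x * w x)

/-- `X` is an eigenfunction of the Dirichlet problem for `L₀`, with eigenvalue `lam`
(non-vanishing of `X` is not part of this predicate). -/
def IsEigenfunction {n : ℕ} {Ω : Set (Space n)} (L₀ : EllipticOperator Ω) (lam : ℝ) (X : L2 Ω) :
    Prop :=
  ∃ Y : L2vec Ω, HasGrad Ω X Y ∧
    ∀ (w : L2 Ω) (h : L2vec Ω), HasGrad Ω w h → L₀.form X Y w h = lam * inner ℝ X w

/-- `X 0, X 1, …` is an orthonormal basis of `L²(Ω)` made of Dirichlet eigenfunctions of `L₀`,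
listed with nondecreasing eigenvalues `lam 0 ≤ lam 1 ≤ …`. -/
structure IsEigenbasis {n : ℕ} {Ω : Set (Space n)} (L₀ : EllipticOperator Ω) (lam : ℕ → ℝ)
    (X : HilbertBasis ℕ ℝ (L2 Ω)) : Prop where
  monotone : Monotone lam
  eigen : ∀ j, IsEigenfunction L₀ (lam j) (X j)

/-- `u ∈ L²(0,T; H¹₀(Ω))` with spatial weak gradient `G ∈ L²(0,T; L²(Ω; ℝⁿ))`. -/
structure MemL2H10 {n : ℕ} (Ω : Set (Space n)) (T : ℝ) (u : ℝ → L2 Ω) (G : ℝ → L2vec Ω) :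
    Prop where
  memLp : MemLp u 2 (volume.restrict (Ioo 0 T))
  memLp_grad : MemLp G 2 (volume.restrict (Ioo 0 T))
  hasGrad : ∀ᵐ t ∂(volume.restrict (Ioo 0 T)), HasGrad Ω (u t) (G t)

/-- `φ ∈ H^{1,1}_0(Q)`, `Q = Ω × (0,T)`: `φ`, its weak time derivative `φt` and its spatial weak
gradient `Gφ` are square integrable on `Q` and `φ` vanishes on `∂Ω × (0,T)`. As usual `φ` is
represented by its continuous version `[0,T] → L²(Ω)`. -/
structure IsTestFunction {n : ℕ} (Ω : Set (Space n)) (T : ℝ) (φ φt : ℝ → L2 Ω)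
    (Gφ : ℝ → L2vec Ω) : Prop where
  memL2H10 : MemL2H10 Ω T φ Gφ
  memLp_deriv : MemLp φt 2 (volume.restrict (Ioo 0 T))
  eq_integral : ∀ t ∈ Icc 0 T, φ t = φ 0 + ∫ τ in (0 : ℝ)..t, φt τ

/-- `f ∈ L²(Q)`, `Q = Ω × (0,T)`. -/
def MemL2Q {n : ℕ} (Ω : Set (Space n)) (T : ℝ) (f : Space n → ℝ → ℝ) : Prop :=
  MemLp (fun p : Space n × ℝ => f p.1 p.2) 2
    ((volume.restrict Ω).prod (volume.restrict (Ioo 0 T)))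

/-- The class of `e ∈ L^∞(0,T; L^q(Ω))` with `ess sup_{t ∈ (0,T)} ‖e(·,t)‖_{L^q(Ω)} ≤ M`. -/
def errorClass {n : ℕ} (Ω : Set (Space n)) (T : ℝ) (q : ℝ≥0∞) (M : ℝ≥0) :
    Set (Space n → ℝ → ℝ) :=
  {e | AEStronglyMeasurable (fun p : Space n × ℝ => e p.1 p.2)
        ((volume.restrict Ω).prod (volume.restrict (Ioo 0 T))) ∧
      ∀ᵐ t ∂(volume.restrict (Ioo 0 T)), eLpNorm (fun x => e x t) q (volume.restrict Ω) ≤ M}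

/-- `u ∈ C([0,T]; L²(Ω)) ∩ L²(0,T; H¹₀(Ω))`, with spatial weak gradient `G`, is a weak solution of
`u_t + L₀ u + e u = f` in `Ω × (0,T)`, `u = 0` on `∂Ω × (0,T)`. -/
structure IsWeakSolution {n : ℕ} {Ω : Set (Space n)} (L₀ : EllipticOperator Ω) (T : ℝ)
    (e f : Space n → ℝ → ℝ) (u : ℝ → L2 Ω) (G : ℝ → L2vec Ω) : Prop where
  continuousOn : ContinuousOn u (Icc 0 T)
  memL2H10 : MemL2H10 Ω T u G
  weak : ∀ (φ φt : ℝ → L2 Ω) (Gφ : ℝ → L2vec Ω), IsTestFunction Ω T φ φt Gφ → ∀ t ∈ Icc 0 T,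
    inner ℝ (u t) (φ t) - (∫ τ in (0 : ℝ)..t, inner ℝ (u τ) (φt τ))
      + (∫ τ in (0 : ℝ)..t, (L₀.form (u τ) (G τ) (φ τ) (Gφ τ)
          + ∫ x in Ω, e x τ * u τ x * φ τ x))
    = inner ℝ (u 0) (φ 0) + ∫ τ in (0 : ℝ)..t, ∫ x in Ω, f x τ * φ τ x

/-- `u` is a weak solution (with spatial weak gradient `G`) whose first `K` coefficients in the
basis `X` are prescribed at time `0` as `a`, all the others being `T`-periodic. -/
structure IsApproxPeriodicSolution {n : ℕ} {Ω : Set (Space n)} (L₀ : EllipticOperator Ω) (T : ℝ)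
    (X : HilbertBasis ℕ ℝ (L2 Ω)) (e f : Space n → ℝ → ℝ) (K : ℕ) (a : Fin K → ℝ)
    (u : ℝ → L2 Ω) (G : ℝ → L2vec Ω) : Prop where
  weakSolution : IsWeakSolution L₀ T e f u G
  initial : ∀ j : Fin K, inner ℝ (u 0) (X j) = a j
  periodic : ∀ j : ℕ, K ≤ j → inner ℝ (u 0) (X j) = inner ℝ (u T) (X j)

end ApproxPeriodic

open ApproxPeriodic

/-! In an eigenbasis of `L₀` the equation is the system u_j' + λ_j u_j = (f − e u)_j, where u_j(0)
is prescribed for j < K and u_j is periodic for j ≥ K. Without e the modes decouple and are solved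
explicitly. The potential e couples them and is only form bounded relative to `L₀`, so it is first
turned into a bounded operator. With γ so large that L₀ + γ ≥ 1, put y = (L₀+γ)^(1/2) u and E(t) =
(L₀+γ)^(-1/2) e(t) (L₀+γ)^(-1/2). Then u_j' + λ_j u_j = √(λ_j+γ) h_j with h = (L₀+γ)^(-1/2) f − E y,
and √(λ_j+γ) is exactly the growth that the energy method absorbs.

Let P_K be the projection onto the modes j ≥ K. In L² for the weight exp(-2γt) the energy method
gives ‖y‖² ≤ Σ_{j<K} u_j(0)² + 8 exp(2γT) ‖P_K h‖² + ‖h‖² (`IsModalFamily.integral_le`). The middle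
term pays for the unknown initial values of the periodic modes (`HasPrimitive.periodic_le`). If ‖E‖²
≤ 1/16 and 8 exp(2γT) ‖P_K E‖² ≤ 1/16, the coupled system is solved by contraction, and the same
inequality yields uniqueness and the estimate.

Both smallness conditions come from the Sobolev and Hölder inequalities: since q > (n+2)/2, the form
of e is at most a times the form of L₀ + Γ, with a as small as desired if Γ is large
(`exists_potential_bound`, `exists_form_bound`). The choice a = 1/4 fixes γ. A second choice, a of
order exp(-2γT), may need Γ larger than γ, but this is harmless on modes with λ_j ≥ Γ, hence after
P_K for K large (`norm_high_potentialOp_le`). How large does not depend on the eigenbasis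
(`exists_uniform_index`).

The weak formulation and the modal system are equivalent (`IsWeakSolution.exists_modal`,
`weak_of_modal`, `IsModalFamily.exists_weakSolution`), and Gårding's inequality converts the bound
on y into one on ∇u. -/

namespace ApproxPeriodic

/-! ### The scalar equation u' + λu = g on [0,T]. -/

/-- `u` is a primitive of the integrable function `u'` on `[0,T]`. -/
structure HasPrimitive (T : ℝ) (u u' : ℝ → ℝ) : Prop where
  integrable : IntervalIntegrable u' volume 0 T
  eq_integral : ∀ t ∈ Icc 0 T, u t = u 0 + ∫ s in (0 : ℝ)..t, u' s

namespace HasPrimitive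

variable {T : ℝ} {u u' w w' : ℝ → ℝ}

theorem intervalIntegrable (h : HasPrimitive T u u') {t : ℝ} (ht : t ∈ Icc 0 T) :
    IntervalIntegrable u' volume 0 t :=
  h.integrable.mono_set (by
    rw [uIcc_of_le ht.1, uIcc_of_le (ht.1.trans ht.2)]; exact Icc_subset_Icc_right ht.2)

theorem continuousOn (h : HasPrimitive T u u') : ContinuousOn u (Icc 0 T) := by
  rcases lt_or_ge T 0 with hT | hT
  · simp [Icc_eq_empty (not_le.mpr hT)]
  · have h1 : ContinuousOn (fun t => u 0 + ∫ s in (0 : ℝ)..t, u' s) (uIcc 0 T) :=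
      continuousOn_const.add (intervalIntegral.continuousOn_primitive_interval'
        h.integrable left_mem_uIcc)
    rw [uIcc_of_le hT] at h1
    exact h1.congr h.eq_integral

theorem absolutelyContinuousOnInterval (h : HasPrimitive T u u') {t : ℝ} (ht : t ∈ Icc 0 T) :
    AbsolutelyContinuousOnInterval (fun x => u 0 + ∫ s in (0 : ℝ)..x, u' s) 0 t := by
  have h1 := (h.intervalIntegrable ht).absolutelyContinuousOnInterval_intervalIntegral
    (c := 0) left_mem_uIcc
  have h2 : AbsolutelyContinuousOnInterval (fun _ : ℝ => u 0) 0 t :=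
    (LipschitzOnWith.of_dist_le_mul (K := 0) (by simp)).absolutelyContinuousOnInterval
  exact h2.add h1

/-- Primitives of integrable functions are absolutely continuous, so the product rule holds almost
everywhere and integrates. The energy inequality, Duhamel's formula and the testing of modes against
φ all rest on it. -/
theorem mul (hT : 0 ≤ T) (h : HasPrimitive T u u') (k : HasPrimitive T w w') :
    HasPrimitive T (fun t => u t * w t) (fun t => u' t * w t + u t * w' t) := by
  refine ⟨?_, fun t ht => ?_⟩
  · refine (h.integrable.mul_continuousOn ?_).add (k.integrable.continuousOn_mul ?_)
    · rw [uIcc_of_le hT]; exact k.continuousOn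
    · rw [uIcc_of_le hT]; exact h.continuousOn
  · have key := (h.absolutelyContinuousOnInterval ht).integral_deriv_mul_eq_sub
      (k.absolutelyContinuousOnInterval ht)
    rw [← h.eq_integral t ht, ← k.eq_integral t ht] at key
    simp only [intervalIntegral.integral_same, add_zero] at key
    rw [← sub_eq_iff_eq_add', ← key]
    apply intervalIntegral.integral_congr_ae
    filter_upwards [(h.intervalIntegrable ht).ae_hasDerivAt_integral,
      (k.intervalIntegrable ht).ae_hasDerivAt_integral] with x hx hy hxt
    have hx' := ((hx (uIoc_subset_uIcc hxt) 0 left_mem_uIcc).const_add (u 0)).deriv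
    have hy' := ((hy (uIoc_subset_uIcc hxt) 0 left_mem_uIcc).const_add (w 0)).deriv
    have hxT : x ∈ Icc 0 T := by
      rw [uIoc_of_le ht.1] at hxt
      exact ⟨hxt.1.le, hxt.2.trans ht.2⟩
    rw [hx', hy', ← h.eq_integral x hxT, ← k.eq_integral x hxT]

theorem of_hasDerivAt (hu : ∀ t, HasDerivAt u (u' t) t) (hc : Continuous u') :
    HasPrimitive T u u' :=
  ⟨hc.intervalIntegrable _ _, fun t _ => by
    rw [intervalIntegral.integral_eq_sub_of_hasDerivAt (fun x _ => hu x)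
      (hc.intervalIntegrable _ _)]; ring⟩

end HasPrimitive

theorem hasPrimitive_exp (T c : ℝ) :
    HasPrimitive T (fun t => Real.exp (c * t)) (fun t => c * Real.exp (c * t)) := by
  refine .of_hasDerivAt (fun t => ?_) (by fun_prop)
  have := ((hasDerivAt_id t).const_mul c).exp
  simpa [mul_comm] using this

/-- Weighted energy inequality for the scalar equation `u' + lam u = g`. -/
theorem HasPrimitive.energy {T lam c : ℝ} {g u : ℝ → ℝ}
    (h : HasPrimitive T u (fun s => g s - lam * u s)) (hg : MemLp g 2 (volume.restrict (Ioo 0 T)))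
    (hc : 0 < lam + c) {t : ℝ} (ht : t ∈ Icc 0 T) :
    Real.exp (-2 * c * t) * u t ^ 2
        + (lam + c) * (∫ s in (0 : ℝ)..t, Real.exp (-2 * c * s) * u s ^ 2) ≤
      u 0 ^ 2 + (lam + c)⁻¹ * ∫ s in (0 : ℝ)..t, Real.exp (-2 * c * s) * g s ^ 2 := by
  have hT : 0 ≤ T := ht.1.trans ht.2
  have h1 := ((hasPrimitive_exp T (-2 * c)).mul hT (h.mul hT h)).eq_integral t ht
  have hsub : uIcc 0 t ⊆ Icc 0 T := by
    rw [uIcc_of_le ht.1]; exact Icc_subset_Icc_right ht.2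
  have hcu : ContinuousOn u (uIcc 0 t) := h.continuousOn.mono hsub
  have hce : ContinuousOn (fun s : ℝ => Real.exp (-2 * c * s)) (uIcc 0 t) := by fun_prop
  have hg1 : IntervalIntegrable g volume 0 t := by
    have := (h.intervalIntegrable ht).add ((hcu.intervalIntegrable).const_mul lam)
    refine this.congr fun s _ => ?_
    simp
  have hg2 : IntervalIntegrable (fun s => g s ^ 2) volume 0 t := by
    have h2 : IntegrableOn (fun s => g s ^ 2) (Ioo 0 T) := hg.integrable_sq
    rw [intervalIntegrable_iff_integrableOn_Ioo_of_le ht.1]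
    exact h2.mono_set (Ioo_subset_Ioo_right ht.2)
  have i1 : IntervalIntegrable (fun s => Real.exp (-2 * c * s) * u s ^ 2) volume 0 t :=
    (hce.mul (hcu.pow 2)).intervalIntegrable
  have i2 : IntervalIntegrable (fun s => Real.exp (-2 * c * s) * g s ^ 2) volume 0 t :=
    hg2.continuousOn_mul hce
  simp only [mul_zero, Real.exp_zero, one_mul] at h1
  have h3 : (∫ s in (0 : ℝ)..t, (-2 * c * Real.exp (-2 * c * s) * (u s * u s) +
      Real.exp (-2 * c * s) * ((g s - lam * u s) * u s + u s * (g s - lam * u s)))) ≤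
      ∫ s in (0 : ℝ)..t, ((lam + c)⁻¹ * (Real.exp (-2 * c * s) * g s ^ 2)
        - (lam + c) * (Real.exp (-2 * c * s) * u s ^ 2)) := by
    refine intervalIntegral.integral_mono_on ht.1 ?_ ((i2.const_mul _).sub (i1.const_mul _)) ?_
    · exact (((hasPrimitive_exp T (-2 * c)).mul hT (h.mul hT h)).intervalIntegrable ht)
    · intro s _
      have he := Real.exp_pos (-2 * c * s)
      -- Young's inequality with weight λ + c. The derivative of exp(-2cs)u² contributes −2(λ+c)u²,
      -- of which one half is left over for the left side.
      have h4 : 2 * u s * g s ≤ (lam + c)⁻¹ * g s ^ 2 + (lam + c) * u s ^ 2 := by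
        have h5 : 0 ≤ (lam + c)⁻¹ * (g s - (lam + c) * u s) ^ 2 := by positivity
        have h6 : (lam + c)⁻¹ * (g s - (lam + c) * u s) ^ 2
          = (lam + c)⁻¹ * g s ^ 2 + (lam + c) * u s ^ 2 - 2 * u s * g s := by
          field_simp; ring
        linarith
      nlinarith
  rw [intervalIntegral.integral_sub (i2.const_mul _) (i1.const_mul _),
    intervalIntegral.integral_const_mul, intervalIntegral.integral_const_mul] at h3
  nlinarith

theorem HasPrimitive.duhamel {T lam : ℝ} {g : ℝ → ℝ} (hg : IntervalIntegrable g volume 0 T)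
    (hT : 0 ≤ T) (u₀ : ℝ) :
    HasPrimitive T
      (fun t => Real.exp (-lam * t) * (u₀ + ∫ s in (0 : ℝ)..t, Real.exp (lam * s) * g s))
      (fun s => g s - lam * (Real.exp (-lam * s) *
        (u₀ + ∫ r in (0 : ℝ)..s, Real.exp (lam * r) * g r))) := by
  have h1 : HasPrimitive T (fun t => u₀ + ∫ s in (0 : ℝ)..t, Real.exp (lam * s) * g s)
      (fun s => Real.exp (lam * s) * g s) :=
    ⟨hg.continuousOn_mul (by fun_prop), fun t _ => by simp⟩
  have h2 := (hasPrimitive_exp T (-lam)).mul hT h1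
  convert h2 using 2 with s
  have : Real.exp (-lam * s) * (Real.exp (lam * s) * g s) = g s := by
    rw [← mul_assoc, ← Real.exp_add]; simp
  rw [this]; ring

/-- By Duhamel u(T) = z(u(0) + I) with z = exp(-λT) < 1, so periodicity is an affine equation for
u(0), solved by zI/(1 − z). -/
theorem HasPrimitive.exists_periodic {T lam : ℝ} {g : ℝ → ℝ}
    (hg : IntervalIntegrable g volume 0 T) (hT : 0 < T) (hlam : 0 < lam) :
    ∃ u, HasPrimitive T u (fun s => g s - lam * u s) ∧ u 0 = u T := by
  have he : Real.exp (-lam * T) < 1 := by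
    rw [Real.exp_lt_one_iff]; nlinarith
  set I := ∫ s in (0 : ℝ)..T, Real.exp (lam * s) * g s
  refine ⟨_, HasPrimitive.duhamel hg hT.le
    (Real.exp (-lam * T) * I / (1 - Real.exp (-lam * T))), ?_⟩
  simp only [mul_zero, Real.exp_zero, intervalIntegral.integral_same, add_zero, one_mul]
  have : 1 - Real.exp (-lam * T) ≠ 0 := by linarith
  change _ = Real.exp (-lam * T) * (_ + I)
  generalize Real.exp (-lam * T) = z at *
  field_simp
  ring

/-- Bound for the initial value of a periodic solution of `u' + lam u = g`. -/
theorem HasPrimitive.periodic_le {T lam : ℝ} {g u : ℝ → ℝ}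
    (h : HasPrimitive T u (fun s => g s - lam * u s)) (hg : MemLp g 2 (volume.restrict (Ioo 0 T)))
    (hT : 0 < T) (hlam : 0 < lam) (hexp : Real.exp (-lam * T) ≤ 1 / 2) (hper : u 0 = u T) :
    u 0 ^ 2 ≤ 4 / lam * ∫ s in (0 : ℝ)..T, g s ^ 2 := by
  -- This c makes the weight grow like exp(λt). At t = T the value u(T)² = u(0)² carries the factor
  -- exp(λT), and after division by it the term exp(-λT)u(0)² ≤ u(0)²/2 is absorbed.
  have h1 := h.energy hg (c := -lam / 2) (by linarith) (t := T) ⟨hT.le, le_rfl⟩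
  have e1 : -2 * (-lam / 2) = lam := by ring
  have e2 : lam + -lam / 2 = lam / 2 := by ring
  rw [e1, e2, ← hper] at h1
  have hg2 : IntervalIntegrable (fun s => g s ^ 2) volume 0 T := by
    rw [intervalIntegrable_iff_integrableOn_Ioo_of_le hT.le]
    exact hg.integrable_sq
  have h2 : 0 ≤ ∫ s in (0 : ℝ)..T, Real.exp (lam * s) * u s ^ 2 :=
    intervalIntegral.integral_nonneg hT.le fun s _ => by positivity
  have h3 : (∫ s in (0 : ℝ)..T, Real.exp (lam * s) * g s ^ 2) ≤
      ∫ s in (0 : ℝ)..T, Real.exp (lam * T) * g s ^ 2 := by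
    refine intervalIntegral.integral_mono_on hT.le
      (hg2.continuousOn_mul (by fun_prop)) (hg2.const_mul _) fun s hs => ?_
    gcongr
    exact hs.2
  rw [intervalIntegral.integral_const_mul] at h3
  set G := ∫ s in (0 : ℝ)..T, g s ^ 2
  have hG : 0 ≤ G := intervalIntegral.integral_nonneg hT.le fun s _ => by positivity
  have hE : Real.exp (lam * T) * Real.exp (-lam * T) = 1 := by
    rw [← Real.exp_add]; simp
  set x := Real.exp (lam * T)
  set z := Real.exp (-lam * T)
  have hx : 0 < x := Real.exp_pos _
  have hz : 0 < z := Real.exp_pos _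
  have h4 : x * u 0 ^ 2 ≤ u 0 ^ 2 + (lam / 2)⁻¹ * (x * G) := by
    have : (lam / 2)⁻¹ * (∫ s in (0 : ℝ)..T, Real.exp (lam * s) * g s ^ 2) ≤
      (lam / 2)⁻¹ * (x * G) := by gcongr
    have := mul_nonneg (by linarith : 0 ≤ lam / 2) h2
    linarith
  have h5 : z * (x * u 0 ^ 2) ≤ z * (u 0 ^ 2 + (lam / 2)⁻¹ * (x * G)) := by gcongr
  have h6 : u 0 ^ 2 ≤ z * u 0 ^ 2 + (lam / 2)⁻¹ * G := by
    calc u 0 ^ 2 = x * z * u 0 ^ 2 := by rw [hE, one_mul]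
      _ = z * (x * u 0 ^ 2) := by ring
      _ ≤ _ := h5
      _ = z * u 0 ^ 2 + (x * z) * ((lam / 2)⁻¹ * G) := by ring
      _ = _ := by rw [hE, one_mul]
  have h7 : 4 / lam * G = 2 * ((lam / 2)⁻¹ * G) := by field_simp; ring
  rw [h7]
  nlinarith [sq_nonneg (u 0)]

end ApproxPeriodic

namespace ApproxPeriodic

/-! ### Functions with values in a Hilbert space, through their coordinates. -/

section HilbertValued

variable {H : Type*} [NormedAddCommGroup H] [InnerProductSpace ℝ H]
  (X : HilbertBasis ℕ ℝ H) {α : Type*} [MeasurableSpace α] {μ : Measure α}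

theorem tendsto_basis_sum (v : H) :
    Filter.Tendsto (fun N => ∑ j ∈ Finset.range N, inner ℝ (X j) v • X j) Filter.atTop (𝓝 v) := by
  have := (X.hasSum_repr v).tendsto_sum_nat
  simpa only [X.repr_apply_apply] using this

theorem hasSum_sq_coord (v : H) : HasSum (fun j => inner ℝ (X j) v ^ 2) (‖v‖ ^ 2) := by
  have := X.hasSum_inner_mul_inner v v
  rw [real_inner_self_eq_norm_sq] at this
  refine this.congr_fun fun j => ?_
  rw [real_inner_comm v, sq]

theorem exists_coord_eq {c : ℕ → ℝ} (hc : Summable fun j => c j ^ 2) :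
    ∃ v : H, ∀ j, inner ℝ (X j) v = c j := by
  have hm : Memℓp c 2 := by
    refine memℓp_gen ?_
    simpa using hc
  refine ⟨X.repr.symm ⟨c, hm⟩, fun j => ?_⟩
  rw [← X.repr_apply_apply, LinearIsometryEquiv.apply_symm_apply]

theorem basis_ext {v w : H} (h : ∀ j, inner ℝ (X j) v = inner ℝ (X j) w) : v = w := by
  apply X.repr.injective
  ext j
  simpa only [X.repr_apply_apply] using h j

/-- Vector-valued functions are often built below by pointwise choice. Their measurability is
recovered from the coordinates, as partial sums converge at every point. -/
theorem aestronglyMeasurable_of_coord {y : α → H}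
    (h : ∀ j, AEStronglyMeasurable (fun t => inner ℝ (X j) (y t)) μ) :
    AEStronglyMeasurable y μ :=
  aestronglyMeasurable_of_tendsto_ae (u := Filter.atTop)
    (f := fun N t => ∑ j ∈ Finset.range N, inner ℝ (X j) (y t) • X j)
    (fun N => by
      refine Finset.aestronglyMeasurable_fun_sum _ fun j _ => ?_
      exact (h j).smul_const (X j))
    (Filter.Eventually.of_forall fun t => tendsto_basis_sum X (y t))

theorem norm_coord_le (v : H) (j : ℕ) : |inner ℝ (X j) v| ≤ ‖v‖ := by
  have := abs_real_inner_le_norm (X j) v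
  rwa [X.orthonormal.1 j, one_mul] at this

theorem MemLp.coord {y : α → H} {p : ℝ≥0∞} (hy : MemLp y p μ) (j : ℕ) :
    MemLp (fun t => inner ℝ (X j) (y t)) p μ :=
  hy.mono (aestronglyMeasurable_const.inner hy.1)
    (Filter.Eventually.of_forall fun t => norm_coord_le X (y t) j)

theorem hasSum_integral_coord_sq {y : α → H} (hy : MemLp y 2 μ) :
    HasSum (fun j => ∫ t, inner ℝ (X j) (y t) ^ 2 ∂μ) (∫ t, ‖y t‖ ^ 2 ∂μ) := by
  have hi : ∀ j, Integrable (fun t => inner ℝ (X j) (y t) ^ 2) μ :=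
    fun j => (MemLp.coord X hy j).integrable_sq
  have hn : Integrable (fun t => ‖y t‖ ^ 2) μ := hy.norm.integrable_sq
  have hs : Summable fun j => ∫ t, ‖inner ℝ (X j) (y t) ^ 2‖ ∂μ := by
    refine summable_of_sum_le (c := ∫ t, ‖y t‖ ^ 2 ∂μ) (fun j => by positivity) fun s => ?_
    rw [← integral_finsetSum _ fun j _ => (hi j).norm]
    refine integral_mono (integrable_finsetSum _ fun j _ => (hi j).norm) hn fun t => ?_
    simp only [norm_pow, Real.norm_eq_abs, sq_abs]
    exact sum_le_hasSum s (fun _ _ => sq_nonneg _) (hasSum_sq_coord X (y t))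
  have := hasSum_integral_of_summable_integral_norm hi hs
  rwa [integral_congr_ae (Filter.Eventually.of_forall fun t => (hasSum_sq_coord X (y t)).tsum_eq)]
    at this

/-- By Tonelli the sum of the squares is finite at almost every t, where the coordinates define a
vector; the value 0 is taken elsewhere. The same integral bounds the L² norm. -/
theorem exists_memLp_coord_eq {c : ℕ → α → ℝ} (hc : ∀ j, MemLp (c j) 2 μ)
    (hs : Summable fun j => ∫ t, c j t ^ 2 ∂μ) :
    ∃ y : α → H, MemLp y 2 μ ∧ ∀ᵐ t ∂μ, ∀ j, inner ℝ (X j) (y t) = c j t := by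
  classical
  have hi : ∀ j, Integrable (fun t => c j t ^ 2) μ := fun j => (hc j).integrable_sq
  have hl : ∀ j, ∫⁻ t, ENNReal.ofReal (c j t ^ 2) ∂μ = ENNReal.ofReal (∫ t, c j t ^ 2 ∂μ) :=
    fun j => (ofReal_integral_eq_lintegral_ofReal (hi j)
      (Filter.Eventually.of_forall fun t => sq_nonneg _)).symm
  have hfin : ∫⁻ t, ∑' j, ENNReal.ofReal (c j t ^ 2) ∂μ ≠ ⊤ := by
    rw [lintegral_tsum fun j => (hi j).aemeasurable.ennreal_ofReal]
    simp_rw [hl]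
    exact hs.tsum_ofReal_ne_top
  have hae : ∀ᵐ t ∂μ, Summable fun j => c j t ^ 2 := by
    filter_upwards [ae_lt_top' (AEMeasurable.tsum
      fun j => (hi j).aemeasurable.ennreal_ofReal) hfin] with t ht
    have := ENNReal.summable_toReal ht.ne
    refine this.congr fun j => ?_
    rw [ENNReal.toReal_ofReal (sq_nonneg _)]
  let y : α → H := fun t => if h : Summable (fun j => c j t ^ 2) then
    (exists_coord_eq X h).choose else 0
  have hy : ∀ᵐ t ∂μ, ∀ j, inner ℝ (X j) (y t) = c j t := by
    filter_upwards [hae] with t ht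
    simp only [y, dif_pos ht]
    exact (exists_coord_eq X ht).choose_spec
  have hm : AEStronglyMeasurable y μ := aestronglyMeasurable_of_coord X fun j =>
    (hc j).1.congr (hy.mono fun t ht => (ht j).symm)
  refine ⟨y, ⟨hm, ?_⟩, hy⟩
  rw [eLpNorm_lt_top_iff_lintegral_rpow_enorm_lt_top (by simp) (by simp)]
  refine lt_of_eq_of_lt (lintegral_congr_ae ?_) hfin.lt_top
  filter_upwards [hy] with t ht
  have h1 := hasSum_sq_coord X (y t)
  simp_rw [ht] at h1
  rw [← ENNReal.ofReal_tsum_of_nonneg (fun j => sq_nonneg _) h1.summable, h1.tsum_eq,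
    ← ofReal_norm, ENNReal.toReal_ofNat, ENNReal.rpow_ofNat, ENNReal.ofReal_pow (norm_nonneg _)]

theorem Lp_norm_sq_eq_integral (f : Lp H 2 μ) : ‖f‖ ^ 2 = ∫ t, ‖f t‖ ^ 2 ∂μ := by
  rw [← real_inner_self_eq_norm_sq, L2.inner_def]
  simp only [real_inner_self_eq_norm_sq]

/-- The projection onto the modes of index at least `K`. -/
noncomputable def highModes (K : ℕ) : H →L[ℝ] H :=
  ContinuousLinearMap.id ℝ H
    - ∑ j ∈ Finset.range K, (innerSL ℝ (X j)).smulRight (X j)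

theorem inner_highModes (K j : ℕ) (v : H) :
    inner ℝ (X j) (highModes X K v) = if j < K then 0 else inner ℝ (X j) v := by
  simp only [highModes, sub_apply, ContinuousLinearMap.id_apply,
    sum_apply, ContinuousLinearMap.smulRight_apply, innerSL_apply_apply,
    inner_sub_right, inner_sum, inner_smul_right]
  simp only [orthonormal_iff_ite.mp X.orthonormal j]
  simp
  split_ifs <;> simp

end HilbertValued

/-! ### The weighted measure on the time interval. -/

section Weight

/-- The measure `exp (-2 γ t) dt` on `(0,T)`. -/
noncomputable def weighted (γ T : ℝ) : Measure ℝ :=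
  (volume.restrict (Ioo 0 T)).withDensity fun t => ENNReal.ofReal (Real.exp (-2 * γ * t))

theorem weighted_le {γ T : ℝ} (hγ : 0 ≤ γ) : weighted γ T ≤ volume.restrict (Ioo 0 T) := by
  have : weighted γ T ≤ (volume.restrict (Ioo 0 T)).withDensity 1 := by
    refine withDensity_mono ?_
    filter_upwards [ae_restrict_mem measurableSet_Ioo] with t ht
    rw [Pi.one_apply, ENNReal.ofReal_le_one, Real.exp_le_one_iff]
    nlinarith [ht.1]
  rwa [withDensity_one] at this

/-- The factor lost when the weight is removed; it is the origin of every exp(2γT) below. -/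
theorem le_weighted {γ T : ℝ} (hγ : 0 ≤ γ) :
    volume.restrict (Ioo 0 T) ≤ ENNReal.ofReal (Real.exp (2 * γ * T)) • weighted γ T := by
  rw [weighted, ← withDensity_smul _ (by fun_prop)]
  conv_lhs => rw [← withDensity_one (μ := volume.restrict (Ioo 0 T))]
  refine withDensity_mono ?_
  filter_upwards [ae_restrict_mem measurableSet_Ioo] with t ht
  rw [Pi.one_apply, Pi.smul_apply, smul_eq_mul, ← ENNReal.ofReal_mul (Real.exp_pos _).le,
    ← Real.exp_add, ENNReal.one_le_ofReal, Real.one_le_exp_iff]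
  nlinarith [ht.2]

theorem ae_weighted_iff {γ T : ℝ} (hγ : 0 ≤ γ) {p : ℝ → Prop} :
    (∀ᵐ t ∂weighted γ T, p t) ↔ ∀ᵐ t ∂volume.restrict (Ioo 0 T), p t := by
  refine ⟨fun h => ?_, fun h => (Measure.absolutelyContinuous_of_le (weighted_le hγ)).ae_le h⟩
  exact ((Measure.absolutelyContinuous_of_le (le_weighted hγ)).trans
    Measure.smul_absolutelyContinuous).ae_le h

theorem memLp_weighted_iff {γ T : ℝ} (hγ : 0 ≤ γ) {H : Type*} [NormedAddCommGroup H] {y : ℝ → H} :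
    MemLp y 2 (weighted γ T) ↔ MemLp y 2 (volume.restrict (Ioo 0 T)) :=
  ⟨fun h => (h.smul_measure ENNReal.ofReal_ne_top).mono_measure (le_weighted hγ),
    fun h => h.mono_measure (weighted_le hγ)⟩

theorem integral_weighted {γ T : ℝ} (f : ℝ → ℝ) :
    ∫ t, f t ∂weighted γ T = ∫ t in Ioo 0 T, Real.exp (-2 * γ * t) * f t := by
  rw [weighted, integral_withDensity_eq_integral_toReal_smul (by fun_prop)
    (Filter.Eventually.of_forall fun _ => ENNReal.ofReal_lt_top)]
  simp only [ENNReal.toReal_ofReal (Real.exp_pos _).le, smul_eq_mul]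

theorem integral_le_weighted {γ T : ℝ} (hγ : 0 ≤ γ) {f : ℝ → ℝ}
    (hf : Integrable f (weighted γ T)) (h0 : ∀ t, 0 ≤ f t) :
    ∫ t in Ioo 0 T, f t ≤ Real.exp (2 * γ * T) * ∫ t, f t ∂weighted γ T := by
  have h1 := integral_mono_measure (le_weighted (T := T) hγ) (Filter.Eventually.of_forall h0)
    (hf.smul_measure ENNReal.ofReal_ne_top)
  rwa [integral_smul_measure, ENNReal.toReal_ofReal (Real.exp_pos _).le, smul_eq_mul] at h1

end Weight

end ApproxPeriodic

/-! ### The abstract system of modes: linear estimate, contraction, a priori bound. -/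

namespace ApproxPeriodic

/-- The frequencies `lam j + γ` are at least one, and the modes of index at least `K` decay fast
on the time interval `(0,T)`. -/
structure SpectralGap (lam : ℕ → ℝ) (γ T : ℝ) (K : ℕ) : Prop where
  gamma_nonneg : 0 ≤ γ
  T_pos : 0 < T
  one_le : ∀ j, 1 ≤ lam j + γ
  gamma_le : ∀ j, K ≤ j → γ ≤ lam j
  lam_pos : ∀ j, K ≤ j → 0 < lam j
  exp_le : ∀ j, K ≤ j → Real.exp (-lam j * T) ≤ 1 / 2

variable {H : Type*} [NormedAddCommGroup H] [InnerProductSpace ℝ H]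
  {X : HilbertBasis ℕ ℝ H} {lam : ℕ → ℝ} {γ T : ℝ} {K : ℕ}

/-- The functions `u j` solve `u' + lam j u = √(lam j + γ) h_j`, and `y` has the coordinates
`√(lam j + γ) u j`. -/
structure IsModalFamily (X : HilbertBasis ℕ ℝ H) (lam : ℕ → ℝ) (γ T : ℝ) (h y : ℝ → H)
    (u : ℕ → ℝ → ℝ) : Prop where
  coord : ∀ᵐ t ∂volume.restrict (Ioo 0 T), ∀ j, inner ℝ (X j) (y t) = √(lam j + γ) * u j t
  mode : ∀ j, HasPrimitive T (u j)
    (fun s => √(lam j + γ) * inner ℝ (X j) (h s) - lam j * u j s)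

/-- A bound for the energy of the `j`-th mode. -/
noncomputable def modeBound (X : HilbertBasis ℕ ℝ H) (γ T : ℝ) (K : ℕ) (h : ℝ → H)
    (u : ℕ → ℝ → ℝ) (j : ℕ) : ℝ :=
  ((if j < K then u j 0 ^ 2 else 0)
    + 8 * Real.exp (2 * γ * T) * ∫ t, inner ℝ (X j) (highModes X K (h t)) ^ 2 ∂weighted γ T)
    + ∫ t, inner ℝ (X j) (h t) ^ 2 ∂weighted γ T

/-- The sum of the bounds for the energies of all modes. -/
noncomputable def totalBound (X : HilbertBasis ℕ ℝ H) (γ T : ℝ) (K : ℕ) (h : ℝ → H)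
    (u : ℕ → ℝ → ℝ) : ℝ :=
  ((∑ j ∈ Finset.range K, u j 0 ^ 2)
    + 8 * Real.exp (2 * γ * T) * ∫ t, ‖highModes X K (h t)‖ ^ 2 ∂weighted γ T)
    + ∫ t, ‖h t‖ ^ 2 ∂weighted γ T

theorem hasSum_modeBound {h : ℝ → H} {u : ℕ → ℝ → ℝ} (hh : MemLp h 2 (weighted γ T)) :
    HasSum (modeBound X γ T K h u) (totalBound X γ T K h u) := by
  refine HasSum.add (HasSum.add ?_ (HasSum.mul_left _ ?_)) (hasSum_integral_coord_sq X hh)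
  · have : ∑ j ∈ Finset.range K, u j 0 ^ 2
        = ∑ j ∈ Finset.range K, (if j < K then u j 0 ^ 2 else 0) :=
      Finset.sum_congr rfl fun j hj => by rw [if_pos (Finset.mem_range.mp hj)]
    rw [this]
    exact hasSum_sum_of_ne_finset_zero fun j hj => by
      rw [if_neg (by simpa using hj)]
  · exact hasSum_integral_coord_sq X ((highModes X K).comp_memLp' hh)

/-- The energy inequality with c = γ divides the squared source by λ_j + γ, which cancels the square
of √(λ_j+γ): the bound is uniform in j. There remains u_j(0)², which is data for j < K and is
otherwise controlled by periodicity. -/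
theorem mode_energy_le (hS : SpectralGap lam γ T K) {h : ℝ → H} {u : ℕ → ℝ → ℝ}
    (hh : MemLp h 2 (weighted γ T)) {j : ℕ}
    (hu : HasPrimitive T (u j) (fun s => √(lam j + γ) * inner ℝ (X j) (h s) - lam j * u j s))
    (hper : K ≤ j → u j 0 = u j T) {t : ℝ} (ht : t ∈ Icc 0 T) :
    Real.exp (-2 * γ * t) * u j t ^ 2
        + (lam j + γ) * (∫ s in (0 : ℝ)..t, Real.exp (-2 * γ * s) * u j s ^ 2) ≤
      modeBound X γ T K h u j := by
  have hμ : 0 < lam j + γ := by linarith [hS.one_le j]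
  have hj : MemLp (fun s => inner ℝ (X j) (h s)) 2 (weighted γ T) := MemLp.coord X hh j
  have hj' := (memLp_weighted_iff hS.gamma_nonneg).mp hj
  have hg : MemLp (fun s => √(lam j + γ) * inner ℝ (X j) (h s)) 2 (volume.restrict (Ioo 0 T)) :=
    hj'.const_mul _
  have h1 := hu.energy hg hμ ht
  have hsq : ∀ s, (√(lam j + γ) * inner ℝ (X j) (h s)) ^ 2
      = (lam j + γ) * inner ℝ (X j) (h s) ^ 2 := fun s => by
    rw [mul_pow, Real.sq_sqrt hμ.le]
  have h2 : (lam j + γ)⁻¹ * (∫ s in (0 : ℝ)..t, Real.exp (-2 * γ * s) *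
      (√(lam j + γ) * inner ℝ (X j) (h s)) ^ 2) ≤ ∫ s, inner ℝ (X j) (h s) ^ 2 ∂weighted γ T := by
    have : (fun s => Real.exp (-2 * γ * s) * (√(lam j + γ) * inner ℝ (X j) (h s)) ^ 2)
        = fun s => (lam j + γ) * (Real.exp (-2 * γ * s) * inner ℝ (X j) (h s) ^ 2) := by
      ext s; rw [hsq]; ring
    rw [this, intervalIntegral.integral_const_mul, inv_mul_cancel_left₀ hμ.ne', integral_weighted,
      intervalIntegral.integral_of_le ht.1, integral_Ioc_eq_integral_Ioo]
    refine setIntegral_mono_set ?_ (Filter.Eventually.of_forall fun s => by positivity)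
      (Ioo_subset_Ioo_right ht.2).eventuallyLE
    refine (hj'.integrable_sq).mono ((by fun_prop : Continuous fun s : ℝ =>
      Real.exp (-2 * γ * s)).aestronglyMeasurable.mul hj'.integrable_sq.1) ?_
    filter_upwards [ae_restrict_mem measurableSet_Ioo] with s hs
    rw [norm_mul, Real.norm_of_nonneg (Real.exp_pos _).le]
    refine mul_le_of_le_one_left (norm_nonneg _) (Real.exp_le_one_iff.mpr ?_)
    nlinarith [hs.1, hS.gamma_nonneg]
  refine h1.trans (add_le_add ?_ h2)
  have hpos : 0 ≤ ∫ t, inner ℝ (X j) (highModes X K (h t)) ^ 2 ∂weighted γ T :=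
    integral_nonneg fun t => sq_nonneg _
  by_cases hjK : j < K
  · rw [if_pos hjK]
    exact le_add_of_nonneg_right (by positivity)
  · have hK := not_lt.mp hjK
    have hl := hS.lam_pos j hK
    have h3 := hu.periodic_le hg hS.T_pos hl (hS.exp_le j hK) (hper hK)
    simp only [inner_highModes, if_neg hjK, zero_add]
    simp only [hsq] at h3
    rw [intervalIntegral.integral_const_mul, intervalIntegral.integral_of_le hS.T_pos.le,
      integral_Ioc_eq_integral_Ioo] at h3
    have h4 := integral_le_weighted (T := T) hS.gamma_nonneg hj.integrable_sq
      fun s => sq_nonneg _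
    have h5 : 0 ≤ ∫ s in Ioo 0 T, inner ℝ (X j) (h s) ^ 2 :=
      integral_nonneg fun s => sq_nonneg _
    calc u j 0 ^ 2 ≤ _ := h3
      _ = (4 * (lam j + γ) / lam j) * ∫ s in Ioo 0 T, inner ℝ (X j) (h s) ^ 2 := by ring
      -- On high modes γ ≤ λ_j, so 4(λ_j+γ)/λ_j ≤ 8.
      _ ≤ 8 * ∫ s in Ioo 0 T, inner ℝ (X j) (h s) ^ 2 := by
          refine mul_le_mul_of_nonneg_right ?_ h5
          rw [div_le_iff₀ hl]
          linarith [hS.gamma_le j hK]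
      _ ≤ 8 * (Real.exp (2 * γ * T) * ∫ s, inner ℝ (X j) (h s) ^ 2 ∂weighted γ T) := by gcongr
      _ = _ := by ring

/-- The bound is uniform in t and summable in j; it gives both the supremum estimate and the
continuity in time of the sum of the modes. -/
theorem mode_sq_le (hS : SpectralGap lam γ T K) {h : ℝ → H} {u : ℕ → ℝ → ℝ}
    (hh : MemLp h 2 (weighted γ T)) {j : ℕ}
    (hu : HasPrimitive T (u j) (fun s => √(lam j + γ) * inner ℝ (X j) (h s) - lam j * u j s))
    (hper : K ≤ j → u j 0 = u j T) {t : ℝ} (ht : t ∈ Icc 0 T) :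
    u j t ^ 2 ≤ Real.exp (2 * γ * T) * modeBound X γ T K h u j := by
  have h1 := mode_energy_le hS hh hu hper ht
  have hμ : 0 < lam j + γ := by linarith [hS.one_le j]
  have h2 : 0 ≤ (lam j + γ) * ∫ s in (0 : ℝ)..t, Real.exp (-2 * γ * s) * u j s ^ 2 :=
    mul_nonneg hμ.le (intervalIntegral.integral_nonneg ht.1 fun s _ => by positivity)
  have h3 : Real.exp (-2 * γ * t) * u j t ^ 2 ≤ modeBound X γ T K h u j := by linarith
  have h4 : Real.exp (2 * γ * t) * Real.exp (-2 * γ * t) = 1 := by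
    rw [← Real.exp_add]; simp
  calc u j t ^ 2 = Real.exp (2 * γ * t) * (Real.exp (-2 * γ * t) * u j t ^ 2) := by
        rw [← mul_assoc, h4, one_mul]
    _ ≤ Real.exp (2 * γ * t) * modeBound X γ T K h u j := by gcongr
    _ ≤ _ := by
      have : 0 ≤ modeBound X γ T K h u j := le_trans (by positivity) h3
      have := hS.gamma_nonneg
      gcongr
      exact ht.2

theorem mode_integral_le (hS : SpectralGap lam γ T K) {h : ℝ → H} {u : ℕ → ℝ → ℝ}
    (hh : MemLp h 2 (weighted γ T)) {j : ℕ}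
    (hu : HasPrimitive T (u j) (fun s => √(lam j + γ) * inner ℝ (X j) (h s) - lam j * u j s))
    (hper : K ≤ j → u j 0 = u j T) :
    ∫ t, (√(lam j + γ) * u j t) ^ 2 ∂weighted γ T ≤ modeBound X γ T K h u j := by
  have h1 := mode_energy_le hS hh hu hper (t := T) ⟨hS.T_pos.le, le_rfl⟩
  have hμ : 0 < lam j + γ := by linarith [hS.one_le j]
  have h2 : 0 ≤ Real.exp (-2 * γ * T) * u j T ^ 2 := by positivity
  simp only [mul_pow, Real.sq_sqrt hμ.le]
  rw [integral_const_mul, integral_weighted, ← integral_Ioc_eq_integral_Ioo,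
    ← intervalIntegral.integral_of_le hS.T_pos.le]
  linarith

/-- The energy estimate for families of modes, the high ones being periodic. -/
theorem IsModalFamily.integral_le (hS : SpectralGap lam γ T K) {h y : ℝ → H} {u : ℕ → ℝ → ℝ}
    (hu : IsModalFamily X lam γ T h y u) (hh : MemLp h 2 (weighted γ T))
    (hy : MemLp y 2 (weighted γ T)) (hper : ∀ j, K ≤ j → u j 0 = u j T) :
    ∫ t, ‖y t‖ ^ 2 ∂weighted γ T ≤ totalBound X γ T K h u := by
  refine hasSum_le (fun j => ?_) (hasSum_integral_coord_sq X hy) (hasSum_modeBound (u := u) hh)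
  refine le_of_eq_of_le (integral_congr_ae ?_) (mode_integral_le hS hh (hu.mode j) (hper j))
  filter_upwards [(ae_weighted_iff hS.gamma_nonneg).mpr hu.coord] with t ht
  rw [ht]

theorem memLp_continuousOn {E : Type*} [NormedAddCommGroup E] {c : ℝ → E} (hc : ContinuousOn c (Icc 0 T)) :
    MemLp c 2 (volume.restrict (Ioo 0 T)) := by
  obtain ⟨B, hB⟩ := isCompact_Icc.exists_bound_of_continuousOn hc
  refine MemLp.of_bound ((hc.mono Ioo_subset_Icc_self).aestronglyMeasurable measurableSet_Ioo) B ?_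
  filter_upwards [ae_restrict_mem measurableSet_Ioo] with t ht
  exact hB t (Ioo_subset_Icc_self ht)

/-- With h given the modes decouple: Duhamel's formula serves for j < K, the periodic solution for j
≥ K. Summability of the mode bounds allows the coordinates to be assembled into y. -/
theorem exists_modalFamily (hS : SpectralGap lam γ T K) {h : ℝ → H}
    (hh : MemLp h 2 (weighted γ T)) (a : ℕ → ℝ) :
    ∃ (y : ℝ → H) (u : ℕ → ℝ → ℝ), MemLp y 2 (weighted γ T) ∧ IsModalFamily X lam γ T h y u ∧
      (∀ j, j < K → u j 0 = a j) ∧ ∀ j, K ≤ j → u j 0 = u j T := by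
  have hT := hS.T_pos
  have hex : ∀ j, ∃ u : ℝ → ℝ, HasPrimitive T u
      (fun s => √(lam j + γ) * inner ℝ (X j) (h s) - lam j * u s) ∧
      (j < K → u 0 = a j) ∧ (K ≤ j → u 0 = u T) := by
    intro j
    have hg : IntervalIntegrable (fun s => √(lam j + γ) * inner ℝ (X j) (h s)) volume 0 T := by
      rw [intervalIntegrable_iff_integrableOn_Ioo_of_le hT.le]
      exact (((memLp_weighted_iff hS.gamma_nonneg).mp (MemLp.coord X hh j)).const_mul
        _).integrable (by norm_num)
    by_cases hj : j < K
    · exact ⟨_, HasPrimitive.duhamel (lam := lam j) hg hT.le (a j), by simp,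
        fun hK => absurd hj (not_lt.mpr hK)⟩
    · obtain ⟨u, hu, hp⟩ := HasPrimitive.exists_periodic hg hT (hS.lam_pos j (not_lt.mp hj))
      exact ⟨u, hu, fun h => absurd h hj, fun _ => hp⟩
  choose u hu ha hp using hex
  obtain ⟨y, hy, hc⟩ := exists_memLp_coord_eq X (μ := weighted γ T)
    (c := fun j t => √(lam j + γ) * u j t)
    (fun j => ((memLp_weighted_iff hS.gamma_nonneg).mpr
      (memLp_continuousOn (hu j).continuousOn)).const_mul _)
    ((hasSum_modeBound (K := K) (u := u) hh).summable.of_nonneg_of_le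
      (fun j => integral_nonneg fun t => sq_nonneg _)
      (fun j => mode_integral_le hS hh (hu j) (hp j)))
  exact ⟨y, u, hy, ⟨(ae_weighted_iff hS.gamma_nonneg).mp hc, hu⟩, ha, hp⟩

theorem HasPrimitive.sub {T : ℝ} {u u' w w' : ℝ → ℝ} (h : HasPrimitive T u u')
    (k : HasPrimitive T w w') : HasPrimitive T (fun t => u t - w t) (fun t => u' t - w' t) :=
  ⟨h.integrable.sub k.integrable, fun t ht => by
    rw [intervalIntegral.integral_sub (h.intervalIntegrable ht) (k.intervalIntegrable ht),
      h.eq_integral t ht, k.eq_integral t ht]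
    ring⟩

theorem IsModalFamily.sub {h y h' y' : ℝ → H} {u u' : ℕ → ℝ → ℝ}
    (hu : IsModalFamily X lam γ T h y u) (hu' : IsModalFamily X lam γ T h' y' u') :
    IsModalFamily X lam γ T (fun t => h t - h' t) (fun t => y t - y' t)
      (fun j t => u j t - u' j t) where
  coord := by
    filter_upwards [hu.coord, hu'.coord] with t h1 h2 j
    rw [inner_sub_right, h1, h2, mul_sub]
  mode j := by
    convert (hu.mode j).sub (hu'.mode j) using 2 with s
    rw [inner_sub_right]; ring

/-- A measurable family of operators that is small, and very small on the high modes. -/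
structure IsSmallFamily (X : HilbertBasis ℕ ℝ H) (γ T : ℝ) (K : ℕ) (E : ℝ → H →L[ℝ] H) :
    Prop where
  measurable : ∀ i j, AEStronglyMeasurable (fun t => inner ℝ (E t (X i)) (X j))
    (volume.restrict (Ioo 0 T))
  bound : ∀ t v, ‖E t v‖ ^ 2 ≤ 1 / 16 * ‖v‖ ^ 2
  bound_high : ∀ t v, 8 * Real.exp (2 * γ * T) * ‖highModes X K (E t v)‖ ^ 2 ≤ 1 / 16 * ‖v‖ ^ 2

/-- Measurability of the matrix entries suffices, since each E(t) is continuous and so commutes with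
the expansion of y(t). -/
theorem IsSmallFamily.aestronglyMeasurable {E : ℝ → H →L[ℝ] H} (hE : IsSmallFamily X γ T K E)
    {y : ℝ → H} (hy : AEStronglyMeasurable y (volume.restrict (Ioo 0 T))) :
    AEStronglyMeasurable (fun t => E t (y t)) (volume.restrict (Ioo 0 T)) := by
  refine aestronglyMeasurable_of_coord X fun j => ?_
  refine aestronglyMeasurable_of_tendsto_ae (u := Filter.atTop)
    (f := fun N t => ∑ i ∈ Finset.range N, inner ℝ (X i) (y t) * inner ℝ (E t (X i)) (X j))
    (fun N => Finset.aestronglyMeasurable_fun_sum _ fun i _ => ?_)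
    (Filter.Eventually.of_forall fun t => ?_)
  · exact (aestronglyMeasurable_const.inner hy).mul (hE.measurable i j)
  · have h1 : Continuous fun v => inner ℝ (X j) (E t v) :=
      continuous_const.inner (E t).continuous
    refine ((h1.tendsto _).comp (tendsto_basis_sum X (y t))).congr fun N => ?_
    simp only [Function.comp, map_sum, map_smul, inner_sum, inner_smul_right]
    exact Finset.sum_congr rfl fun i _ => by rw [real_inner_comm (E t (X i)) (X j)]

theorem IsSmallFamily.memLp (hγ : 0 ≤ γ) {E : ℝ → H →L[ℝ] H} (hE : IsSmallFamily X γ T K E)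
    {y : ℝ → H} (hy : MemLp y 2 (weighted γ T)) :
    MemLp (fun t => E t (y t)) 2 (weighted γ T) := by
  rw [memLp_weighted_iff hγ] at hy ⊢
  refine hy.mono (hE.aestronglyMeasurable hy.1) (Filter.Eventually.of_forall fun t => ?_)
  have := hE.bound t (y t)
  exact (sq_le_sq₀ (norm_nonneg _) (norm_nonneg _)).mp (by nlinarith [sq_nonneg ‖y t‖])

/-- The left side is the part of `totalBound` that depends on h, for h = E y; each of the two bounds
contributes 1/16. -/
theorem IsSmallFamily.integral_le (hγ : 0 ≤ γ) {E : ℝ → H →L[ℝ] H} (hE : IsSmallFamily X γ T K E)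
    {y : ℝ → H} (hy : MemLp y 2 (weighted γ T)) :
    8 * Real.exp (2 * γ * T) * (∫ t, ‖highModes X K (E t (y t))‖ ^ 2 ∂weighted γ T)
      + ∫ t, ‖E t (y t)‖ ^ 2 ∂weighted γ T ≤ 1 / 8 * ∫ t, ‖y t‖ ^ 2 ∂weighted γ T := by
  have hEy := hE.memLp hγ hy
  have i1 : Integrable (fun t => ‖E t (y t)‖ ^ 2) (weighted γ T) := hEy.norm.integrable_sq
  have i2 : Integrable (fun t => ‖highModes X K (E t (y t))‖ ^ 2) (weighted γ T) :=
    ((highModes X K).comp_memLp' hEy).norm.integrable_sq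
  have i3 : Integrable (fun t => ‖y t‖ ^ 2) (weighted γ T) := hy.norm.integrable_sq
  rw [← integral_const_mul, ← integral_add (i2.const_mul _) i1, ← integral_const_mul]
  refine integral_mono ((i2.const_mul _).add i1) (i3.const_mul _) fun t => ?_
  have h1 := hE.bound t (y t)
  have h2 := hE.bound_high t (y t)
  simp only [] at h1 h2 ⊢
  linarith

/-- Existence for the perturbed system of modes, by contraction. -/
theorem exists_modalFamily_perturbed [CompleteSpace H] (hS : SpectralGap lam γ T K)
    {E : ℝ → H →L[ℝ] H} (hE : IsSmallFamily X γ T K E) {F : ℝ → H}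
    (hF : MemLp F 2 (weighted γ T)) (a : ℕ → ℝ) :
    ∃ (y : ℝ → H) (u : ℕ → ℝ → ℝ), MemLp y 2 (weighted γ T) ∧
      IsModalFamily X lam γ T (fun t => F t - E t (y t)) y u ∧
      (∀ j, j < K → u j 0 = a j) ∧ ∀ j, K ≤ j → u j 0 = u j T := by
  have hγ := hS.gamma_nonneg
  have hex : ∀ z : Lp H 2 (weighted γ T), ∃ (w : Lp H 2 (weighted γ T)) (u : ℕ → ℝ → ℝ),
      IsModalFamily X lam γ T (fun t => F t - E t (z t)) w u ∧
      (∀ j, j < K → u j 0 = a j) ∧ ∀ j, K ≤ j → u j 0 = u j T := by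
    intro z
    obtain ⟨y, u, hy, hu, ha, hp⟩ := exists_modalFamily (X := X) hS
      (hF.sub (hE.memLp hγ (Lp.memLp z))) a
    refine ⟨hy.toLp y, u, ⟨?_, hu.mode⟩, ha, hp⟩
    filter_upwards [hu.coord, (ae_weighted_iff hγ).mp hy.coeFn_toLp] with t h1 h2
    rwa [h2]
  -- Any selection will do: the estimate below compares arbitrary solution families for two inputs.
  choose Φ u hu ha hp using hex
  have hcontr : ContractingWith (1 / 2) Φ := by
    refine ⟨by rw [← NNReal.coe_lt_coe]; norm_num, LipschitzWith.of_dist_le_mul fun z z' => ?_⟩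
    rw [dist_eq_norm, dist_eq_norm]
    have hm : MemLp (fun t => z' t - z t) 2 (weighted γ T) := (Lp.memLp z').sub (Lp.memLp z)
    have h1 := ((hu z).sub (hu z')).integral_le hS
      ((hF.sub (hE.memLp hγ (Lp.memLp z))).sub (hF.sub (hE.memLp hγ (Lp.memLp z'))))
      ((Lp.memLp _).sub (Lp.memLp _)) (fun j hj => by rw [hp z j hj, hp z' j hj])
    have h2 : ∀ t, F t - E t (z t) - (F t - E t (z' t)) = E t (z' t - z t) := fun t => by
      rw [map_sub]; abel
    have h3 := hE.integral_le hγ hm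
    simp only [totalBound, h2] at h1
    -- The low initial values are the same for both inputs, so only the smallness of E enters. It
    -- gives the factor 1/8 for the squares, and 1/8 ≤ (1/2)².
    have h4 : ∑ j ∈ Finset.range K, (u z j 0 - u z' j 0) ^ 2 = 0 :=
      Finset.sum_eq_zero fun j hj => by
        rw [ha z j (Finset.mem_range.mp hj), ha z' j (Finset.mem_range.mp hj)]; simp
    rw [h4, zero_add] at h1
    have h5 := h1.trans h3
    have e1 : ∫ t, ‖Φ z t - Φ z' t‖ ^ 2 ∂weighted γ T = ‖Φ z - Φ z'‖ ^ 2 := by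
      rw [Lp_norm_sq_eq_integral]
      refine integral_congr_ae ?_
      filter_upwards [Lp.coeFn_sub (Φ z) (Φ z')] with t ht
      rw [ht, Pi.sub_apply]
    have e2 : ∫ t, ‖z' t - z t‖ ^ 2 ∂weighted γ T = ‖z - z'‖ ^ 2 := by
      rw [Lp_norm_sq_eq_integral]
      refine integral_congr_ae ?_
      filter_upwards [Lp.coeFn_sub z z'] with t ht
      rw [ht, Pi.sub_apply, norm_sub_rev]
    rw [e1, e2] at h5
    refine abs_le_of_sq_le_sq' ?_ (by positivity) |>.2
    rw [mul_pow]
    norm_num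
    nlinarith [sq_nonneg ‖z - z'‖]
  set y := hcontr.fixedPoint
  have hy : Φ y = y := hcontr.fixedPoint_isFixedPt
  refine ⟨y, u y, Lp.memLp y, ?_, ha y, hp y⟩
  have := hu y
  rwa [hy] at this

/-- The a priori estimate for the perturbed system of modes. -/
theorem IsModalFamily.totalBound_le (hS : SpectralGap lam γ T K) {E : ℝ → H →L[ℝ] H}
    (hE : IsSmallFamily X γ T K E) {F y : ℝ → H} {u : ℕ → ℝ → ℝ}
    (hu : IsModalFamily X lam γ T (fun t => F t - E t (y t)) y u) (hF : MemLp F 2 (weighted γ T))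
    (hy : MemLp y 2 (weighted γ T)) (hper : ∀ j, K ≤ j → u j 0 = u j T) :
    totalBound X γ T K (fun t => F t - E t (y t)) u ≤
      2 * (∑ j ∈ Finset.range K, u j 0 ^ 2) + 4 * ((∫ t, ‖F t‖ ^ 2 ∂weighted γ T)
        + 8 * Real.exp (2 * γ * T) * ∫ t, ‖highModes X K (F t)‖ ^ 2 ∂weighted γ T) := by
  have hγ := hS.gamma_nonneg
  have hEy := hE.memLp hγ hy
  have h1 := hu.integral_le hS (hF.sub hEy) hy hper
  have h2 := hE.integral_le hγ hy
  have key : ∀ {A B : ℝ → H}, MemLp A 2 (weighted γ T) → MemLp B 2 (weighted γ T) →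
      ∫ t, ‖A t - B t‖ ^ 2 ∂weighted γ T ≤
        2 * (∫ t, ‖A t‖ ^ 2 ∂weighted γ T) + 2 * ∫ t, ‖B t‖ ^ 2 ∂weighted γ T := by
    intro A B hA hB
    have iA : Integrable (fun t => ‖A t‖ ^ 2) (weighted γ T) := hA.norm.integrable_sq
    have iB : Integrable (fun t => ‖B t‖ ^ 2) (weighted γ T) := hB.norm.integrable_sq
    rw [← integral_const_mul, ← integral_const_mul,
      ← integral_add (iA.const_mul _) (iB.const_mul _)]
    refine integral_mono (hA.sub hB).norm.integrable_sq
      ((iA.const_mul _).add (iB.const_mul _)) fun t => ?_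
    have := parallelogram_law_with_norm ℝ (A t) (B t)
    nlinarith [sq_nonneg ‖A t + B t‖]
  have h3 := key hF hEy
  have h4 := key ((highModes X K).comp_memLp' hF) ((highModes X K).comp_memLp' hEy)
  simp only [Function.comp, ← map_sub] at h4
  have h6 : 8 * Real.exp (2 * γ * T)
      * ∫ t, ‖highModes X K (F t - E t (y t))‖ ^ 2 ∂weighted γ T ≤ 8 * Real.exp (2 * γ * T)
      * (2 * (∫ t, ‖highModes X K (F t)‖ ^ 2 ∂weighted γ T)
        + 2 * ∫ t, ‖highModes X K (E t (y t))‖ ^ 2 ∂weighted γ T) := by gcongr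
  have p1 : 0 ≤ ∑ j ∈ Finset.range K, u j 0 ^ 2 := by positivity
  have p2 : 0 ≤ ∫ t, ‖F t‖ ^ 2 ∂weighted γ T := integral_nonneg fun t => by positivity
  have p3 : 0 ≤ 8 * Real.exp (2 * γ * T) * ∫ t, ‖highModes X K (F t)‖ ^ 2 ∂weighted γ T :=
    mul_nonneg (by positivity) (integral_nonneg fun t => by positivity)
  -- Write R for the total bound, A for the initial sum and N for the bracket in F. The
  -- parallelogram law gives R ≤ A + 2N + 2 · (1/8)∫‖y‖², and ∫‖y‖² ≤ R, so a quarter of R is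
  -- absorbed.
  simp only [totalBound] at h1 ⊢
  linarith

end ApproxPeriodic

/-! ### The bilinear form of L₀ and Gårding's inequality. -/

namespace ApproxPeriodic

section MulForm

variable {α : Type*} [MeasurableSpace α] {μ : Measure α}

theorem integrable_mul_mul {m : α → ℝ} (hm : MemLp m ∞ μ) (p r : Lp ℝ 2 μ) :
    Integrable (fun x => m x * p x * r x) μ := by
  have h1 : MemLp (fun x => m x * p x) 2 μ := (Lp.memLp p).mul' hm
  exact h1.integrable_mul (Lp.memLp r)

/-- The bounded bilinear form `∫ m p r` on `L²` for a bounded function `m`. -/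
noncomputable def mulForm {m : α → ℝ} (hm : MemLp m ∞ μ) : Lp ℝ 2 μ →L[ℝ] Lp ℝ 2 μ →L[ℝ] ℝ :=
  LinearMap.mkContinuous₂
    (LinearMap.mk₂ ℝ (fun p r => ∫ x, m x * p x * r x ∂μ)
      (fun p p' r => by
        rw [← integral_add (integrable_mul_mul hm p r) (integrable_mul_mul hm p' r)]
        refine integral_congr_ae ?_
        filter_upwards [Lp.coeFn_add p p'] with x hx
        rw [hx, Pi.add_apply]; ring)
      (fun k p r => by
        rw [smul_eq_mul, ← integral_const_mul]
        refine integral_congr_ae ?_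
        filter_upwards [Lp.coeFn_smul k p] with x hx
        rw [hx, Pi.smul_apply, smul_eq_mul]; ring)
      (fun p r r' => by
        rw [← integral_add (integrable_mul_mul hm p r) (integrable_mul_mul hm p r')]
        refine integral_congr_ae ?_
        filter_upwards [Lp.coeFn_add r r'] with x hx
        rw [hx, Pi.add_apply]; ring)
      (fun k p r => by
        rw [smul_eq_mul, ← integral_const_mul]
        refine integral_congr_ae ?_
        filter_upwards [Lp.coeFn_smul k r] with x hx
        rw [hx, Pi.smul_apply, smul_eq_mul]; ring))
    (eLpNorm m ∞ μ).toReal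
    (fun p r => by
      have h1 : MemLp (fun x => m x * p x) 2 μ := (Lp.memLp p).mul' hm
      have h2 : ∫ x, m x * p x * r x ∂μ = inner ℝ (h1.toLp _) r := by
        rw [L2.inner_def]
        refine integral_congr_ae ?_
        filter_upwards [h1.coeFn_toLp] with x hx
        rw [hx, real_inner_eq_re_inner]; simp [mul_comm]
      have h3 : ‖h1.toLp _‖ ≤ (eLpNorm m ∞ μ).toReal * ‖p‖ := by
        refine Lp.norm_le_mul_norm_of_ae_le_mul ?_
        filter_upwards [h1.coeFn_toLp, ae_le_eLpNormEssSup (f := m) (μ := μ)] with x hx hb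
        rw [hx, norm_mul]
        gcongr
        rw [← eLpNorm_exponent_top] at hb
        exact (ENNReal.ofReal_le_iff_le_toReal hm.2.ne).mp (by rwa [ofReal_norm])
      rw [LinearMap.mk₂_apply, h2, Real.norm_eq_abs]
      refine (abs_real_inner_le_norm _ _).trans ?_
      gcongr)

end MulForm

variable {n : ℕ} {Ω : Set (Space n)}

/-- The `i`-th component of a square integrable vector field. -/
noncomputable def component (i : Fin n) : L2vec Ω →L[ℝ] L2 Ω :=
  (EuclideanSpace.proj i : Space n →L[ℝ] ℝ).compLpL 2 _

theorem coeFn_component (i : Fin n) (g : L2vec Ω) :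
    component i g =ᵐ[volume.restrict Ω] fun x => g x i :=
  (EuclideanSpace.proj i : Space n →L[ℝ] ℝ).coeFn_compLp g

theorem memLp_top_of_lipschitzOnWith (hΩ : IsC2Domain Ω) {f : Space n → ℝ} {k : ℝ≥0}
    (hf : LipschitzOnWith k f (closure Ω)) : MemLp f ∞ (volume.restrict Ω) := by
  have hc : IsCompact (closure Ω) := hΩ.isBounded.isCompact_closure
  obtain ⟨B, hB⟩ := hc.exists_bound_of_continuousOn hf.continuousOn
  refine memLp_top_of_bound ((hf.continuousOn.mono subset_closure).aestronglyMeasurable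
    hΩ.isOpen.measurableSet) B ?_
  filter_upwards [ae_restrict_mem hΩ.isOpen.measurableSet] with x hx
  exact hB x (subset_closure hx)

namespace EllipticOperator

theorem a_memLp (L₀ : EllipticOperator Ω) (hΩ : IsC2Domain Ω) (i j : Fin n) :
    MemLp (L₀.a i j) ∞ (volume.restrict Ω) :=
  memLp_top_of_lipschitzOnWith hΩ (L₀.a_lipschitz i j).choose_spec

theorem b_memLp (L₀ : EllipticOperator Ω) (hΩ : IsC2Domain Ω) (i : Fin n) :
    MemLp (L₀.b i) ∞ (volume.restrict Ω) :=
  memLp_top_of_lipschitzOnWith hΩ (L₀.b_lipschitz i).choose_spec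

/-- The bilinear form `∫ m (P z) (R z')` for bounded operators `P` and `R` into `L²(Ω)`. -/
noncomputable def mulFormComp {m : Space n → ℝ} (hm : MemLp m ∞ (volume.restrict Ω))
    (P R : (L2 Ω × L2vec Ω) →L[ℝ] L2 Ω) :
    (L2 Ω × L2vec Ω) →L[ℝ] (L2 Ω × L2vec Ω) →L[ℝ] ℝ :=
  (mulForm hm).bilinearComp P R

/-- The operator `(v, g) ↦ v`. -/
noncomputable def valueMap (Ω : Set (Space n)) : (L2 Ω × L2vec Ω) →L[ℝ] L2 Ω :=
  ContinuousLinearMap.fst ℝ _ _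

/-- The operator `(v, g) ↦ gᵢ`. -/
noncomputable def gradMap (Ω : Set (Space n)) (i : Fin n) : (L2 Ω × L2vec Ω) →L[ℝ] L2 Ω :=
  (component i).comp (ContinuousLinearMap.snd ℝ _ _)

theorem mulFormComp_apply {m : Space n → ℝ} (hm : MemLp m ∞ (volume.restrict Ω))
    (P R : (L2 Ω × L2vec Ω) →L[ℝ] L2 Ω) (z z' : L2 Ω × L2vec Ω) :
    mulFormComp hm P R z z' = ∫ x in Ω, m x * P z x * R z' x := rfl

/-- The bilinear form of `L₀` as a bounded bilinear form on `L²(Ω) × L²(Ω; ℝⁿ)`. -/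
noncomputable def formL (L₀ : EllipticOperator Ω) (hΩ : IsC2Domain Ω) :
    (L2 Ω × L2vec Ω) →L[ℝ] (L2 Ω × L2vec Ω) →L[ℝ] ℝ :=
  (∑ i, ∑ j, mulFormComp (L₀.a_memLp hΩ i j) (gradMap Ω i) (gradMap Ω j))
    + (∑ i, mulFormComp (L₀.b_memLp hΩ i) (gradMap Ω i) (valueMap Ω))
    + (∑ i, mulFormComp (L₀.b_memLp hΩ i) (valueMap Ω) (gradMap Ω i))
    + mulFormComp L₀.c_bounded (valueMap Ω) (valueMap Ω)

theorem integrable_form (L₀ : EllipticOperator Ω) (hΩ : IsC2Domain Ω)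
    (v : L2 Ω) (g : L2vec Ω) (w : L2 Ω) (h : L2vec Ω) :
    Integrable (fun x => (∑ i, ∑ j, L₀.a i j x * g x i * h x j)
    + (∑ i, L₀.b i x * g x i * w x) + (∑ i, L₀.b i x * v x * h x i)
    + L₀.c x * v x * w x) (volume.restrict Ω) := by
  have hA : ∀ i j, Integrable (fun x => L₀.a i j x * g x i * h x j) (volume.restrict Ω) :=
    fun i j => (integrable_mul_mul (L₀.a_memLp hΩ i j) (component i g) (component j h)).congr
      (by filter_upwards [coeFn_component i g, coeFn_component j h] with x h1 h2; rw [h1, h2])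
  have hB : ∀ i, Integrable (fun x => L₀.b i x * g x i * w x) (volume.restrict Ω) :=
    fun i => (integrable_mul_mul (L₀.b_memLp hΩ i) (component i g) w).congr
      (by filter_upwards [coeFn_component i g] with x h1; rw [h1])
  have hC : ∀ i, Integrable (fun x => L₀.b i x * v x * h x i) (volume.restrict Ω) :=
    fun i => (integrable_mul_mul (L₀.b_memLp hΩ i) v (component i h)).congr
      (by filter_upwards [coeFn_component i h] with x h1; rw [h1])
  exact (((integrable_finsetSum _ fun i _ => integrable_finsetSum _ fun j _ => hA i j).add
    (integrable_finsetSum _ fun i _ => hB i)).add (integrable_finsetSum _ fun i _ => hC i)).add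
    (integrable_mul_mul L₀.c_bounded v w)

/-- Through this identity the integral acquires linearity and continuity, so that eigenfunction
expansions may be inserted in it. -/
theorem formL_apply (L₀ : EllipticOperator Ω) (hΩ : IsC2Domain Ω)
    (v : L2 Ω) (g : L2vec Ω) (w : L2 Ω) (h : L2vec Ω) :
    L₀.formL hΩ (v, g) (w, h) = L₀.form v g w h := by
  have hA : ∀ i j, Integrable (fun x => L₀.a i j x * component i g x * component j h x)
      (volume.restrict Ω) :=
    fun i j => integrable_mul_mul (L₀.a_memLp hΩ i j) (component i g) (component j h)
  have hB : ∀ i, Integrable (fun x => L₀.b i x * component i g x * w x) (volume.restrict Ω) :=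
    fun i => integrable_mul_mul (L₀.b_memLp hΩ i) (component i g) w
  have hC : ∀ i, Integrable (fun x => L₀.b i x * v x * component i h x) (volume.restrict Ω) :=
    fun i => integrable_mul_mul (L₀.b_memLp hΩ i) v (component i h)
  have hD := integrable_mul_mul L₀.c_bounded v w
  have iA := integrable_finsetSum Finset.univ fun i _ =>
    integrable_finsetSum Finset.univ fun j _ => hA i j
  have iB := integrable_finsetSum Finset.univ fun i _ => hB i
  have iC := integrable_finsetSum Finset.univ fun i _ => hC i
  have iAB := iA.add iB
  have iABC := iAB.add iC
  simp only [Pi.add_def] at iAB iABC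
  have e1 : ∀ i, gradMap Ω i (v, g) = component i g := fun i => rfl
  have e2 : ∀ i, gradMap Ω i (w, h) = component i h := fun i => rfl
  have e3 : valueMap Ω (v, g) = v := rfl
  have e4 : valueMap Ω (w, h) = w := rfl
  simp only [formL, add_apply, sum_apply, mulFormComp_apply, e1, e2, e3, e4]
  simp only [← integral_finsetSum _ fun j _ => hA _ j]
  rw [← integral_finsetSum _ fun i _ => integrable_finsetSum _ fun j _ => hA i j,
    ← integral_finsetSum _ fun i _ => hB i, ← integral_finsetSum _ fun i _ => hC i,
    ← integral_add iA iB, ← integral_add iAB iC, ← integral_add iABC hD,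
    form]
  refine integral_congr_ae ?_
  have h1 : ∀ᵐ x ∂volume.restrict Ω, ∀ i, component i g x = g x i :=
    ae_all_iff.mpr fun i => coeFn_component i g
  have h2 : ∀ᵐ x ∂volume.restrict Ω, ∀ i, component i h x = h x i :=
    ae_all_iff.mpr fun i => coeFn_component i h
  filter_upwards [h1, h2] with x h1 h2
  simp only [h1, h2]

theorem form_symm (L₀ : EllipticOperator Ω) (hΩ : IsC2Domain Ω)
    (v : L2 Ω) (g : L2vec Ω) (w : L2 Ω) (h : L2vec Ω) :
    L₀.form v g w h = L₀.form w h v g := by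
  refine integral_congr_ae ?_
  filter_upwards [ae_restrict_mem hΩ.isOpen.measurableSet] with x hx
  have h1 : ∑ i, ∑ j, L₀.a i j x * g x i * h x j = ∑ i, ∑ j, L₀.a i j x * h x i * g x j := by
    rw [Finset.sum_comm]
    refine Finset.sum_congr rfl fun i _ => Finset.sum_congr rfl fun j _ => ?_
    rw [L₀.a_symm j i x (subset_closure hx)]; ring
  have h2 : ∑ i, L₀.b i x * g x i * w x = ∑ i, L₀.b i x * w x * g x i :=
    Finset.sum_congr rfl fun i _ => by ring
  have h3 : ∑ i, L₀.b i x * v x * h x i = ∑ i, L₀.b i x * h x i * v x :=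
    Finset.sum_congr rfl fun i _ => by ring
  rw [h1, h2, h3]; ring

theorem L2_norm_sq {α : Type*} [MeasurableSpace α] {μ : Measure α} (v : Lp ℝ 2 μ) :
    ‖v‖ ^ 2 = ∫ x, v x ^ 2 ∂μ := by
  rw [Lp_norm_sq_eq_integral]; simp

/-- Gårding's inequality. -/
theorem exists_garding (L₀ : EllipticOperator Ω) (hΩ : IsC2Domain Ω) :
    ∃ κ : ℝ, 0 ≤ κ ∧ ∀ (v : L2 Ω) (g : L2vec Ω),
      L₀.ell / 2 * ‖g‖ ^ 2 ≤ L₀.form v g v g + κ * ‖v‖ ^ 2 := by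
  have hb : ∃ B : ℝ, 0 ≤ B ∧ ∀ x ∈ closure Ω, ∑ i, |L₀.b i x| ≤ B := by
    have hc : IsCompact (closure Ω) := hΩ.isBounded.isCompact_closure
    have : ContinuousOn (fun x => ∑ i, |L₀.b i x|) (closure Ω) :=
      continuousOn_finsetSum _ fun i _ => (L₀.b_lipschitz i).choose_spec.continuousOn.abs
    obtain ⟨B, hB⟩ := hc.exists_bound_of_continuousOn this
    exact ⟨|B|, abs_nonneg _, fun x hx => (le_abs_self _).trans ((hB x hx).trans (le_abs_self B))⟩
  obtain ⟨B, hB0, hB⟩ := hb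
  set C := (eLpNorm L₀.c ∞ (volume.restrict Ω)).toReal
  have hC : ∀ᵐ x ∂volume.restrict Ω, |L₀.c x| ≤ C := by
    filter_upwards [ae_le_eLpNormEssSup (f := L₀.c) (μ := volume.restrict Ω)] with x hb
    rw [← eLpNorm_exponent_top] at hb
    exact (ENNReal.ofReal_le_iff_le_toReal L₀.c_bounded.2.ne).mp
      (by rwa [← Real.norm_eq_abs, ofReal_norm])
  have hell := L₀.ell_pos
  -- Young's inequality moves the two first order terms into half of the ellipticity, at the cost
  -- 2B²/ell; C bounds |c|. The inequality is pointwise in x, so g need not be the gradient of v.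
  refine ⟨2 * B ^ 2 / L₀.ell + C, by positivity, fun v g => ?_⟩
  have i1 : Integrable (fun x => ‖g x‖ ^ 2) (volume.restrict Ω) := (Lp.memLp g).norm.integrable_sq
  have i2 : Integrable (fun x => v x ^ 2) (volume.restrict Ω) := (Lp.memLp v).integrable_sq
  rw [L2_norm_sq, Lp_norm_sq_eq_integral, form, ← integral_const_mul, ← integral_const_mul,
    ← integral_add (L₀.integrable_form hΩ v g v g) (i2.const_mul _)]
  refine integral_mono_ae (i1.const_mul _)
    ((L₀.integrable_form hΩ v g v g).add (i2.const_mul _)) ?_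
  filter_upwards [hC, ae_restrict_mem hΩ.isOpen.measurableSet] with x hc hx
  have h1 := L₀.a_lower x (subset_closure hx) (g x)
  have h2 : |∑ i, L₀.b i x * g x i * v x| ≤ B * ‖g x‖ * |v x| := by
    refine (Finset.abs_sum_le_sum_abs _ _).trans ?_
    calc ∑ i, |L₀.b i x * g x i * v x| ≤ ∑ i, |L₀.b i x| * (‖g x‖ * |v x|) := by
          refine Finset.sum_le_sum fun i _ => ?_
          rw [abs_mul, abs_mul, mul_assoc]
          gcongr
          exact PiLp.norm_apply_le (g x) i
      _ = (∑ i, |L₀.b i x|) * (‖g x‖ * |v x|) := by rw [Finset.sum_mul]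
      _ ≤ B * (‖g x‖ * |v x|) := by gcongr; exact hB x (subset_closure hx)
      _ = _ := by ring
  have h3 : ∑ i, L₀.b i x * v x * g x i = ∑ i, L₀.b i x * g x i * v x :=
    Finset.sum_congr rfl fun i _ => by ring
  have h4 : -(C * v x ^ 2) ≤ L₀.c x * v x * v x := by
    have := (abs_le.mp hc).1
    nlinarith [sq_nonneg (v x)]
  have h5 : 2 * (B * ‖g x‖ * |v x|) ≤ L₀.ell / 2 * ‖g x‖ ^ 2 + 2 * B ^ 2 / L₀.ell * v x ^ 2 := by
    have h6 : 0 ≤ L₀.ell / 2 * (‖g x‖ - 2 * B / L₀.ell * |v x|) ^ 2 := by positivity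
    have h7 : L₀.ell / 2 * (‖g x‖ - 2 * B / L₀.ell * |v x|) ^ 2 = L₀.ell / 2 * ‖g x‖ ^ 2
        + 2 * B ^ 2 / L₀.ell * |v x| ^ 2 - 2 * (B * ‖g x‖ * |v x|) := by
      field_simp; ring
    rw [sq_abs] at h7
    linarith
  have h8 := (abs_le.mp h2).1
  simp only [h3]
  linarith

end EllipticOperator

end ApproxPeriodic

/-! ### The weak gradient on H¹₀(Ω). -/

namespace ApproxPeriodic

variable {n : ℕ} {Ω : Set (Space n)}

theorem gradient_apply (φ : Space n → ℝ) (x : Space n) (i : Fin n) :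
    gradient φ x i = fderiv ℝ φ x (EuclideanSpace.single i 1) := by
  have h1 : inner ℝ (gradient φ x) (EuclideanSpace.single i (1 : ℝ))
      = fderiv ℝ φ x (EuclideanSpace.single i 1) := by
    rw [gradient, InnerProductSpace.toDual_symm_apply]
  rw [← h1, EuclideanSpace.inner_single_right]
  simp

theorem norm_gradient (φ : Space n → ℝ) (x : Space n) : ‖gradient φ x‖ = ‖fderiv ℝ φ x‖ := by
  rw [gradient, LinearIsometryEquiv.norm_map]

theorem continuous_gradient {φ : Space n → ℝ} (hφ : ContDiff ℝ ∞ φ) :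
    Continuous (gradient φ) :=
  (InnerProductSpace.toDual ℝ (Space n)).symm.continuous.comp (hφ.continuous_fderiv (by simp))

theorem tsupport_gradient_subset (φ : Space n → ℝ) : tsupport (gradient φ) ⊆ tsupport φ := by
  refine closure_minimal (fun x hx => ?_) (isClosed_tsupport φ)
  refine support_fderiv_subset ℝ (f := φ) fun h => hx ?_
  rw [gradient, h, map_zero]

theorem hasCompactSupport_gradient {φ : Space n → ℝ} (hφ : HasCompactSupport φ) :
    HasCompactSupport (gradient φ) :=
  hφ.of_isClosed_subset (isClosed_tsupport _) (tsupport_gradient_subset φ)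

/-- The graph of the gradient on `C_c^∞(Ω)`. -/
noncomputable def smoothPairs (Ω : Set (Space n)) : Submodule ℝ (L2 Ω × L2vec Ω) where
  carrier := {p : L2 Ω × L2vec Ω | ∃ φ : Space n → ℝ,
    ContDiff ℝ ∞ φ ∧ HasCompactSupport φ ∧ tsupport φ ⊆ Ω ∧
      p.1 =ᵐ[volume.restrict Ω] φ ∧ p.2 =ᵐ[volume.restrict Ω] gradient φ}
  add_mem' := by
    rintro p r ⟨φ, h1, h2, h3, h4, h5⟩ ⟨ψ, k1, k2, k3, k4, k5⟩
    refine ⟨φ + ψ, h1.add k1, h2.add k2, (tsupport_add φ ψ).trans (union_subset h3 k3), ?_, ?_⟩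
    · exact (Lp.coeFn_add _ _).trans (h4.add k4)
    · refine (Lp.coeFn_add _ _).trans ((h5.add k5).trans (Filter.Eventually.of_forall fun x => ?_))
      simp only [gradient, Pi.add_apply]
      rw [fderiv_add ((h1.differentiable (by simp)) x) ((k1.differentiable (by simp)) x), map_add]
  zero_mem' := by
    refine ⟨0, contDiff_const, HasCompactSupport.zero, by simp [tsupport], Lp.coeFn_zero _ _ _, ?_⟩
    refine (Lp.coeFn_zero _ _ _).trans (Filter.Eventually.of_forall fun x => ?_)
    simp [gradient]
  smul_mem' := by
    rintro c p ⟨φ, h1, h2, h3, h4, h5⟩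
    refine ⟨c • φ, h1.const_smul c, h2.smul_left (f := fun _ => c),
      (tsupport_smul_subset_right (fun _ => c) φ).trans h3, ?_, ?_⟩
    · exact (Lp.coeFn_smul _ _).trans (h4.const_smul c)
    · refine (Lp.coeFn_smul _ _).trans ((h5.const_smul c).trans
        (Filter.Eventually.of_forall fun x => ?_))
      simp only [gradient, Pi.smul_apply]
      rw [fderiv_const_smul ((h1.differentiable (by simp)) x), map_smul]

/-- The graph of the weak gradient on `H¹₀(Ω)`. -/
noncomputable def gradGraph (Ω : Set (Space n)) : Submodule ℝ (L2 Ω × L2vec Ω) :=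
  (smoothPairs Ω).topologicalClosure

theorem isClosed_gradGraph : IsClosed (gradGraph Ω : Set (L2 Ω × L2vec Ω)) :=
  Submodule.isClosed_topologicalClosure _

theorem memLp_of_compactSupport {E : Type*} [NormedAddCommGroup E] {φ : Space n → E}
    (h1 : Continuous φ) (h2 : HasCompactSupport φ) (p : ℝ≥0∞) :
    MemLp φ p (volume.restrict Ω) :=
  (h1.memLp_of_hasCompactSupport h2).restrict Ω

theorem hasGrad_of_smooth {φ : Space n → ℝ} (h1 : ContDiff ℝ ∞ φ) (h2 : HasCompactSupport φ)
    (h3 : tsupport φ ⊆ Ω) :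
    HasGrad Ω ((memLp_of_compactSupport h1.continuous h2 2).toLp φ)
      ((memLp_of_compactSupport (continuous_gradient h1)
        (hasCompactSupport_gradient h2) 2).toLp (gradient φ)) :=
  subset_closure ⟨φ, h1, h2, h3, (memLp_of_compactSupport h1.continuous h2 2).coeFn_toLp,
    (memLp_of_compactSupport (continuous_gradient h1)
      (hasCompactSupport_gradient h2) 2).coeFn_toLp⟩

theorem integral_mul_partial {φ ψ : Space n → ℝ} (hφ : ContDiff ℝ ∞ φ) (hψ : ContDiff ℝ ∞ ψ)
    (hc : HasCompactSupport ψ) (hs : tsupport ψ ⊆ Ω) (i : Fin n) :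
    (∫ x in Ω, gradient ψ x i * φ x) = -∫ x in Ω, ψ x * gradient φ x i := by
  have c1 : Continuous fun x => gradient φ x i :=
    (EuclideanSpace.proj i : Space n →L[ℝ] ℝ).continuous.comp (continuous_gradient hφ)
  have c2 : Continuous fun x => gradient ψ x i :=
    (EuclideanSpace.proj i : Space n →L[ℝ] ℝ).continuous.comp (continuous_gradient hψ)
  have s2 : HasCompactSupport fun x => gradient ψ x i :=
    (hasCompactSupport_gradient hc).comp_left (g := fun y : Space n => y i) rfl
  have z1 : ∀ x, x ∉ Ω → ψ x * gradient φ x i = 0 := fun x hx => by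
    rw [image_eq_zero_of_notMem_tsupport fun h => hx (hs h), zero_mul]
  have z2 : ∀ x, x ∉ Ω → gradient ψ x i * φ x = 0 := fun x hx => by
    rw [image_eq_zero_of_notMem_tsupport (f := gradient ψ)
      fun h => hx (hs (tsupport_gradient_subset ψ h))]
    simp
  rw [setIntegral_eq_integral_of_forall_compl_eq_zero z1,
    setIntegral_eq_integral_of_forall_compl_eq_zero z2]
  have key := integral_mul_fderiv_eq_neg_fderiv_mul_of_integrable (μ := volume) (f := ψ) (g := φ)
    (v := EuclideanSpace.single i (1 : ℝ)) ?_ ?_ ?_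
    (fun x _ => (hψ.differentiable (by simp)) x) (fun x _ => (hφ.differentiable (by simp)) x)
  · simp only [gradient_apply]
    rw [key, neg_neg]
  · simp only [← gradient_apply]
    exact (c2.mul hφ.continuous).integrable_of_hasCompactSupport s2.mul_right
  · simp only [← gradient_apply]
    exact (hψ.continuous.mul c1).integrable_of_hasCompactSupport hc.mul_right
  · exact (hψ.continuous.mul hφ.continuous).integrable_of_hasCompactSupport hc.mul_right

theorem isFiniteMeasure_restrict (hΩ : IsC2Domain Ω) : IsFiniteMeasure (volume.restrict Ω) :=
  ⟨by rw [Measure.restrict_apply_univ]; exact hΩ.isBounded.measure_lt_top⟩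

/-- The gradient is closable: ∫ψ g_i = −∫∂_iψ v holds for smooth pairs and survives L² limits, so
for v = 0 each g_i is orthogonal to all test functions. -/
theorem hasGrad_zero_right (hΩ : IsC2Domain Ω) {g : L2vec Ω} (h : HasGrad Ω 0 g) : g = 0 := by
  have := isFiniteMeasure_restrict hΩ
  have hi : ∀ i, ∀ᵐ x ∂volume.restrict Ω, component i g x = 0 := by
    intro i
    have key : ∀ ψ : Space n → ℝ, ContDiff ℝ ∞ ψ → HasCompactSupport ψ → tsupport ψ ⊆ Ω →
        ∫ x in Ω, ψ x • component i g x = 0 := by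
      intro ψ h1 h2 h3
      have m1 := memLp_of_compactSupport (Ω := Ω) h1.continuous h2 2
      have m2 : MemLp (fun x => gradient ψ x i) 2 (volume.restrict Ω) :=
        (EuclideanSpace.proj i : Space n →L[ℝ] ℝ).comp_memLp' (memLp_of_compactSupport
          (continuous_gradient h1) (hasCompactSupport_gradient h2) 2)
      have e1 : ∀ w : L2 Ω, inner ℝ (m1.toLp ψ) w = ∫ x in Ω, ψ x * w x := fun w => by
        rw [L2.inner_def]
        refine integral_congr_ae ?_
        filter_upwards [m1.coeFn_toLp] with x hx
        rw [hx]; simp [mul_comm]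
      have e2 : ∀ w : L2 Ω, inner ℝ (m2.toLp _) w = ∫ x in Ω, gradient ψ x i * w x := fun w => by
        rw [L2.inner_def]
        refine integral_congr_ae ?_
        filter_upwards [m2.coeFn_toLp] with x hx
        rw [hx]; simp [mul_comm]
      have hcl : IsClosed {p : L2 Ω × L2vec Ω | inner ℝ (m1.toLp ψ) (component i p.2)
          + inner ℝ (m2.toLp _) p.1 = 0} := by
        refine isClosed_eq (Continuous.add ?_ ?_) continuous_const
        · exact continuous_const.inner ((component i).continuous.comp continuous_snd)
        · exact continuous_const.inner continuous_fst
      have hmem := closure_minimal (fun p hp => ?_) hcl h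
      · have : inner ℝ (m1.toLp ψ) (component i g) = 0 := by simpa using hmem
        rw [e1] at this
        simpa only [smul_eq_mul] using this
      · obtain ⟨φ, k1, k2, k3, k4, k5⟩ := hp
        have e3 : ∫ x in Ω, ψ x * component i p.2 x = ∫ x in Ω, ψ x * gradient φ x i := by
          refine integral_congr_ae ?_
          filter_upwards [coeFn_component i p.2, k5] with x a b
          rw [a, b]
        have e4 : ∫ x in Ω, gradient ψ x i * p.1 x = ∫ x in Ω, gradient ψ x i * φ x := by
          refine integral_congr_ae ?_
          filter_upwards [k4] with x a
          rw [a]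
        simp only [mem_ofPred_eq]
        rw [e1, e2, e3, e4, integral_mul_partial k1 h1 h2 h3, add_neg_cancel]
    have hli : LocallyIntegrableOn (component i g) Ω (volume.restrict Ω) :=
      ((Lp.memLp (component i g)).integrable (by norm_num)).locallyIntegrable.locallyIntegrableOn Ω
    filter_upwards [hΩ.isOpen.ae_eq_zero_of_integral_contDiff_smul_eq_zero hli key,
      ae_restrict_mem hΩ.isOpen.measurableSet] with x a b
    exact a b
  rw [Lp.eq_zero_iff_ae_eq_zero]
  have h1 : ∀ᵐ x ∂volume.restrict Ω, ∀ i, component i g x = g x i :=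
    ae_all_iff.mpr fun i => coeFn_component i g
  filter_upwards [ae_all_iff.mpr hi, h1] with x a b
  ext i
  rw [← b, a]; simp

theorem HasGrad.unique (hΩ : IsC2Domain Ω) {v : L2 Ω} {g g' : L2vec Ω} (h : HasGrad Ω v g)
    (h' : HasGrad Ω v g') : g = g' := by
  -- `HasGrad` unfolds to membership in the closed subspace `gradGraph`, which makes it linear.
  have := (gradGraph Ω).sub_mem h h'
  rw [Prod.mk_sub_mk, sub_self] at this
  exact sub_eq_zero.mp (hasGrad_zero_right hΩ this)

/-- The gradient is not bounded by the function. -/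
theorem exists_large_grad (hn : 1 ≤ n) (hΩ : IsC2Domain Ω) (C : ℝ) :
    ∃ (v : L2 Ω) (g : L2vec Ω), HasGrad Ω v g ∧ C * ‖v‖ ^ 2 < ‖g‖ ^ 2 := by
  obtain ⟨x₀, hx₀⟩ := hΩ.isConnected.nonempty
  obtain ⟨r, hr, hball⟩ := Metric.isOpen_iff.mp hΩ.isOpen x₀ hx₀
  have : Nonempty (Fin n) := ⟨⟨0, hn⟩⟩
  let β : ContDiffBump (0 : Space n) := ⟨r / 4, r / 2, by positivity, by linarith⟩
  have hβ : ContDiff ℝ ∞ β := β.contDiff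
  have hβc : HasCompactSupport β := β.hasCompactSupport
  have hβs : tsupport β = Metric.closedBall 0 (r / 2) := β.tsupport_eq
  set I₀ := ∫ x, β x ^ 2
  set I₁ := ∫ x, ‖fderiv ℝ β x‖ ^ 2
  have hcd : Continuous (fderiv ℝ β) := hβ.continuous_fderiv (by simp)
  have hI₁ : 0 < I₁ := by
    -- Otherwise β would be constant, yet it is 1 at the centre and 0 far away; a far point exists
    -- because n ≥ 1.
    have hex : ∃ x, fderiv ℝ β x ≠ 0 := by
      by_contra hne
      push Not at hne
      obtain ⟨z, hz⟩ := NormedSpace.exists_lt_norm ℝ (Space n) r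
      have h1 := is_const_of_fderiv_eq_zero (hβ.differentiable (by simp)) hne 0 z
      rw [β.one_of_mem_closedBall (by simp [β.rIn_pos.le])] at h1
      have h2 : β z = 0 := β.zero_of_le_dist (by
        rw [dist_zero_right]; change r / 2 ≤ ‖z‖; linarith)
      rw [h2] at h1
      norm_num at h1
    obtain ⟨x, hx⟩ := hex
    refine Continuous.integral_pos_of_hasCompactSupport_nonneg_nonzero (x := x)
      (by fun_prop) ?_ (fun x => by positivity) (by simpa using hx)
    exact (hβc.fderiv ℝ).comp_left (g := fun L => ‖L‖ ^ 2) (by simp)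
  -- The witness is the bump contracted by k about x₀: both integrals scale by k^(-n), but the one
  -- of the gradient gains k². The condition k ≥ 1 keeps the support inside Ω.
  obtain ⟨k, hk1, hk⟩ : ∃ k : ℝ, 1 ≤ k ∧ C * I₀ < k ^ 2 * I₁ := by
    obtain ⟨m, hm⟩ := exists_nat_gt (C * I₀ / I₁)
    refine ⟨m + 1, by simp, ?_⟩
    rw [← div_lt_iff₀ hI₁]
    have : (0 : ℝ) ≤ m := m.cast_nonneg
    nlinarith
  have hk0 : 0 < k := by linarith
  let φ : Space n → ℝ := fun x => β (k • (x - x₀))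
  have hφ : ContDiff ℝ ∞ φ := hβ.comp (by fun_prop)
  have hsupp : tsupport φ ⊆ Metric.closedBall x₀ (r / 2) := by
    refine closure_minimal (fun x hx => ?_) Metric.isClosed_closedBall
    by_contra hne
    refine hx (β.zero_of_le_dist ?_)
    rw [dist_zero_right, norm_smul, Real.norm_of_nonneg hk0.le]
    rw [Metric.mem_closedBall, not_le, dist_eq_norm] at hne
    change r / 2 ≤ _
    nlinarith [norm_nonneg (x - x₀)]
  have hφc : HasCompactSupport φ :=
    (isCompact_closedBall x₀ (r / 2)).of_isClosed_subset (isClosed_tsupport _) hsupp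
  have hφs : tsupport φ ⊆ Ω :=
    hsupp.trans ((Metric.closedBall_subset_ball (by linarith)).trans hball)
  refine ⟨_, _, hasGrad_of_smooth hφ hφc hφs, ?_⟩
  have hfd : ∀ x, fderiv ℝ φ x = k • fderiv ℝ β (k • (x - x₀)) := fun x => by
    have h1 : HasFDerivAt (fun y : Space n => k • (y - x₀))
        (k • ContinuousLinearMap.id ℝ (Space n)) x :=
      ((hasFDerivAt_id x).sub_const x₀).const_smul k
    have h2 := ((hβ.differentiable (by simp)) (k • (x - x₀))).hasFDerivAt.comp x h1
    refine h2.fderiv.trans ?_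
    ext y
    simp
  have scale : ∀ f : Space n → ℝ, ∫ x, f (k • (x - x₀)) = |(k ^ n)⁻¹| * ∫ x, f x := fun f => by
    rw [integral_sub_right_eq_self (fun x => f (k • x)) x₀, Measure.integral_comp_smul]
    simp
  have e1 : ‖(memLp_of_compactSupport (Ω := Ω) hφ.continuous hφc 2).toLp φ‖ ^ 2
      = |(k ^ n)⁻¹| * I₀ := by
    rw [Lp_norm_sq_eq_integral, ← scale (fun x => β x ^ 2)]
    rw [← setIntegral_eq_integral_of_forall_compl_eq_zero (s := Ω)
      (f := fun x => β (k • (x - x₀)) ^ 2)]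
    · refine integral_congr_ae ?_
      filter_upwards [(memLp_of_compactSupport (Ω := Ω) hφ.continuous hφc 2).coeFn_toLp] with x hx
      rw [hx, Real.norm_eq_abs, sq_abs]
    · intro x hx
      have : φ x = 0 := image_eq_zero_of_notMem_tsupport fun h => hx (hφs h)
      simpa [φ] using this
  have e2 : ‖(memLp_of_compactSupport (Ω := Ω) (continuous_gradient hφ)
      (hasCompactSupport_gradient hφc) 2).toLp (gradient φ)‖ ^ 2
      = |(k ^ n)⁻¹| * (k ^ 2 * I₁) := by
    rw [Lp_norm_sq_eq_integral, ← integral_const_mul,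
      ← scale (fun x => k ^ 2 * ‖fderiv ℝ β x‖ ^ 2)]
    rw [← setIntegral_eq_integral_of_forall_compl_eq_zero (s := Ω)
      (f := fun x => k ^ 2 * ‖fderiv ℝ β (k • (x - x₀))‖ ^ 2)]
    · refine integral_congr_ae ?_
      filter_upwards [(memLp_of_compactSupport (Ω := Ω) (continuous_gradient hφ)
        (hasCompactSupport_gradient hφc) 2).coeFn_toLp] with x hx
      rw [hx, norm_gradient, hfd, norm_smul, mul_pow, Real.norm_eq_abs, sq_abs]
    · intro x hx
      have h0 : gradient φ x = 0 := image_eq_zero_of_notMem_tsupport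
        fun h => hx (hφs (tsupport_gradient_subset φ h))
      have := norm_gradient φ x
      rw [h0, norm_zero, hfd, norm_smul, Real.norm_eq_abs] at this
      rw [← sq_abs k, ← mul_pow, ← this]
      simp
  rw [e1, e2]
  have : 0 < |(k ^ n)⁻¹| := abs_pos.mpr (by positivity)
  nlinarith

end ApproxPeriodic

/-! ### Eigenfunction expansions in H¹₀(Ω) and growth of the eigenvalues. -/

namespace ApproxPeriodic

variable {n : ℕ} {Ω : Set (Space n)}

/-- `κ` is a Gårding constant of `L₀`. -/
def IsGarding (L₀ : EllipticOperator Ω) (κ : ℝ) : Prop :=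
  0 ≤ κ ∧ ∀ (v : L2 Ω) (g : L2vec Ω),
    L₀.ell / 2 * ‖g‖ ^ 2 ≤ L₀.form v g v g + κ * ‖v‖ ^ 2

variable {L₀ : EllipticOperator Ω} {lam : ℕ → ℝ} {X : HilbertBasis ℕ ℝ (L2 Ω)}

/-- The weak gradient of the `j`-th eigenfunction. -/
noncomputable def IsEigenbasis.grad (hX : IsEigenbasis L₀ lam X) (j : ℕ) : L2vec Ω :=
  (hX.eigen j).choose

theorem IsEigenbasis.hasGrad (hX : IsEigenbasis L₀ lam X) (j : ℕ) :
    HasGrad Ω (X j) (hX.grad j) := (hX.eigen j).choose_spec.1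

theorem IsEigenbasis.form_eq (hX : IsEigenbasis L₀ lam X) (j : ℕ) {w : L2 Ω} {h : L2vec Ω}
    (hw : HasGrad Ω w h) : L₀.form (X j) (hX.grad j) w h = lam j * inner ℝ (X j) w :=
  (hX.eigen j).choose_spec.2 w h hw

theorem IsEigenbasis.neg_le (hX : IsEigenbasis L₀ lam X) {κ : ℝ} (hκ : IsGarding L₀ κ) (j : ℕ) :
    -κ ≤ lam j := by
  have h1 := hκ.2 (X j) (hX.grad j)
  rw [hX.form_eq j (hX.hasGrad j), real_inner_self_eq_norm_sq, X.orthonormal.1 j] at h1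
  have : 0 ≤ L₀.ell / 2 * ‖hX.grad j‖ ^ 2 := by have := L₀.ell_pos; positivity
  linarith

/-- The finite sums of an eigenfunction expansion, with their gradients. -/
noncomputable def IsEigenbasis.partialSum (hX : IsEigenbasis L₀ lam X) (c : ℕ → ℝ)
    (s : Finset ℕ) : L2 Ω × L2vec Ω :=
  ∑ j ∈ s, c j • (X j, hX.grad j)

theorem IsEigenbasis.partialSum_mem (hX : IsEigenbasis L₀ lam X) (c : ℕ → ℝ) (s : Finset ℕ) :
    hX.partialSum c s ∈ gradGraph Ω :=
  Submodule.sum_mem _ fun j _ => Submodule.smul_mem _ _ (hX.hasGrad j)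

theorem IsEigenbasis.partialSum_fst (hX : IsEigenbasis L₀ lam X) (c : ℕ → ℝ) (s : Finset ℕ) :
    (hX.partialSum c s).1 = ∑ j ∈ s, c j • X j := by
  simp [partialSum, Prod.fst_sum]

theorem IsEigenbasis.formL_partialSum (hX : IsEigenbasis L₀ lam X) (hΩ : IsC2Domain Ω)
    (c : ℕ → ℝ) (s : Finset ℕ) {z : L2 Ω × L2vec Ω} (hz : z ∈ gradGraph Ω) :
    L₀.formL hΩ (hX.partialSum c s) z = ∑ j ∈ s, lam j * c j * inner ℝ (X j) z.1 := by
  simp only [partialSum, map_sum, map_smul, sum_apply, smul_apply]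
  refine Finset.sum_congr rfl fun j _ => ?_
  obtain ⟨w, h⟩ := z
  rw [L₀.formL_apply hΩ, hX.form_eq j hz, smul_eq_mul]; ring

theorem inner_sum_basis (c : ℕ → ℝ) (s : Finset ℕ) (j : ℕ) (hj : j ∈ s) :
    inner ℝ (X j) (∑ i ∈ s, c i • X i) = c j := by
  simp only [inner_sum, inner_smul_right, orthonormal_iff_ite.mp X.orthonormal j]
  simp [hj]

theorem norm_sq_sum_basis (c : ℕ → ℝ) (s : Finset ℕ) :
    ‖∑ i ∈ s, c i • X i‖ ^ 2 = ∑ i ∈ s, c i ^ 2 := by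
  rw [← real_inner_self_eq_norm_sq, sum_inner]
  refine Finset.sum_congr rfl fun j hj => ?_
  rw [inner_smul_left, inner_sum_basis c s j hj]
  simp [sq]

theorem IsEigenbasis.form_partialSum_self (hX : IsEigenbasis L₀ lam X) (hΩ : IsC2Domain Ω)
    (c : ℕ → ℝ) (s : Finset ℕ) :
    L₀.formL hΩ (hX.partialSum c s) (hX.partialSum c s) = ∑ j ∈ s, lam j * c j ^ 2 := by
  rw [hX.formL_partialSum hΩ c s (hX.partialSum_mem c s)]
  refine Finset.sum_congr rfl fun j hj => ?_
  rw [hX.partialSum_fst, inner_sum_basis c s j hj]; ring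

/-- Bessel's inequality for the energy. -/
theorem IsEigenbasis.bessel (hX : IsEigenbasis L₀ lam X) (hΩ : IsC2Domain Ω) {κ γ : ℝ}
    (hκ : IsGarding L₀ κ) (hγ : κ ≤ γ) {w : L2 Ω} {h : L2vec Ω} (hw : HasGrad Ω w h)
    (s : Finset ℕ) :
    ∑ j ∈ s, (lam j + γ) * inner ℝ (X j) w ^ 2 ≤ L₀.form w h w h + γ * ‖w‖ ^ 2 := by
  set c : ℕ → ℝ := fun j => inner ℝ (X j) w
  have hz : (w, h) ∈ gradGraph Ω := hw
  set z := hX.partialSum c s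
  -- Gårding's inequality for the remainder of the partial sum z. As B(z,w) = B(z,z) = Σ λ_j c_j²,
  -- the form of the remainder is B(w,w) − Σ λ_j c_j², and similarly for the norm.
  have h0 := hκ.2 (w - z.1) (h - z.2)
  have e0 : L₀.form (w - z.1) (h - z.2) (w - z.1) (h - z.2)
      = L₀.formL hΩ ((w, h) - z) ((w, h) - z) := (L₀.formL_apply hΩ _ _ _ _).symm
  have e1 : L₀.formL hΩ (w, h) z = L₀.formL hΩ z (w, h) := by
    change L₀.formL hΩ (w, h) (z.1, z.2) = L₀.formL hΩ (z.1, z.2) (w, h)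
    rw [L₀.formL_apply, L₀.formL_apply, L₀.form_symm hΩ]
  have e2 : L₀.formL hΩ z (w, h) = ∑ j ∈ s, lam j * c j ^ 2 := by
    rw [hX.formL_partialSum hΩ c s hz]
    exact Finset.sum_congr rfl fun j _ => by simp only [c]; ring
  have e3 := hX.form_partialSum_self hΩ c s
  have e4 : ‖w - z.1‖ ^ 2 = ‖w‖ ^ 2 - ∑ j ∈ s, c j ^ 2 := by
    have h1 : inner ℝ w z.1 = ∑ j ∈ s, c j ^ 2 := by
      simp only [z, hX.partialSum_fst, inner_sum, inner_smul_right]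
      exact Finset.sum_congr rfl fun j _ => by rw [real_inner_comm]; simp only [c]; ring
    have h2 : ‖z.1‖ ^ 2 = ∑ j ∈ s, c j ^ 2 := by
      simp only [z, hX.partialSum_fst, norm_sq_sum_basis]
    rw [norm_sub_sq_real, h1, h2]; ring
  rw [e0, e4] at h0
  simp only [map_sub, sub_apply] at h0
  rw [e1, e2, e3, L₀.formL_apply] at h0
  have h5 : 0 ≤ L₀.ell / 2 * ‖h - z.2‖ ^ 2 := by have := L₀.ell_pos; positivity
  have h6 : ∑ j ∈ s, (lam j + γ) * c j ^ 2 = ∑ j ∈ s, lam j * c j ^ 2 + γ * ∑ j ∈ s, c j ^ 2 := by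
    rw [Finset.mul_sum, ← Finset.sum_add_distrib]
    exact Finset.sum_congr rfl fun j _ => by ring
  have h7 : 0 ≤ ‖w‖ ^ 2 - ∑ j ∈ s, c j ^ 2 := by rw [← e4]; positivity
  rw [h6]
  nlinarith

/-- On finite sums the form is diagonal, so Gårding bounds the graph norm by Σ(λ_j+γ)c_j²; the
margin 1 in γ ≥ κ + 1 takes care of the L² part. Cauchy's criterion then transfers. -/
theorem IsEigenbasis.summable_expansion (hX : IsEigenbasis L₀ lam X) (hΩ : IsC2Domain Ω)
    {κ γ : ℝ} (hκ : IsGarding L₀ κ) (hγ : κ + 1 ≤ γ) {c : ℕ → ℝ}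
    (hc : Summable fun j => (lam j + γ) * c j ^ 2) :
    Summable fun j => c j • ((X j, hX.grad j) : L2 Ω × L2vec Ω) := by
  have hell := L₀.ell_pos
  set D : ℝ := 1 + 2 / L₀.ell
  have hD : 0 < D := by positivity
  have hbound : ∀ s : Finset ℕ,
      ‖hX.partialSum c s‖ ^ 2 ≤ D * ∑ j ∈ s, (lam j + γ) * c j ^ 2 := by
    intro s
    set z := hX.partialSum c s
    have h0 := hκ.2 z.1 z.2
    rw [← L₀.formL_apply hΩ, Prod.mk.eta, hX.form_partialSum_self hΩ c s] at h0
    have h1 : ‖z.1‖ ^ 2 = ∑ j ∈ s, c j ^ 2 := by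
      simp only [z, hX.partialSum_fst, norm_sq_sum_basis]
    have h6 : ∑ j ∈ s, (lam j + γ) * c j ^ 2
        = ∑ j ∈ s, lam j * c j ^ 2 + γ * ∑ j ∈ s, c j ^ 2 := by
      rw [Finset.mul_sum, ← Finset.sum_add_distrib]
      exact Finset.sum_congr rfl fun j _ => by ring
    have h7 : 0 ≤ ∑ j ∈ s, c j ^ 2 := by positivity
    rw [h1] at h0
    have h8 : L₀.ell / 2 * ‖z.2‖ ^ 2 + ‖z.1‖ ^ 2 ≤ ∑ j ∈ s, (lam j + γ) * c j ^ 2 := by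
      rw [h6, h1]; nlinarith
    set S := ∑ j ∈ s, (lam j + γ) * c j ^ 2
    have h9 : ‖z‖ ^ 2 ≤ ‖z.1‖ ^ 2 + ‖z.2‖ ^ 2 := by
      rw [Prod.norm_def]
      rcases max_choice ‖z.1‖ ‖z.2‖ with h | h <;> rw [h] <;>
        nlinarith [sq_nonneg ‖z.1‖, sq_nonneg ‖z.2‖]
    have h10 : ‖z.2‖ ^ 2 ≤ 2 / L₀.ell * S := by
      calc ‖z.2‖ ^ 2 = 2 / L₀.ell * (L₀.ell / 2 * ‖z.2‖ ^ 2) := by field_simp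
        _ ≤ 2 / L₀.ell * S := by gcongr; nlinarith [sq_nonneg ‖z.1‖]
    have h11 : ‖z.1‖ ^ 2 ≤ S := by
      have : 0 ≤ L₀.ell / 2 * ‖z.2‖ ^ 2 := by positivity
      linarith
    simp only [D]
    linarith
  rw [summable_iff_vanishing_norm] at hc ⊢
  intro ε hε
  obtain ⟨s, hs⟩ := hc (ε ^ 2 / D) (by positivity)
  refine ⟨s, fun t ht => ?_⟩
  have h1 := hs t ht
  have h2 := hbound t
  rw [Real.norm_eq_abs] at h1
  have h3 := (le_abs_self _).trans_lt h1
  rw [lt_div_iff₀ hD] at h3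
  refine lt_of_pow_lt_pow_left₀ 2 hε.le (lt_of_le_of_lt h2 ?_)
  linarith

/-- The eigenfunction expansion of an element of `H¹₀(Ω)` converges in `H¹₀(Ω)`. -/
theorem IsEigenbasis.hasSum_expansion (hX : IsEigenbasis L₀ lam X) (hΩ : IsC2Domain Ω)
    {w : L2 Ω} {h : L2vec Ω} (hw : HasGrad Ω w h) :
    HasSum (fun j => inner ℝ (X j) w • ((X j, hX.grad j) : L2 Ω × L2vec Ω)) (w, h) := by
  obtain ⟨κ, hκ⟩ := L₀.exists_garding hΩ
  have hs : Summable fun j => (lam j + (κ + 1)) * inner ℝ (X j) w ^ 2 :=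
    summable_of_sum_le (fun j => mul_nonneg (by linarith [hX.neg_le hκ j]) (sq_nonneg _))
      (hX.bessel hΩ hκ (by linarith) hw)
  obtain ⟨⟨w', h'⟩, hsum⟩ := hX.summable_expansion hΩ hκ le_rfl hs
  -- The first component is identified by the expansion in L²; closedness of the graph and
  -- uniqueness of the gradient then identify the second.
  have h1 : w' = w := by
    refine HasSum.unique (hsum.mapL (ContinuousLinearMap.fst ℝ _ _)) ?_
    exact (X.hasSum_repr w).congr_fun fun j => by rw [X.repr_apply_apply]; rfl
  have h2 : HasGrad Ω w' h' := isClosed_gradGraph.mem_of_tendsto hsum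
    (Filter.Eventually.of_forall fun s => hX.partialSum_mem _ s)
  subst h1
  rwa [hw.unique hΩ h2]

/-- The converse of Bessel's inequality: finite energy forces membership in H¹₀. This is how modal
solutions obtain a gradient. -/
theorem IsEigenbasis.exists_hasGrad (hX : IsEigenbasis L₀ lam X) (hΩ : IsC2Domain Ω)
    {κ γ : ℝ} (hκ : IsGarding L₀ κ) (hγ : κ + 1 ≤ γ) {w : L2 Ω}
    (hw : Summable fun j => (lam j + γ) * inner ℝ (X j) w ^ 2) : ∃ h, HasGrad Ω w h := by
  obtain ⟨⟨w', h'⟩, hsum⟩ := hX.summable_expansion hΩ hκ hγ hw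
  have h1 : w' = w := by
    refine HasSum.unique (hsum.mapL (ContinuousLinearMap.fst ℝ _ _)) ?_
    exact (X.hasSum_repr w).congr_fun fun j => by rw [X.repr_apply_apply]; rfl
  have h2 : HasGrad Ω w' h' := isClosed_gradGraph.mem_of_tendsto hsum
    (Filter.Eventually.of_forall fun s => hX.partialSum_mem _ s)
  subst h1
  exact ⟨h', h2⟩

/-- The bilinear form of `L₀` is diagonal in the eigenbasis. -/
theorem IsEigenbasis.hasSum_form (hX : IsEigenbasis L₀ lam X) (hΩ : IsC2Domain Ω)
    {v w : L2 Ω} {g h : L2vec Ω} (hv : HasGrad Ω v g) (hw : HasGrad Ω w h) :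
    HasSum (fun j => lam j * inner ℝ (X j) v * inner ℝ (X j) w) (L₀.form v g w h) := by
  have h1 := ((L₀.formL hΩ).flip (w, h)).hasSum (hX.hasSum_expansion hΩ hv)
  simp only [ContinuousLinearMap.flip_apply, map_smul] at h1
  rw [L₀.formL_apply] at h1
  refine h1.congr_fun fun j => ?_
  rw [L₀.formL_apply hΩ, hX.form_eq j hw, smul_eq_mul]; ring

theorem IsEigenbasis.hasSum_energy (hX : IsEigenbasis L₀ lam X) (hΩ : IsC2Domain Ω)
    {v : L2 Ω} {g : L2vec Ω} (hv : HasGrad Ω v g) (γ : ℝ) :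
    HasSum (fun j => (lam j + γ) * inner ℝ (X j) v ^ 2) (L₀.form v g v g + γ * ‖v‖ ^ 2) := by
  refine ((hX.hasSum_form hΩ hv hv).add ((hasSum_sq_coord X v).mul_left γ)).congr_fun fun j => ?_
  ring

/-- No compact embedding is involved. If all λ_j ≤ Λ, the diagonal form gives B(v,v) ≤ Λ‖v‖², so by
Gårding ‖∇v‖ is bounded by a multiple of ‖v‖ on H¹₀, against `exists_large_grad`. -/
theorem IsEigenbasis.exists_lt (hn : 1 ≤ n) (hΩ : IsC2Domain Ω) (hX : IsEigenbasis L₀ lam X)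
    (Λ : ℝ) : ∃ N, ∀ j, N ≤ j → Λ < lam j := by
  by_contra hne
  push Not at hne
  have hb : ∀ j, lam j ≤ Λ := fun j => by
    obtain ⟨i, hi, hl⟩ := hne j
    exact (hX.monotone hi).trans hl
  obtain ⟨κ, hκ⟩ := L₀.exists_garding hΩ
  have hell := L₀.ell_pos
  obtain ⟨v, g, hv, hlt⟩ := exists_large_grad hn hΩ (2 / L₀.ell * (Λ + κ))
  have h1 : L₀.form v g v g ≤ Λ * ‖v‖ ^ 2 := by
    refine hasSum_le (fun j => ?_) (hX.hasSum_form hΩ hv hv) ((hasSum_sq_coord X v).mul_left Λ)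
    rw [mul_assoc, ← sq]
    exact mul_le_mul_of_nonneg_right (hb j) (sq_nonneg _)
  have h2 := hκ.2 v g
  have h3 : ‖g‖ ^ 2 ≤ 2 / L₀.ell * (Λ + κ) * ‖v‖ ^ 2 := by
    calc ‖g‖ ^ 2 = 2 / L₀.ell * (L₀.ell / 2 * ‖g‖ ^ 2) := by field_simp
      _ ≤ 2 / L₀.ell * ((Λ + κ) * ‖v‖ ^ 2) :=
        mul_le_mul_of_nonneg_left (by linarith) (by positivity)
      _ = _ := by ring
  linarith

theorem inner_eigenfunctions_eq_zero (hΩ : IsC2Domain Ω) {lam' : ℕ → ℝ}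
    {X' : HilbertBasis ℕ ℝ (L2 Ω)} (hX : IsEigenbasis L₀ lam X) (hX' : IsEigenbasis L₀ lam' X')
    {i k : ℕ} (h : lam i ≠ lam' k) : inner ℝ (X i) (X' k) = 0 := by
  have h1 := hX.form_eq i (hX'.hasGrad k)
  have h2 := hX'.form_eq k (hX.hasGrad i)
  rw [L₀.form_symm hΩ, h1, real_inner_comm] at h2
  have h3 : (lam i - lam' k) * inner ℝ (X' k) (X i) = 0 := by linarith
  rw [real_inner_comm]
  exact (mul_eq_zero.mp h3).resolve_left (sub_ne_zero.mpr h)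

/-- The number of eigenvalues below a given level does not depend on the eigenbasis. -/
theorem eigenvalue_gt_of_eigenvalue_gt (hΩ : IsC2Domain Ω) {lam' : ℕ → ℝ}
    {X' : HilbertBasis ℕ ℝ (L2 Ω)} (hX : IsEigenbasis L₀ lam X) (hX' : IsEigenbasis L₀ lam' X')
    {Λ : ℝ} {N : ℕ} (hN : ∀ j, N ≤ j → Λ < lam j) {j : ℕ} (hj : N ≤ j) : Λ < lam' j := by
  by_contra hle
  have hle' : ∀ k ∈ Finset.range (N + 1), lam' k ≤ Λ := fun k hk =>
    (hX'.monotone (by have := Finset.mem_range.mp hk; omega)).trans (not_lt.mp hle)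
  -- Eigenfunctions with different eigenvalues are orthogonal, so N + 1 orthonormal vectors would
  -- lie in the span of X_0, …, X_{N-1}; summing the squared coefficients both ways gives N + 1 ≤ N.
  have h1 : ∀ k ∈ Finset.range (N + 1), ∑ i ∈ Finset.range N, inner ℝ (X i) (X' k) ^ 2 = 1 := by
    intro k hk
    have h2 := hasSum_sq_coord X (X' k)
    rw [X'.orthonormal.1 k, one_pow] at h2
    refine HasSum.unique (hasSum_sum_of_ne_finset_zero fun i hi => ?_) h2
    rw [inner_eigenfunctions_eq_zero hΩ hX hX', zero_pow two_ne_zero]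
    have := hN i (by simpa using hi)
    have := hle' k hk
    intro heq
    linarith
  have h3 : ∀ i, ∑ k ∈ Finset.range (N + 1), inner ℝ (X i) (X' k) ^ 2 ≤ 1 := by
    intro i
    have h2 := hasSum_sq_coord X' (X i)
    rw [X.orthonormal.1 i, one_pow] at h2
    simp only [real_inner_comm (X i)] at h2
    exact sum_le_hasSum _ (fun _ _ => sq_nonneg _) h2
  have h4 : ((N + 1 : ℕ) : ℝ) ≤ N := by
    calc ((N + 1 : ℕ) : ℝ)
        = ∑ k ∈ Finset.range (N + 1), ∑ i ∈ Finset.range N, inner ℝ (X i) (X' k) ^ 2 := by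
          rw [Finset.sum_congr rfl h1]; simp
      _ = ∑ i ∈ Finset.range N, ∑ k ∈ Finset.range (N + 1), inner ℝ (X i) (X' k) ^ 2 :=
          Finset.sum_comm
      _ ≤ ∑ i ∈ Finset.range N, 1 := Finset.sum_le_sum fun i _ => h3 i
      _ = N := by simp
  push_cast at h4
  linarith

/-- The index must be chosen before the basis. One eigenbasis determines it for all of them, and
without any eigenbasis the claim is vacuous. -/
theorem exists_uniform_index (hn : 1 ≤ n) (hΩ : IsC2Domain Ω) (L₀ : EllipticOperator Ω) (Λ : ℝ) :
    ∃ N : ℕ, ∀ (lam : ℕ → ℝ) (X : HilbertBasis ℕ ℝ (L2 Ω)), IsEigenbasis L₀ lam X →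
      ∀ j, N ≤ j → Λ < lam j := by
  by_cases hex : ∃ (lam : ℕ → ℝ) (X : HilbertBasis ℕ ℝ (L2 Ω)), IsEigenbasis L₀ lam X
  · obtain ⟨lam, X, hX⟩ := hex
    obtain ⟨N, hN⟩ := hX.exists_lt hn hΩ Λ
    exact ⟨N, fun lam' X' hX' j hj => eigenvalue_gt_of_eigenvalue_gt hΩ hX hX' hN hj⟩
  · exact ⟨0, fun lam X hX => absurd ⟨lam, X, hX⟩ hex⟩

end ApproxPeriodic

/-! ### Sobolev inequality and form bounds for potentials in L^q. -/

namespace ApproxPeriodic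

variable {n : ℕ} {Ω : Set (Space n)}

theorem eLpNorm_top_le_fderiv_one {φ : Space 1 → ℝ} (hφ : ContDiff ℝ 1 φ)
    (hc : HasCompactSupport φ) : eLpNorm φ ∞ volume ≤ eLpNorm (fderiv ℝ φ) 1 volume := by
  let L : ℝ ≃ₗᵢ[ℝ] Space 1 := (OrthonormalBasis.singleton (Fin 1) ℝ).repr
  have hL : ContDiff ℝ 1 (φ ∘ L) := hφ.comp L.contDiff
  have hcL : HasCompactSupport (φ ∘ L) := hc.comp_homeomorph L.toHomeomorph
  rw [eLpNorm_exponent_top, eLpNorm_one_eq_lintegral_enorm]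
  refine eLpNormEssSup_le_of_ae_enorm_bound (Filter.Eventually.of_forall fun x => ?_)
  have h1 := hcL.enorm_le_lintegral_Ici_deriv hL (L.symm x)
  simp only [Function.comp, L.apply_symm_apply] at h1
  refine h1.trans ((setLIntegral_le_lintegral _ _).trans ?_)
  rw [← L.measurePreserving.lintegral_comp (hφ.continuous_fderiv (by simp)).enorm.measurable]
  refine lintegral_mono fun y => ?_
  have hd : HasDerivAt (φ ∘ L) (fderiv ℝ φ (L y) (L 1)) y := by
    have h2 := ((hφ.differentiable (by simp)) (L y)).hasFDerivAt.comp y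
      (L : ℝ →L[ℝ] Space 1).hasFDerivAt
    exact h2.hasDerivAt
  rw [hd.deriv, ← ofReal_norm, ← ofReal_norm]
  refine ENNReal.ofReal_le_ofReal (((fderiv ℝ φ (L y)).le_opNorm (L 1)).trans ?_)
  simp

/-- The exponent `2 (n + 2) / n` for which we use the Sobolev inequality. -/
noncomputable def sobolevExponent (n : ℕ) : ℝ≥0 := 2 * (n + 2) / n

/-- The exponent is 2p with p = (n+2)/n conjugate to (n+2)/2, as Hölder's inequality with the
potential requires. It is finite in every dimension and below the critical 2n/(n−2) when n ≥ 3. -/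
theorem sobolev_smooth (hn : 1 ≤ n) (hΩ : IsC2Domain Ω) :
    ∃ C : ℝ≥0, ∀ φ : Space n → ℝ, ContDiff ℝ ∞ φ → HasCompactSupport φ → tsupport φ ⊆ Ω →
      eLpNorm φ (sobolevExponent n) (volume.restrict Ω) ≤
        C * eLpNorm (gradient φ) 2 (volume.restrict Ω) := by
  have hfin := isFiniteMeasure_restrict hΩ
  have hgrad : ∀ (φ : Space n → ℝ) (p : ℝ≥0∞),
      tsupport φ ⊆ Ω → eLpNorm (fderiv ℝ φ) p volume = eLpNorm (gradient φ) p (volume.restrict Ω) := by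
    intro φ p hs
    rw [eLpNorm_restrict_eq_of_support_subset
      ((subset_tsupport _).trans ((tsupport_gradient_subset φ).trans hs))]
    exact eLpNorm_congr_norm_ae (Filter.Eventually.of_forall fun x => (norm_gradient φ x).symm)
  have hpow : ∀ {a : ℝ}, 0 ≤ a → ∃ D : ℝ≥0, (volume.restrict Ω) univ ^ a = D := fun ha =>
    ⟨_, (ENNReal.coe_toNNReal (ENNReal.rpow_ne_top_of_nonneg ha (measure_ne_top _ _))).symm⟩
  rcases Nat.lt_or_ge 1 n with hn2 | hn1
  · have hn' : (2 : ℝ) ≤ n := by exact_mod_cast hn2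
    have hn0 : (0 : ℝ) < n := by linarith
    -- The exponent whose Sobolev conjugate is exactly 2(n+2)/n. Since p₁ < 2 ≤ n the inequality
    -- applies also for n = 2, and boundedness of Ω replaces L^{p₁} by L² on the gradient.
    set p₁ : ℝ≥0 := (1 / 2 + 2 / (n * (n + 2)))⁻¹ with hp₁
    have hp₁' : (p₁ : ℝ)⁻¹ = 1 / 2 + 2 / (n * (n + 2)) := by
      rw [hp₁]; push_cast; rw [inv_inv]
    have hx : 0 < (2 : ℝ) / (n * (n + 2)) := by positivity
    have hx4 : (2 : ℝ) / (n * (n + 2)) ≤ 1 / 4 := by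
      rw [div_le_iff₀ (by positivity)]; nlinarith
    have hp₁pos : (0 : ℝ) < p₁ := by
      rw [← inv_pos, hp₁']; linarith
    have hone : 1 ≤ p₁ := by
      rw [← NNReal.coe_le_coe, NNReal.coe_one, ← inv_le_one₀ hp₁pos]
      linarith
    have htwo : (p₁ : ℝ) < 2 := by
      rw [← inv_lt_inv₀ (by norm_num) hp₁pos, hp₁']; linarith
    have hlt : p₁ < Module.finrank ℝ (Space n) := by
      rw [finrank_euclideanSpace_fin, ← NNReal.coe_lt_coe, NNReal.coe_natCast]
      linarith
    have hle : ((p₁ : ℝ≥0) : ℝ)⁻¹ - (Module.finrank ℝ (Space n) : ℝ)⁻¹ ≤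
        ((sobolevExponent n : ℝ≥0) : ℝ)⁻¹ := by
      rw [finrank_euclideanSpace_fin, hp₁', sobolevExponent]
      push_cast
      apply le_of_eq
      field_simp
      ring
    obtain ⟨D, hD⟩ := hpow (a := 1 / ((p₁ : ℝ≥0∞)).toReal - 1 / (2 : ℝ≥0∞).toReal) (by
      simp only [ENNReal.coe_toReal, ENNReal.toReal_ofNat, one_div, hp₁']
      linarith)
    refine ⟨eLpNormLESNormFDerivOfLeConst ℝ volume Ω p₁ (sobolevExponent n) * D,
      fun φ h1 h2 h3 => ?_⟩
    have h4 := eLpNorm_le_eLpNorm_fderiv_of_le (μ := volume) (h1.of_le (by simp))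
      ((subset_tsupport φ).trans h3) hone hlt hle hΩ.isBounded
    rw [eLpNorm_restrict_eq_of_support_subset ((subset_tsupport φ).trans h3)]
    refine h4.trans ?_
    rw [hgrad φ _ h3, ENNReal.coe_mul, mul_assoc]
    gcongr
    have h5 := eLpNorm_le_eLpNorm_mul_rpow_measure_univ (μ := volume.restrict Ω)
      (p := p₁) (q := 2) (f := gradient φ)
      (by rw [← ENNReal.coe_ofNat, ENNReal.coe_le_coe, ← NNReal.coe_le_coe]; exact htwo.le)
      (continuous_gradient h1).aestronglyMeasurable
    rw [hD] at h5
    rwa [mul_comm]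
  · obtain rfl : n = 1 := le_antisymm hn1 hn
    obtain ⟨D, hD⟩ := hpow (a := 1 / ((sobolevExponent 1 : ℝ≥0∞)).toReal
      - 1 / (∞ : ℝ≥0∞).toReal) (by simp)
    obtain ⟨D', hD'⟩ := hpow (a := 1 / (1 : ℝ≥0∞).toReal - 1 / (2 : ℝ≥0∞).toReal) (by norm_num)
    refine ⟨D * D', fun φ h1 h2 h3 => ?_⟩
    have h4 := eLpNorm_le_eLpNorm_mul_rpow_measure_univ (μ := volume.restrict Ω)
      (p := sobolevExponent 1) (q := ∞) (f := φ) le_top h1.continuous.aestronglyMeasurable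
    have h5 := eLpNorm_le_eLpNorm_mul_rpow_measure_univ (μ := volume.restrict Ω)
      (p := 1) (q := 2) (f := gradient φ) (by norm_num)
      (continuous_gradient h1).aestronglyMeasurable
    have h6 := eLpNorm_top_le_fderiv_one (h1.of_le (by simp)) h2
    rw [hgrad φ _ h3] at h6
    rw [hD] at h4
    rw [hD'] at h5
    calc _ ≤ _ := h4
      _ ≤ eLpNorm (gradient φ) 1 (volume.restrict Ω) * D := by
        gcongr
        exact (eLpNorm_mono_measure _ Measure.restrict_le_self).trans h6
      _ ≤ eLpNorm (gradient φ) 2 (volume.restrict Ω) * D' * D := by gcongr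
      _ = _ := by rw [ENNReal.coe_mul]; ring

/-- Density, with lower semicontinuity of the norm along an almost everywhere convergent
subsequence, as v is not known beforehand to lie in the higher L^p. -/
theorem sobolev_hasGrad (hn : 1 ≤ n) (hΩ : IsC2Domain Ω) :
    ∃ C : ℝ≥0, ∀ (v : L2 Ω) (g : L2vec Ω), HasGrad Ω v g →
      eLpNorm v (sobolevExponent n) (volume.restrict Ω) ≤ C * ‖g‖ₑ := by
  obtain ⟨C, hC⟩ := sobolev_smooth hn hΩ
  refine ⟨C, fun v g h => ?_⟩
  obtain ⟨z, hz, hlim⟩ := mem_closure_iff_seq_limit.mp h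
  have h1 : Filter.Tendsto (fun k => (z k).1) Filter.atTop (𝓝 v) :=
    (continuous_fst.tendsto _).comp hlim
  have h2 : Filter.Tendsto (fun k => (z k).2) Filter.atTop (𝓝 g) :=
    (continuous_snd.tendsto _).comp hlim
  obtain ⟨ns, hns, hae⟩ := (tendstoInMeasure_of_tendsto_Lp h1).exists_seq_tendsto_ae
  refine (Lp.eLpNorm_lim_le_liminf_eLpNorm (fun k => (Lp.memLp (z (ns k)).1).1) _ hae).trans ?_
  have h3 : Filter.Tendsto (fun k => C * ‖(z (ns k)).2‖ₑ) Filter.atTop (𝓝 (C * ‖g‖ₑ)) :=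
    ENNReal.Tendsto.const_mul ((continuous_enorm.tendsto g).comp (h2.comp hns.tendsto_atTop))
      (Or.inr ENNReal.coe_ne_top)
  rw [← h3.liminf_eq]
  refine Filter.liminf_le_liminf (Filter.Eventually.of_forall fun k => ?_)
  obtain ⟨φ, k1, k2, k3, k4, k5⟩ := hz (ns k)
  rw [eLpNorm_congr_ae k4, Lp.enorm_def, eLpNorm_congr_ae k5]
  exact hC φ k1 k2 k3

/-- A potential is cut at height R: the low part is bounded, the high part is dominated by |x|^r
with a factor that vanishes as R → ∞. -/
theorem enorm_le_add_rpow {r R : ℝ} (hr : 1 < r) (hR : 0 < R) (x : ℝ) :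
    |x| ≤ R + R ^ (1 - r) * |x| ^ r := by
  rcases le_or_gt |x| R with h | h
  · exact h.trans (le_add_of_nonneg_right (by positivity))
  · have hx : 0 < |x| := hR.trans h
    have h1 : |x| = |x| ^ (1 - r) * |x| ^ r := by
      rw [← Real.rpow_add hx]; simp
    have h2 : |x| ^ (1 - r) ≤ R ^ (1 - r) :=
      Real.rpow_le_rpow_of_nonpos hR h.le (by linarith)
    have h3 : |x| ^ (1 - r) * |x| ^ r ≤ R ^ (1 - r) * |x| ^ r := by gcongr
    linarith

/-- A potential in the class `L^q`, `q > (n + 2) / 2`, is form bounded with small bound. -/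
theorem exists_potential_bound (hn : 1 ≤ n) (hΩ : IsC2Domain Ω) {q : ℝ≥0∞}
    (hq : ((n : ℝ≥0∞) + 2) / 2 < q) (M : ℝ≥0) {ε : ℝ} (hε : 0 < ε) :
    ∃ D : ℝ, 0 ≤ D ∧ ∀ η : Space n → ℝ, AEStronglyMeasurable η (volume.restrict Ω) →
      eLpNorm η q (volume.restrict Ω) ≤ M → ∀ (v : L2 Ω) (g : L2vec Ω), HasGrad Ω v g →
      Integrable (fun x => |η x| * v x ^ 2) (volume.restrict Ω) ∧
      ∫ x in Ω, |η x| * v x ^ 2 ≤ ε * ‖g‖ ^ 2 + D * ‖v‖ ^ 2 := by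
  have hfin := isFiniteMeasure_restrict hΩ
  obtain ⟨C, hC⟩ := sobolev_hasGrad hn hΩ
  have hn0 : (0 : ℝ) < n := by exact_mod_cast hn
  set s : ℝ := (n + 2) / 2 with hs
  have hs0 : 0 < s := by positivity
  -- A finite exponent strictly between s = (n+2)/2 and q, which may be ∞. The slack r = q₀/s > 1
  -- places |η|^r in L^s and produces the small form bound.
  obtain ⟨q₀, hq₀, hq₀q⟩ := ENNReal.lt_iff_exists_nnreal_btwn.mp hq
  have hsq : s < q₀ := by
    have : (((n : ℝ≥0∞) + 2) / 2) = ((((n : ℝ≥0) + 2) / 2 : ℝ≥0) : ℝ≥0∞) := by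
      rw [ENNReal.coe_div (by norm_num)]; push_cast; rfl
    rw [this, ENNReal.coe_lt_coe, ← NNReal.coe_lt_coe] at hq₀
    push_cast at hq₀
    exact hq₀
  have hq₀0 : (0 : ℝ) < q₀ := hs0.trans hsq
  set r : ℝ := q₀ / s with hr
  have hr1 : 1 < r := by rw [hr, one_lt_div hs0]; exact hsq
  have hr0 : 0 < r := by linarith
  set p : ℝ := (n + 2) / n with hp
  have hconj : s.HolderConjugate p := by
    rw [Real.holderConjugate_iff]
    refine ⟨?_, ?_⟩
    · rw [hs, lt_div_iff₀ (by norm_num)]; linarith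
    · rw [hs, hp]; field_simp; ring
  have hse : ((sobolevExponent n : ℝ≥0∞)).toReal = 2 * p := by
    rw [ENNReal.coe_toReal, sobolevExponent, hp]; push_cast; ring
  have hse0 : (sobolevExponent n : ℝ≥0∞) ≠ 0 := by
    intro h
    rw [h] at hse
    have : 0 < 2 * p := by positivity
    simp at hse
    linarith
  obtain ⟨A, hA⟩ : ∃ A : ℝ≥0, ∀ η : Space n → ℝ, AEStronglyMeasurable η (volume.restrict Ω) →
      eLpNorm η q (volume.restrict Ω) ≤ M → ∀ (v : L2 Ω) (g : L2vec Ω), HasGrad Ω v g →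
      ∫⁻ x in Ω, ‖η x‖ₑ ^ r * ‖v x‖ₑ ^ (2 : ℝ) ≤ A * ‖g‖ₑ ^ 2 := by
    have hexp : 0 ≤ 1 / ((q₀ : ℝ≥0∞)).toReal - 1 / q.toReal := by
      rcases eq_or_ne q ⊤ with rfl | hqt
      · simp
      · rw [sub_nonneg]
        apply one_div_le_one_div_of_le
        · simpa using hq₀0
        · exact ENNReal.toReal_mono hqt hq₀q.le
    set B : ℝ≥0∞ := ((M : ℝ≥0∞) * (volume.restrict Ω) univ ^
      (1 / ((q₀ : ℝ≥0∞)).toReal - 1 / q.toReal)) ^ r * (C : ℝ≥0∞) ^ 2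
    have hB : B ≠ ⊤ := by
      refine ENNReal.mul_ne_top (ENNReal.rpow_ne_top_of_nonneg hr0.le (ENNReal.mul_ne_top
        ENNReal.coe_ne_top (ENNReal.rpow_ne_top_of_nonneg hexp (measure_ne_top _ _)))) ?_
      exact ENNReal.pow_ne_top ENNReal.coe_ne_top
    refine ⟨B.toNNReal, fun η hη hM v g hv => ?_⟩
    rw [ENNReal.coe_toNNReal hB]
    have h1 := ENNReal.lintegral_mul_le_Lp_mul_Lq (volume.restrict Ω) hconj
      (f := fun x => ‖η x‖ₑ ^ r) (g := fun x => ‖v x‖ₑ ^ (2 : ℝ))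
      (hη.enorm.pow_const r) ((Lp.memLp v).1.enorm.pow_const 2)
    refine h1.trans ?_
    simp only [← ENNReal.rpow_mul]
    have e1 : r * s = q₀ := by rw [hr]; field_simp
    have e2 : (∫⁻ x in Ω, ‖η x‖ₑ ^ (r * s)) ^ (1 / s)
        = eLpNorm η q₀ (volume.restrict Ω) ^ r := by
      rw [eLpNorm_eq_lintegral_rpow_enorm_toReal (by simpa using hq₀0.ne') ENNReal.coe_ne_top,
        ← ENNReal.rpow_mul, ENNReal.coe_toReal, e1]
      congr 1
      rw [hr]; field_simp
    have e3 : (∫⁻ x in Ω, ‖v x‖ₑ ^ (2 * p)) ^ (1 / p)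
        = eLpNorm v (sobolevExponent n) (volume.restrict Ω) ^ (2 : ℝ) := by
      rw [eLpNorm_eq_lintegral_rpow_enorm_toReal hse0 ENNReal.coe_ne_top,
        ← ENNReal.rpow_mul, hse]
      congr 1
      field_simp
    rw [e2, e3, ENNReal.rpow_ofNat]
    calc eLpNorm η q₀ (volume.restrict Ω) ^ r
          * eLpNorm v (sobolevExponent n) (volume.restrict Ω) ^ 2
        ≤ ((M : ℝ≥0∞) * (volume.restrict Ω) univ ^
          (1 / ((q₀ : ℝ≥0∞)).toReal - 1 / q.toReal)) ^ r * (C * ‖g‖ₑ) ^ 2 := by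
          gcongr
          · refine (eLpNorm_le_eLpNorm_mul_rpow_measure_univ hq₀q.le hη).trans ?_
            gcongr
          · exact hC v g hv
      _ = _ := by rw [mul_pow]; simp only [B]; ring
  obtain ⟨R, hR0, hR⟩ : ∃ R : ℝ, 0 < R ∧ R ^ (1 - r) * A ≤ ε := by
    have ht : Filter.Tendsto (fun R : ℝ => R ^ (1 - r) * (A : ℝ)) Filter.atTop (𝓝 (0 * A)) := by
      have := tendsto_rpow_neg_atTop (y := r - 1) (by linarith)
      simp only [neg_sub] at this
      exact this.mul_const _
    rw [zero_mul] at ht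
    obtain ⟨R, h1, h2⟩ := ((ht.eventually_le_const hε).and (Filter.eventually_gt_atTop 0)).exists
    exact ⟨R, h2, h1⟩
  refine ⟨R, hR0.le, fun η hη hM v g hv => ?_⟩
  have hmeas : AEStronglyMeasurable (fun x => |η x| * v x ^ 2) (volume.restrict Ω) :=
    hη.norm.mul ((Lp.memLp v).1.pow 2)
  have hl : ∫⁻ x in Ω, ‖|η x| * v x ^ 2‖ₑ ≤ ENNReal.ofReal (ε * ‖g‖ ^ 2 + R * ‖v‖ ^ 2) := by
    have hpt : ∀ x, ‖|η x| * v x ^ 2‖ₑ ≤ ENNReal.ofReal (R ^ (1 - r)) *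
        (‖η x‖ₑ ^ r * ‖v x‖ₑ ^ (2 : ℝ)) + ENNReal.ofReal R * ‖v x‖ₑ ^ (2 : ℝ) := by
      intro x
      have h1 := mul_le_mul_of_nonneg_right (enorm_le_add_rpow hr1 hR0 (η x)) (sq_nonneg (v x))
      have e1 : ‖η x‖ₑ ^ r = ENNReal.ofReal (|η x| ^ r) := by
        rw [← ofReal_norm, Real.norm_eq_abs, ENNReal.ofReal_rpow_of_nonneg (abs_nonneg _) hr0.le]
      have e2 : ‖v x‖ₑ ^ (2 : ℝ) = ENNReal.ofReal (v x ^ 2) := by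
        rw [← ofReal_norm, Real.norm_eq_abs, ENNReal.rpow_ofNat,
          ← ENNReal.ofReal_pow (abs_nonneg _), sq_abs]
      rw [e1, e2, ← ENNReal.ofReal_mul (by positivity), ← ENNReal.ofReal_mul (by positivity),
        ← ENNReal.ofReal_mul (by positivity), ← ENNReal.ofReal_add (by positivity) (by positivity),
        ← ofReal_norm, Real.norm_of_nonneg (by positivity)]
      exact ENNReal.ofReal_le_ofReal (by linarith)
    refine (lintegral_mono hpt).trans ?_
    have m1 : AEMeasurable (fun x => ‖η x‖ₑ ^ r * ‖v x‖ₑ ^ (2 : ℝ)) (volume.restrict Ω) :=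
      (hη.enorm.pow_const r).mul ((Lp.memLp v).1.enorm.pow_const 2)
    rw [lintegral_add_left' (m1.const_mul _), lintegral_const_mul'' _ m1,
      lintegral_const_mul'' _ ((Lp.memLp v).1.enorm.pow_const 2)]
    have e4 : ∫⁻ x in Ω, ‖v x‖ₑ ^ (2 : ℝ) = ENNReal.ofReal (‖v‖ ^ 2) := by
      rw [ENNReal.ofReal_pow (norm_nonneg _), ofReal_norm, Lp.enorm_def,
        eLpNorm_eq_lintegral_rpow_enorm_toReal (by norm_num) (by norm_num), ← ENNReal.rpow_ofNat,
        ← ENNReal.rpow_mul]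
      norm_num
    have e5 : (A : ℝ≥0∞) * ‖g‖ₑ ^ 2 = ENNReal.ofReal (A * ‖g‖ ^ 2) := by
      rw [ENNReal.ofReal_mul (by positivity), ENNReal.ofReal_coe_nnreal,
        ENNReal.ofReal_pow (norm_nonneg _), ofReal_norm]
    have h3 := hA η hη hM v g hv
    rw [e5] at h3
    rw [e4, ← ENNReal.ofReal_mul hR0.le, ENNReal.ofReal_add (by positivity) (by positivity)]
    gcongr
    refine (mul_le_mul_right h3 _).trans ?_
    rw [← ENNReal.ofReal_mul (by positivity)]
    refine ENNReal.ofReal_le_ofReal ?_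
    rw [← mul_assoc]
    gcongr
  have hint : Integrable (fun x => |η x| * v x ^ 2) (volume.restrict Ω) :=
    ⟨hmeas, hl.trans_lt ENNReal.ofReal_lt_top⟩
  refine ⟨hint, ?_⟩
  have h5 := ofReal_integral_norm_eq_lintegral_enorm hint
  have h6 : ∫ x in Ω, ‖|η x| * v x ^ 2‖ = ∫ x in Ω, |η x| * v x ^ 2 :=
    integral_congr_ae (Filter.Eventually.of_forall fun x => Real.norm_of_nonneg (by positivity))
  rw [h6] at h5
  rw [← h5] at hl
  exact (ENNReal.ofReal_le_ofReal_iff (by positivity)).mp hl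

theorem integrable_potential {η : Space n → ℝ} (hη : AEStronglyMeasurable η (volume.restrict Ω))
    {v w : L2 Ω} (hv : Integrable (fun x => |η x| * v x ^ 2) (volume.restrict Ω))
    (hw : Integrable (fun x => |η x| * w x ^ 2) (volume.restrict Ω)) :
    Integrable (fun x => η x * v x * w x) (volume.restrict Ω) := by
  refine (hv.add hw).mono ((hη.mul (Lp.memLp v).1).mul (Lp.memLp w).1)
    (Filter.Eventually.of_forall fun x => ?_)
  simp only [Pi.add_apply, norm_mul, Real.norm_eq_abs]
  rw [abs_of_nonneg (by positivity : 0 ≤ |η x| * v x ^ 2 + |η x| * w x ^ 2), mul_assoc, ← mul_add,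
    ← sq_abs (v x), ← sq_abs (w x)]
  gcongr
  nlinarith [sq_nonneg (|v x| - |w x|), sq_nonneg (|v x|), sq_nonneg (|w x|)]

/-- The Cauchy-Schwarz inequality for the form of a potential. -/
theorem sq_integral_potential_le {η : Space n → ℝ}
    (hη : AEStronglyMeasurable η (volume.restrict Ω))
    {v w : L2 Ω} (hv : Integrable (fun x => |η x| * v x ^ 2) (volume.restrict Ω))
    (hw : Integrable (fun x => |η x| * w x ^ 2) (volume.restrict Ω)) :
    (∫ x in Ω, η x * v x * w x) ^ 2 ≤
      (∫ x in Ω, |η x| * v x ^ 2) * ∫ x in Ω, |η x| * w x ^ 2 := by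
  have hvw := (integrable_potential hη hv hw).norm
  have h1 : |∫ x in Ω, η x * v x * w x| ≤ ∫ x in Ω, ‖η x * v x * w x‖ :=
    abs_integral_le_integral_abs
  set c := ∫ x in Ω, ‖η x * v x * w x‖
  -- The quadratic polynomial is t ↦ ∫|η|(|v|t + |w|)² ≥ 0.
  have h2 : discrim (∫ x in Ω, |η x| * v x ^ 2) (2 * c) (∫ x in Ω, |η x| * w x ^ 2) ≤ 0 := by
    refine discrim_le_zero fun t => ?_
    have h3 : 0 ≤ ∫ x in Ω, ((|η x| * v x ^ 2) * (t * t) + 2 * ‖η x * v x * w x‖ * t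
        + |η x| * w x ^ 2) := by
      refine integral_nonneg fun x => ?_
      have : (|η x| * v x ^ 2) * (t * t) + 2 * ‖η x * v x * w x‖ * t + |η x| * w x ^ 2
          = |η x| * (|v x| * t + |w x|) ^ 2 := by
        simp only [norm_mul, Real.norm_eq_abs]
        rw [← sq_abs (v x), ← sq_abs (w x)]; ring
      simp only [this]
      positivity
    have h4 := (hv.mul_const (t * t)).add ((hvw.const_mul 2).mul_const t)
    simp only [Pi.add_def] at h4
    rw [integral_add h4 hw,
      integral_add (hv.mul_const _) ((hvw.const_mul 2).mul_const t), integral_mul_const,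
      integral_mul_const, integral_const_mul] at h3
    exact h3
  rw [discrim] at h2
  have h4 : (∫ x in Ω, η x * v x * w x) ^ 2 ≤ c ^ 2 := sq_le_sq' (by
    linarith [(abs_le.mp h1).1]) (abs_le.mp h1).2
  nlinarith

end ApproxPeriodic

/-! ### The operator (L₀+γ)^(-1/2) and the conjugated potential. -/

namespace ApproxPeriodic

section Diagonal

variable {H : Type*} [NormedAddCommGroup H] [InnerProductSpace ℝ H] (X : HilbertBasis ℕ ℝ H)

theorem summable_mul_coord_sq {m : ℕ → ℝ} (hm : ∀ j, m j ^ 2 ≤ 1) (z : H) :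
    Summable fun j => (m j * inner ℝ (X j) z) ^ 2 :=
  (hasSum_sq_coord X z).summable.of_nonneg_of_le (fun j => sq_nonneg _) fun j => by
    rw [mul_pow]; exact mul_le_of_le_one_left (sq_nonneg _) (hm j)

/-- The operator that multiplies the `j`-th coordinate by `m j`. -/
noncomputable def diagonal {m : ℕ → ℝ} (hm : ∀ j, m j ^ 2 ≤ 1) : H →ₗ[ℝ] H where
  toFun z := (exists_coord_eq X (summable_mul_coord_sq X hm z)).choose
  map_add' z z' := basis_ext X fun j => by
    rw [inner_add_right, (exists_coord_eq X (summable_mul_coord_sq X hm (z + z'))).choose_spec,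
      (exists_coord_eq X (summable_mul_coord_sq X hm z)).choose_spec,
      (exists_coord_eq X (summable_mul_coord_sq X hm z')).choose_spec, inner_add_right, mul_add]
  map_smul' c z := basis_ext X fun j => by
    rw [RingHom.id_apply, inner_smul_right,
      (exists_coord_eq X (summable_mul_coord_sq X hm (c • z))).choose_spec,
      (exists_coord_eq X (summable_mul_coord_sq X hm z)).choose_spec, inner_smul_right]
    ring

theorem inner_diagonal {m : ℕ → ℝ} (hm : ∀ j, m j ^ 2 ≤ 1) (z : H) (j : ℕ) :
    inner ℝ (X j) (diagonal X hm z) = m j * inner ℝ (X j) z :=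
  (exists_coord_eq X (summable_mul_coord_sq X hm z)).choose_spec j

theorem inner_highModes_self (K : ℕ) (v : H) :
    inner ℝ v (highModes X K v) = ‖highModes X K v‖ ^ 2 := by
  refine HasSum.unique (X.hasSum_inner_mul_inner v (highModes X K v)) ?_
  refine (hasSum_sq_coord X (highModes X K v)).congr_fun fun j => ?_
  rw [real_inner_comm (X j) v, inner_highModes]
  split_ifs
  · simp
  · ring

end Diagonal

variable {n : ℕ} {Ω : Set (Space n)}

/-- Potentials of norm at most `M` in `L^q` have form bound `a` relative to `L₀ + Γ`. -/
def PotentialBound (L₀ : EllipticOperator Ω) (q : ℝ≥0∞) (M : ℝ≥0) (a Γ : ℝ) : Prop :=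
  ∀ η : Space n → ℝ, AEStronglyMeasurable η (volume.restrict Ω) →
    eLpNorm η q (volume.restrict Ω) ≤ M → ∀ (v : L2 Ω) (g : L2vec Ω), HasGrad Ω v g →
    Integrable (fun x => |η x| * v x ^ 2) (volume.restrict Ω) ∧
    ∫ x in Ω, |η x| * v x ^ 2 ≤ a * (L₀.form v g v g + Γ * ‖v‖ ^ 2)

theorem PotentialBound.mono {L₀ : EllipticOperator Ω} {q : ℝ≥0∞} {M : ℝ≥0} {a Γ Γ' : ℝ}
    (ha : 0 ≤ a) (h : PotentialBound L₀ q M a Γ) (hΓ : Γ ≤ Γ') : PotentialBound L₀ q M a Γ' :=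
  fun η h1 h2 v g hv => ⟨(h η h1 h2 v g hv).1, (h η h1 h2 v g hv).2.trans (by gcongr)⟩

theorem exists_form_bound (hn : 1 ≤ n) (hΩ : IsC2Domain Ω) (L₀ : EllipticOperator Ω) {q : ℝ≥0∞}
    (hq : ((n : ℝ≥0∞) + 2) / 2 < q) (M : ℝ≥0) {a : ℝ} (ha : 0 < a) :
    ∃ Γ : ℝ, PotentialBound L₀ q M a Γ := by
  have hell := L₀.ell_pos
  obtain ⟨κ, -, hκ⟩ := L₀.exists_garding hΩ
  -- With this ε the gradient term is a times the left side of Gårding's inequality.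
  obtain ⟨D, hD0, hD⟩ := exists_potential_bound hn hΩ hq M (ε := a * (L₀.ell / 2)) (by positivity)
  refine ⟨κ + D / a, fun η h1 h2 v g hv => ⟨(hD η h1 h2 v g hv).1, ?_⟩⟩
  refine (hD η h1 h2 v g hv).2.trans ?_
  have h3 := mul_le_mul_of_nonneg_left (hκ v g) ha.le
  have h4 : a * (L₀.form v g v g + (κ + D / a) * ‖v‖ ^ 2)
      = a * (L₀.form v g v g + κ * ‖v‖ ^ 2) + D * ‖v‖ ^ 2 := by field_simp; ring
  rw [h4]
  linarith

section Operator

variable {L₀ : EllipticOperator Ω} {lam : ℕ → ℝ} {X : HilbertBasis ℕ ℝ (L2 Ω)} {γ κ : ℝ}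

theorem inv_sqrt_sq_le (h1 : ∀ j, 1 ≤ lam j + γ) (j : ℕ) : (√(lam j + γ))⁻¹ ^ 2 ≤ 1 := by
  have := h1 j
  rw [inv_pow, Real.sq_sqrt (by linarith)]
  exact inv_le_one_of_one_le₀ this

/-- The operator `(L₀ + γ)^(-1/2)`. -/
noncomputable def invSqrt (X : HilbertBasis ℕ ℝ (L2 Ω)) (h1 : ∀ j, 1 ≤ lam j + γ) :
    L2 Ω →ₗ[ℝ] L2 Ω :=
  diagonal X (m := fun j => (√(lam j + γ))⁻¹) (inv_sqrt_sq_le h1)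

theorem inner_invSqrt (h1 : ∀ j, 1 ≤ lam j + γ) (z : L2 Ω) (j : ℕ) :
    inner ℝ (X j) (invSqrt X h1 z) = (√(lam j + γ))⁻¹ * inner ℝ (X j) z :=
  inner_diagonal X _ z j

theorem energy_invSqrt (h1 : ∀ j, 1 ≤ lam j + γ) (z : L2 Ω) :
    HasSum (fun j => (lam j + γ) * inner ℝ (X j) (invSqrt X h1 z) ^ 2) (‖z‖ ^ 2) := by
  refine (hasSum_sq_coord X z).congr_fun fun j => ?_
  have := h1 j
  rw [inner_invSqrt, mul_pow, inv_pow, Real.sq_sqrt (by linarith)]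
  field_simp

/-- The operator is an isometry from L² into H¹₀ with the energy norm of L₀ + γ, so form bounds
become operator bounds on L². -/
theorem exists_grad_invSqrt (hΩ : IsC2Domain Ω) (hX : IsEigenbasis L₀ lam X)
    (hκ : IsGarding L₀ κ) (hγ : κ + 1 ≤ γ) (h1 : ∀ j, 1 ≤ lam j + γ) (z : L2 Ω) :
    ∃ h : L2vec Ω, HasGrad Ω (invSqrt X h1 z) h ∧
      L₀.form (invSqrt X h1 z) h (invSqrt X h1 z) h + γ * ‖invSqrt X h1 z‖ ^ 2 = ‖z‖ ^ 2 := by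
  obtain ⟨h, hh⟩ := hX.exists_hasGrad hΩ hκ hγ (energy_invSqrt h1 z).summable
  exact ⟨h, hh, (hX.hasSum_energy hΩ hh γ).unique (energy_invSqrt h1 z)⟩

theorem potential_invSqrt_le (hΩ : IsC2Domain Ω) (hX : IsEigenbasis L₀ lam X)
    (hκ : IsGarding L₀ κ) (hγ : κ + 1 ≤ γ) (h1 : ∀ j, 1 ≤ lam j + γ) {q : ℝ≥0∞} {M : ℝ≥0} {a : ℝ}
    (hP : PotentialBound L₀ q M a γ) {η : Space n → ℝ}
    (hη : AEStronglyMeasurable η (volume.restrict Ω))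
    (hM : eLpNorm η q (volume.restrict Ω) ≤ M) (z : L2 Ω) :
    Integrable (fun x => |η x| * invSqrt X h1 z x ^ 2) (volume.restrict Ω) ∧
    ∫ x in Ω, |η x| * invSqrt X h1 z x ^ 2 ≤ a * ‖z‖ ^ 2 := by
  obtain ⟨h, hh, he⟩ := exists_grad_invSqrt hΩ hX hκ hγ h1 z
  rw [← he]
  exact hP η hη hM _ h hh

/-- When λ_j ≥ Γ one has λ_j + Γ ≤ 2(λ_j + γ). A very small a is thus available on high modes
although its Γ may far exceed γ. -/
theorem potential_invSqrt_high_le (hΩ : IsC2Domain Ω) (hX : IsEigenbasis L₀ lam X)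
    (hκ : IsGarding L₀ κ) (hγ : κ + 1 ≤ γ) (h1 : ∀ j, 1 ≤ lam j + γ) {q : ℝ≥0∞} {M : ℝ≥0} {a Γ : ℝ}
    (ha : 0 ≤ a) (hP : PotentialBound L₀ q M a Γ) {η : Space n → ℝ}
    (hη : AEStronglyMeasurable η (volume.restrict Ω))
    (hM : eLpNorm η q (volume.restrict Ω) ≤ M) {K : ℕ} (hK : ∀ j, K ≤ j → Γ ≤ lam j) (z : L2 Ω)
    (hz : ∀ j, j < K → inner ℝ (X j) z = 0) :
    ∫ x in Ω, |η x| * invSqrt X h1 z x ^ 2 ≤ 2 * a * ‖z‖ ^ 2 := by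
  obtain ⟨h, hh, he⟩ := exists_grad_invSqrt hΩ hX hκ hγ h1 z
  refine (hP η hη hM _ h hh).2.trans ?_
  rw [mul_comm 2 a, mul_assoc]
  refine mul_le_mul_of_nonneg_left ?_ ha
  refine hasSum_le (fun j => ?_) (hX.hasSum_energy hΩ hh Γ) ((energy_invSqrt (X := X) h1 z).mul_left 2)
  rcases lt_or_ge j K with hj | hj
  · rw [inner_invSqrt, hz j hj]; simp
  · rw [← mul_assoc]
    refine mul_le_mul_of_nonneg_right ?_ (sq_nonneg _)
    have := hκ.1
    linarith [hK j hj]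

theorem exists_potentialOp (hΩ : IsC2Domain Ω) (hX : IsEigenbasis L₀ lam X)
    (hκ : IsGarding L₀ κ) (hγ : κ + 1 ≤ γ) (h1 : ∀ j, 1 ≤ lam j + γ) {q : ℝ≥0∞} {M : ℝ≥0} {a : ℝ}
    (ha : 0 ≤ a) (hP : PotentialBound L₀ q M a γ) {η : Space n → ℝ}
    (hη : AEStronglyMeasurable η (volume.restrict Ω))
    (hM : eLpNorm η q (volume.restrict Ω) ≤ M) :
    ∃ E : L2 Ω →L[ℝ] L2 Ω, ∀ z z', inner ℝ (E z) z'
      = ∫ x in Ω, η x * invSqrt X h1 z x * invSqrt X h1 z' x := by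
  have hb := potential_invSqrt_le hΩ hX hκ hγ h1 hP hη hM
  have hi : ∀ z z', Integrable (fun x => η x * invSqrt X h1 z x * invSqrt X h1 z' x)
      (volume.restrict Ω) := fun z z' => integrable_potential hη (hb z).1 (hb z').1
  let B : L2 Ω →ₗ[ℝ] L2 Ω →ₗ[ℝ] ℝ :=
    LinearMap.mk₂ ℝ (fun z z' => ∫ x in Ω, η x * invSqrt X h1 z x * invSqrt X h1 z' x)
      (fun p p' r => by
        rw [← integral_add (hi p r) (hi p' r), map_add]
        refine integral_congr_ae ?_
        filter_upwards [Lp.coeFn_add (invSqrt X h1 p) (invSqrt X h1 p')] with x hx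
        rw [hx, Pi.add_apply]; ring)
      (fun k p r => by
        rw [smul_eq_mul, ← integral_const_mul, map_smul]
        refine integral_congr_ae ?_
        filter_upwards [Lp.coeFn_smul k (invSqrt X h1 p)] with x hx
        rw [hx, Pi.smul_apply, smul_eq_mul]; ring)
      (fun p r r' => by
        rw [← integral_add (hi p r) (hi p r'), map_add]
        refine integral_congr_ae ?_
        filter_upwards [Lp.coeFn_add (invSqrt X h1 r) (invSqrt X h1 r')] with x hx
        rw [hx, Pi.add_apply]; ring)
      (fun k p r => by
        rw [smul_eq_mul, ← integral_const_mul, map_smul]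
        refine integral_congr_ae ?_
        filter_upwards [Lp.coeFn_smul k (invSqrt X h1 r)] with x hx
        rw [hx, Pi.smul_apply, smul_eq_mul]; ring)
  let Bc : L2 Ω →L[ℝ] L2 Ω →L[ℝ] ℝ := B.mkContinuous₂ a (fun z z' => by
    change ‖∫ x in Ω, η x * invSqrt X h1 z x * invSqrt X h1 z' x‖ ≤ _
    rw [Real.norm_eq_abs]
    refine abs_le_of_sq_le_sq ?_ (by positivity)
    refine (sq_integral_potential_le hη (hb z).1 (hb z').1).trans ?_
    calc _ ≤ (a * ‖z‖ ^ 2) * (a * ‖z'‖ ^ 2) :=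
          mul_le_mul (hb z).2 (hb z').2 (integral_nonneg fun x => by positivity) (by positivity)
      _ = _ := by ring)
  refine ⟨InnerProductSpace.continuousLinearMapOfBilin (𝕜 := ℝ) Bc, fun z z' => ?_⟩
  rw [InnerProductSpace.continuousLinearMapOfBilin_apply]
  rfl

theorem norm_potentialOp_le (hΩ : IsC2Domain Ω) (hX : IsEigenbasis L₀ lam X)
    (hκ : IsGarding L₀ κ) (hγ : κ + 1 ≤ γ) (h1 : ∀ j, 1 ≤ lam j + γ) {q : ℝ≥0∞} {M : ℝ≥0}
    (hP : PotentialBound L₀ q M (1 / 4) γ) {η : Space n → ℝ}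
    (hη : AEStronglyMeasurable η (volume.restrict Ω))
    (hM : eLpNorm η q (volume.restrict Ω) ≤ M) {E : L2 Ω →L[ℝ] L2 Ω}
    (hE : ∀ z z', inner ℝ (E z) z' = ∫ x in Ω, η x * invSqrt X h1 z x * invSqrt X h1 z' x)
    (z : L2 Ω) : ‖E z‖ ^ 2 ≤ 1 / 16 * ‖z‖ ^ 2 := by
  have hb := potential_invSqrt_le hΩ hX hκ hγ h1 hP hη hM
  have h2 := hE z (E z)
  rw [real_inner_self_eq_norm_sq] at h2
  have h3 := sq_integral_potential_le hη (hb z).1 (hb (E z)).1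
  rw [← h2] at h3
  have h4 : (‖E z‖ ^ 2) ^ 2 ≤ (1 / 4 * ‖z‖ ^ 2) * (1 / 4 * ‖E z‖ ^ 2) :=
    h3.trans (mul_le_mul (hb z).2 (hb (E z)).2 (integral_nonneg fun x => by positivity)
      (by positivity))
  rcases eq_or_lt_of_le (sq_nonneg ‖E z‖) with h0 | h0
  · rw [← h0]; positivity
  · refine le_of_mul_le_mul_right ?_ h0
    nlinarith

/-- Pairing E z with its own high part w places only high modes in the second Cauchy–Schwarz factor:
‖w‖⁴ ≤ (1/4)‖z‖² · 2a‖w‖². -/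
theorem norm_high_potentialOp_le (hΩ : IsC2Domain Ω) (hX : IsEigenbasis L₀ lam X)
    (hκ : IsGarding L₀ κ) (hγ : κ + 1 ≤ γ) (h1 : ∀ j, 1 ≤ lam j + γ) {q : ℝ≥0∞} {M : ℝ≥0}
    (hP : PotentialBound L₀ q M (1 / 4) γ) {a Γ : ℝ} (ha : 0 ≤ a)
    (hP' : PotentialBound L₀ q M a Γ) {K : ℕ} (hK : ∀ j, K ≤ j → Γ ≤ lam j) {η : Space n → ℝ}
    (hη : AEStronglyMeasurable η (volume.restrict Ω))
    (hM : eLpNorm η q (volume.restrict Ω) ≤ M) {E : L2 Ω →L[ℝ] L2 Ω}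
    (hE : ∀ z z', inner ℝ (E z) z' = ∫ x in Ω, η x * invSqrt X h1 z x * invSqrt X h1 z' x)
    (z : L2 Ω) : ‖highModes X K (E z)‖ ^ 2 ≤ a / 2 * ‖z‖ ^ 2 := by
  have hb := potential_invSqrt_le hΩ hX hκ hγ h1 hP hη hM
  set w := highModes X K (E z)
  have h2 := hE z w
  rw [inner_highModes_self] at h2
  have h3 := sq_integral_potential_le hη (hb z).1 (hb w).1
  rw [← h2] at h3
  have h5 := potential_invSqrt_high_le hΩ hX hκ hγ h1 ha hP' hη hM hK w
    (fun j hj => by rw [inner_highModes, if_pos hj])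
  have h4 : (‖w‖ ^ 2) ^ 2 ≤ (1 / 4 * ‖z‖ ^ 2) * (2 * a * ‖w‖ ^ 2) :=
    h3.trans (mul_le_mul (hb z).2 h5 (integral_nonneg fun x => by positivity)
      (by positivity))
  rcases eq_or_lt_of_le (sq_nonneg ‖w‖) with h0 | h0
  · rw [← h0]; positivity
  · refine le_of_mul_le_mul_right ?_ h0
    nlinarith

/-- The family of operators `(L₀ + γ)^(-1/2) e(t) (L₀ + γ)^(-1/2)` for a potential `e`. -/
theorem exists_potentialFamily (hΩ : IsC2Domain Ω) (hX : IsEigenbasis L₀ lam X)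
    (hκ : IsGarding L₀ κ) (hγ : κ + 1 ≤ γ) (h1 : ∀ j, 1 ≤ lam j + γ) {q : ℝ≥0∞} {M : ℝ≥0}
    (hP : PotentialBound L₀ q M (1 / 4) γ) {T Γ : ℝ}
    (hP' : PotentialBound L₀ q M (Real.exp (-(2 * γ * T)) / 64) Γ)
    {K : ℕ} (hK : ∀ j, K ≤ j → Γ ≤ lam j)
    {e : Space n → ℝ → ℝ} (he : e ∈ errorClass Ω T q M) :
    ∃ E : ℝ → L2 Ω →L[ℝ] L2 Ω, IsSmallFamily X γ T K E ∧
      ∀ᵐ t ∂volume.restrict (Ioo 0 T), ∀ z z', inner ℝ (E t z) z'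
        = ∫ x in Ω, e x t * invSqrt X h1 z x * invSqrt X h1 z' x := by
  classical
  -- At exceptional times E is set to 0, so that the operator bounds hold for every t.
  let good : ℝ → Prop := fun t => AEStronglyMeasurable (fun x => e x t) (volume.restrict Ω) ∧
    eLpNorm (fun x => e x t) q (volume.restrict Ω) ≤ M
  have hgood : ∀ᵐ t ∂volume.restrict (Ioo 0 T), good t := by
    filter_upwards [he.1.prod_swap.prodMk_left, he.2] with t a b
    exact ⟨a, b⟩
  have hex : ∀ t, ∃ E : L2 Ω →L[ℝ] L2 Ω, (good t → ∀ z z', inner ℝ (E z) z'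
      = ∫ x in Ω, e x t * invSqrt X h1 z x * invSqrt X h1 z' x) ∧ (¬ good t → E = 0) := by
    intro t
    by_cases ht : good t
    · obtain ⟨E, hE⟩ := exists_potentialOp hΩ hX hκ hγ h1 (by norm_num) hP ht.1 ht.2
      exact ⟨E, fun _ => hE, fun h => absurd ht h⟩
    · exact ⟨0, fun h => absurd h ht, fun _ => rfl⟩
  choose E hE hE0 using hex
  have hEae : ∀ᵐ t ∂volume.restrict (Ioo 0 T), ∀ z z', inner ℝ (E t z) z'
      = ∫ x in Ω, e x t * invSqrt X h1 z x * invSqrt X h1 z' x := by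
    filter_upwards [hgood] with t ht
    exact hE t ht
  refine ⟨E, ⟨fun i j => ?_, fun t z => ?_, fun t z => ?_⟩, hEae⟩
  · have hm : AEStronglyMeasurable (fun p : ℝ × Space n => e p.2 p.1 * invSqrt X h1 (X i) p.2
        * invSqrt X h1 (X j) p.2) ((volume.restrict (Ioo 0 T)).prod (volume.restrict Ω)) :=
      (he.1.prod_swap.mul (Lp.memLp (invSqrt X h1 (X i))).1.comp_snd).mul
        (Lp.memLp (invSqrt X h1 (X j))).1.comp_snd
    refine hm.integral_prod_right'.congr ?_
    filter_upwards [hEae] with t ht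
    rw [ht]
  · by_cases ht : good t
    · exact norm_potentialOp_le hΩ hX hκ hγ h1 hP ht.1 ht.2 (hE t ht) z
    · rw [hE0 t ht]; simp
  · by_cases ht : good t
    · have h2 := norm_high_potentialOp_le hΩ hX hκ hγ h1 hP (by positivity) hP' hK ht.1 ht.2
        (hE t ht) z
      have h3 : Real.exp (2 * γ * T) * Real.exp (-(2 * γ * T)) = 1 := by
        rw [← Real.exp_add]; simp
      calc _ ≤ 8 * Real.exp (2 * γ * T) * (Real.exp (-(2 * γ * T)) / 64 / 2 * ‖z‖ ^ 2) := by
            gcongr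
        _ = 1 / 16 * (Real.exp (2 * γ * T) * Real.exp (-(2 * γ * T))) * ‖z‖ ^ 2 := by ring
        _ = _ := by rw [h3]; ring
    · rw [hE0 t ht]; simp

end Operator

end ApproxPeriodic

/-! ### Time slices of f and the rescaled unknown y = (L₀+γ)^(1/2) u. -/

namespace ApproxPeriodic

section HilbertValued

variable {H : Type*} [NormedAddCommGroup H] [InnerProductSpace ℝ H]
  (X : HilbertBasis ℕ ℝ H) {α : Type*} [MeasurableSpace α] {μ : Measure α}

theorem integrable_inner {a b : α → H} (ha : MemLp a 2 μ) (hb : MemLp b 2 μ) :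
    Integrable (fun t => inner ℝ (a t) (b t)) μ := by
  refine (ha.norm.integrable_mul hb.norm).mono (ha.1.inner hb.1)
    (Filter.Eventually.of_forall fun t => ?_)
  refine (norm_inner_le_norm _ _).trans (le_of_eq ?_)
  rw [Pi.mul_apply, Real.norm_of_nonneg (by positivity)]

theorem hasSum_integral_coord_mul {a b : α → H} (ha : MemLp a 2 μ) (hb : MemLp b 2 μ) :
    HasSum (fun j => ∫ t, inner ℝ (X j) (a t) * inner ℝ (X j) (b t) ∂μ)
      (∫ t, inner ℝ (a t) (b t) ∂μ) := by
  have hi : ∀ j, Integrable (fun t => inner ℝ (X j) (a t) * inner ℝ (X j) (b t)) μ :=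
    fun j => (MemLp.coord X ha j).integrable_mul (MemLp.coord X hb j)
  have hs : Summable fun j => ∫ t, ‖inner ℝ (X j) (a t) * inner ℝ (X j) (b t)‖ ∂μ := by
    refine Summable.of_nonneg_of_le (fun j => by positivity) (fun j => ?_)
      ((hasSum_integral_coord_sq X ha).summable.add (hasSum_integral_coord_sq X hb).summable)
    have ia := (MemLp.coord X ha j).integrable_sq
    have ib := (MemLp.coord X hb j).integrable_sq
    rw [← integral_add ia ib]
    refine integral_mono (hi j).norm (ia.add ib) fun t => ?_
    simp only [norm_mul, Real.norm_eq_abs]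
    rw [← sq_abs (inner ℝ (X j) (a t)), ← sq_abs (inner ℝ (X j) (b t))]
    nlinarith [sq_nonneg (|inner ℝ (X j) (a t)| - |inner ℝ (X j) (b t)|),
      sq_nonneg (|inner ℝ (X j) (a t)|), sq_nonneg (|inner ℝ (X j) (b t)|)]
  have h1 := hasSum_integral_of_summable_integral_norm hi hs
  rwa [integral_congr_ae (Filter.Eventually.of_forall fun t =>
    ((X.hasSum_inner_mul_inner (a t) (b t)).congr_fun
      fun j => by rw [real_inner_comm (a t)]).tsum_eq)] at h1

theorem norm_highModes_le (K : ℕ) (v : H) : ‖highModes X K v‖ ≤ ‖v‖ := by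
  have h1 := inner_highModes_self X K v
  have h2 := real_inner_le_norm v (highModes X K v)
  rw [h1, sq] at h2
  rcases eq_or_lt_of_le (norm_nonneg (highModes X K v)) with h0 | h0
  · rw [← h0]; positivity
  · exact le_of_mul_le_mul_right h2 h0

end HilbertValued

variable {n : ℕ} {Ω : Set (Space n)} {T : ℝ}

/-- A function in `L²(Q)` as a function of time with values in `L²(Ω)`. -/
theorem exists_slices (X : HilbertBasis ℕ ℝ (L2 Ω)) {f : Space n → ℝ → ℝ} (hf : MemL2Q Ω T f) :
    ∃ F : ℝ → L2 Ω, MemLp F 2 (volume.restrict (Ioo 0 T)) ∧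
      (∀ᵐ t ∂volume.restrict (Ioo 0 T), F t =ᵐ[volume.restrict Ω] fun x => f x t) ∧
      ∫ t in Ioo 0 T, ‖F t‖ ^ 2 = ∫ p : Space n × ℝ, f p.1 p.2 ^ 2
        ∂((volume.restrict Ω).prod (volume.restrict (Ioo 0 T))) := by
  classical
  have hsq : Integrable (fun p : Space n × ℝ => f p.1 p.2 ^ 2)
    ((volume.restrict Ω).prod (volume.restrict (Ioo 0 T))) := hf.integrable_sq
  have hmem : ∀ᵐ t ∂volume.restrict (Ioo 0 T), MemLp (fun x => f x t) 2 (volume.restrict Ω) := by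
    filter_upwards [hf.1.prod_swap.prodMk_left, hsq.swap.prod_right_ae] with t h1 h2
    exact (memLp_two_iff_integrable_sq h1).mpr h2
  let F : ℝ → L2 Ω := fun t => if h : MemLp (fun x => f x t) 2 (volume.restrict Ω) then
    h.toLp _ else 0
  have hF : ∀ᵐ t ∂volume.restrict (Ioo 0 T), F t =ᵐ[volume.restrict Ω] fun x => f x t := by
    filter_upwards [hmem] with t ht
    simp only [F, dif_pos ht]
    exact ht.coeFn_toLp
  have hFm : AEStronglyMeasurable F (volume.restrict (Ioo 0 T)) := by
    refine aestronglyMeasurable_of_coord X fun j => ?_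
    have hm : AEStronglyMeasurable (fun p : ℝ × Space n => X j p.2 * f p.2 p.1)
        ((volume.restrict (Ioo 0 T)).prod (volume.restrict Ω)) :=
      (Lp.memLp (X j)).1.comp_snd.mul hf.1.prod_swap
    refine hm.integral_prod_right'.congr ?_
    filter_upwards [hF] with t ht
    rw [L2.inner_def]
    refine integral_congr_ae ?_
    filter_upwards [ht] with x hx
    rw [hx]; simp [mul_comm]
  have hnorm : ∀ᵐ t ∂volume.restrict (Ioo 0 T), ‖F t‖ ^ 2 = ∫ x in Ω, f x t ^ 2 := by
    filter_upwards [hF] with t ht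
    rw [EllipticOperator.L2_norm_sq]
    refine integral_congr_ae ?_
    filter_upwards [ht] with x hx
    rw [hx]
  refine ⟨F, ?_, hF, ?_⟩
  · rw [memLp_two_iff_integrable_sq_norm hFm]
    exact hsq.integral_prod_right.congr (hnorm.mono fun t ht => ht.symm)
  · rw [integral_congr_ae hnorm, integral_prod_symm _ hsq]

section Scaled

variable {L₀ : EllipticOperator Ω} {lam : ℕ → ℝ} {X : HilbertBasis ℕ ℝ (L2 Ω)} {γ κ : ℝ}

/-- At almost every t the energy of u(t) is finite, so the rescaled coordinates define a vector.
Boundedness of the form makes y square integrable in time. -/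
theorem exists_scaled (hΩ : IsC2Domain Ω) (hX : IsEigenbasis L₀ lam X)
    (h1 : ∀ j, 1 ≤ lam j + γ) {u : ℝ → L2 Ω} {G : ℝ → L2vec Ω} (hu : MemL2H10 Ω T u G) :
    ∃ y : ℝ → L2 Ω, MemLp y 2 (volume.restrict (Ioo 0 T)) ∧
      ∀ᵐ t ∂volume.restrict (Ioo 0 T),
        (∀ j, inner ℝ (X j) (y t) = √(lam j + γ) * inner ℝ (X j) (u t)) ∧
        ‖y t‖ ^ 2 = L₀.form (u t) (G t) (u t) (G t) + γ * ‖u t‖ ^ 2 := by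
  have hex : ∀ᵐ t ∂volume.restrict (Ioo 0 T), ∃ z : L2 Ω,
      (∀ j, inner ℝ (X j) z = √(lam j + γ) * inner ℝ (X j) (u t)) ∧
        ‖z‖ ^ 2 = L₀.form (u t) (G t) (u t) (G t) + γ * ‖u t‖ ^ 2 := by
    filter_upwards [hu.hasGrad] with t ht
    have hs := (hX.hasSum_energy hΩ ht γ).congr_fun
      (g := fun j => (√(lam j + γ) * inner ℝ (X j) (u t)) ^ 2) fun j => by
        rw [mul_pow, Real.sq_sqrt (by linarith [h1 j])]
    obtain ⟨z, hz⟩ := exists_coord_eq X hs.summable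
    refine ⟨z, hz, (hasSum_sq_coord X z).unique (hs.congr_fun fun j => by rw [hz])⟩
  classical
  let y : ℝ → L2 Ω := fun t => if h : ∃ z : L2 Ω,
      (∀ j, inner ℝ (X j) z = √(lam j + γ) * inner ℝ (X j) (u t)) ∧
        ‖z‖ ^ 2 = L₀.form (u t) (G t) (u t) (G t) + γ * ‖u t‖ ^ 2 then h.choose else 0
  have hy : ∀ᵐ t ∂volume.restrict (Ioo 0 T),
        (∀ j, inner ℝ (X j) (y t) = √(lam j + γ) * inner ℝ (X j) (u t)) ∧
        ‖y t‖ ^ 2 = L₀.form (u t) (G t) (u t) (G t) + γ * ‖u t‖ ^ 2 := by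
    filter_upwards [hex] with t ht
    simp only [y, dif_pos ht]
    exact ht.choose_spec
  have hym : AEStronglyMeasurable y (volume.restrict (Ioo 0 T)) := by
    refine aestronglyMeasurable_of_coord X fun j => ?_
    refine ((MemLp.coord X hu.memLp j).1.const_mul (√(lam j + γ))).congr ?_
    filter_upwards [hy] with t ht
    rw [ht.1]
  refine ⟨y, ?_, hy⟩
  set C := ‖L₀.formL hΩ‖ + |γ|
  have hC : 0 ≤ C := by positivity
  have hb : MemLp (fun t => √C * (‖u t‖ + ‖G t‖)) 2 (volume.restrict (Ioo 0 T)) :=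
    (hu.memLp.norm.add hu.memLp_grad.norm).const_mul _
  refine hb.mono hym ?_
  filter_upwards [hy] with t ht
  rw [Real.norm_of_nonneg (by positivity)]
  refine (sq_le_sq₀ (norm_nonneg _) (by positivity)).mp ?_
  rw [ht.2, mul_pow, Real.sq_sqrt hC, ← L₀.formL_apply hΩ]
  have h2 : L₀.formL hΩ (u t, G t) (u t, G t) ≤ ‖L₀.formL hΩ‖ * (‖u t‖ + ‖G t‖) ^ 2 := by
    have h3 : ‖((u t, G t) : L2 Ω × L2vec Ω)‖ ≤ ‖u t‖ + ‖G t‖ := by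
      rw [Prod.norm_def]
      exact max_le (le_add_of_nonneg_right (norm_nonneg _)) (le_add_of_nonneg_left (norm_nonneg _))
    calc _ ≤ ‖L₀.formL hΩ (u t, G t) (u t, G t)‖ := le_abs_self _
      _ ≤ ‖L₀.formL hΩ‖ * ‖((u t, G t) : L2 Ω × L2vec Ω)‖ * ‖((u t, G t) : L2 Ω × L2vec Ω)‖ :=
        (L₀.formL hΩ).le_opNorm₂ _ _
      _ ≤ ‖L₀.formL hΩ‖ * (‖u t‖ + ‖G t‖) * (‖u t‖ + ‖G t‖) := by gcongr
      _ = _ := by ring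
  have h4 : γ * ‖u t‖ ^ 2 ≤ |γ| * (‖u t‖ + ‖G t‖) ^ 2 := by
    refine mul_le_mul (le_abs_self γ) ?_ (by positivity) (abs_nonneg _)
    gcongr
    exact le_add_of_nonneg_right (norm_nonneg _)
  simp only [C]
  linarith

theorem invSqrt_eq_of_coord (h1 : ∀ j, 1 ≤ lam j + γ) {y v : L2 Ω}
    (h : ∀ j, inner ℝ (X j) y = √(lam j + γ) * inner ℝ (X j) v) : invSqrt X h1 y = v := by
  refine basis_ext X fun j => ?_
  have : √(lam j + γ) ≠ 0 := (Real.sqrt_pos.mpr (by linarith [h1 j])).ne'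
  rw [inner_invSqrt, h, inv_mul_cancel_left₀ this]

theorem invSqrt_basis (h1 : ∀ j, 1 ≤ lam j + γ) (j : ℕ) :
    X j = √(lam j + γ) • invSqrt X h1 (X j) := by
  have : √(lam j + γ) ≠ 0 := (Real.sqrt_pos.mpr (by linarith [h1 j])).ne'
  refine basis_ext X fun i => ?_
  rw [inner_smul_right, inner_invSqrt]
  simp only [orthonormal_iff_ite.mp X.orthonormal i]
  split_ifs with h
  · subst h; field_simp
  · simp

theorem norm_invSqrt_le (h1 : ∀ j, 1 ≤ lam j + γ) (z : L2 Ω) : ‖invSqrt X h1 z‖ ≤ ‖z‖ := by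
  refine (sq_le_sq₀ (norm_nonneg _) (norm_nonneg _)).mp ?_
  refine hasSum_le (fun j => ?_) (hasSum_sq_coord X (invSqrt X h1 z)) (hasSum_sq_coord X z)
  rw [inner_invSqrt, mul_pow]
  exact mul_le_of_le_one_left (sq_nonneg _) (inv_sqrt_sq_le h1 j)

theorem memLp_invSqrt (h1 : ∀ j, 1 ≤ lam j + γ) {F : ℝ → L2 Ω}
    (hF : MemLp F 2 (volume.restrict (Ioo 0 T))) :
    MemLp (fun t => invSqrt X h1 (F t)) 2 (volume.restrict (Ioo 0 T)) := by
  refine hF.mono (aestronglyMeasurable_of_coord X fun j => ?_)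
    (Filter.Eventually.of_forall fun t => norm_invSqrt_le h1 (F t))
  simp only [inner_invSqrt]
  exact (aestronglyMeasurable_const.inner hF.1).const_mul _

end Scaled

theorem isTestFunction_const (v : L2 Ω) {g : L2vec Ω} (hv : HasGrad Ω v g) :
    IsTestFunction Ω T (fun _ => v) (fun _ => 0) (fun _ => g) where
  memL2H10 := ⟨memLp_const v, memLp_const g, Filter.Eventually.of_forall fun _ => hv⟩
  memLp_deriv := memLp_const 0
  eq_integral t _ := by simp

theorem ae_uIoc_of_ae {t : ℝ} (ht : t ∈ Icc 0 T) {p : ℝ → Prop}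
    (h : ∀ᵐ s ∂volume.restrict (Ioo 0 T), p s) : ∀ᵐ s, s ∈ uIoc 0 t → p s := by
  have h1 : ∀ᵐ s : ℝ, s ≠ T := by simp [ae_iff, measure_singleton]
  rw [ae_restrict_iff' measurableSet_Ioo] at h
  filter_upwards [h, h1] with s hs hsT hst
  rw [uIoc_of_le ht.1] at hst
  exact hs ⟨hst.1, lt_of_le_of_ne (hst.2.trans ht.2) hsT⟩

theorem intervalIntegrable_of_integrable {E : Type*} [NormedAddCommGroup E] {t : ℝ}
    (ht : t ∈ Icc 0 T) {g : ℝ → E} (h : Integrable g (volume.restrict (Ioo 0 T))) :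
    IntervalIntegrable g volume 0 t := by
  rw [intervalIntegrable_iff_integrableOn_Ioo_of_le ht.1]
  exact IntegrableOn.mono_set h (Ioo_subset_Ioo_right ht.2)

end ApproxPeriodic

/-! ### Equivalence of the weak formulation and the system of modes. -/

namespace ApproxPeriodic

variable {n : ℕ} {Ω : Set (Space n)} {T : ℝ} {L₀ : EllipticOperator Ω} {lam : ℕ → ℝ}
  {X : HilbertBasis ℕ ℝ (L2 Ω)} {γ κ : ℝ} {K : ℕ}

/-- `E t` represents the potential `e(·,t)` in the variable `(L₀ + γ)^(1/2) u`. -/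
def Represents (X : HilbertBasis ℕ ℝ (L2 Ω)) (h1 : ∀ j, 1 ≤ lam j + γ) (T : ℝ)
    (e : Space n → ℝ → ℝ) (E : ℝ → L2 Ω →L[ℝ] L2 Ω) : Prop :=
  ∀ᵐ t ∂volume.restrict (Ioo 0 T), ∀ z z', inner ℝ (E t z) z'
    = ∫ x in Ω, e x t * invSqrt X h1 z x * invSqrt X h1 z' x

theorem integral_slice {F : L2 Ω} {f : Space n → ℝ} (hF : F =ᵐ[volume.restrict Ω] f) (v : L2 Ω) :
    ∫ x in Ω, f x * v x = inner ℝ F v := by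
  rw [L2.inner_def]
  refine integral_congr_ae ?_
  filter_upwards [hF] with x hx
  rw [hx]; simp [mul_comm]

/-- A weak solution solves the system of modes. -/
theorem IsWeakSolution.exists_modal (hΩ : IsC2Domain Ω) (hX : IsEigenbasis L₀ lam X)
    (hS : SpectralGap lam γ T K) {e f : Space n → ℝ → ℝ} {E : ℝ → L2 Ω →L[ℝ] L2 Ω}
    (hE : IsSmallFamily X γ T K E) (hEe : Represents X hS.one_le T e E) {F : ℝ → L2 Ω}
    (hF : MemLp F 2 (volume.restrict (Ioo 0 T)))
    (hFf : ∀ᵐ t ∂volume.restrict (Ioo 0 T), F t =ᵐ[volume.restrict Ω] fun x => f x t)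
    {u : ℝ → L2 Ω} {G : ℝ → L2vec Ω} (hu : IsWeakSolution L₀ T e f u G) :
    ∃ y : ℝ → L2 Ω, MemLp y 2 (weighted γ T) ∧
      (∀ᵐ t ∂volume.restrict (Ioo 0 T),
        ‖y t‖ ^ 2 = L₀.form (u t) (G t) (u t) (G t) + γ * ‖u t‖ ^ 2) ∧
      IsModalFamily X lam γ T (fun t => invSqrt X hS.one_le (F t) - E t (y t)) y
        (fun j t => inner ℝ (X j) (u t)) := by
  have hγ := hS.gamma_nonneg
  obtain ⟨y, hy, hyu⟩ := exists_scaled hΩ hX hS.one_le hu.memL2H10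
  have hyw := (memLp_weighted_iff hγ).mpr hy
  have hEy := (memLp_weighted_iff hγ).mp (hE.memLp hγ hyw)
  refine ⟨y, hyw, hyu.mono fun t h => h.2, hyu.mono fun t h => h.1, fun j => ?_⟩
  have hFI := memLp_invSqrt (X := X) hS.one_le hF
  have i1 : Integrable (fun s => √(lam j + γ) * inner ℝ (X j) (invSqrt X hS.one_le (F s)))
      (volume.restrict (Ioo 0 T)) := ((MemLp.coord X hFI j).const_mul _).integrable (by norm_num)
  have i2 : Integrable (fun s => √(lam j + γ) * inner ℝ (X j) (E s (y s)))
      (volume.restrict (Ioo 0 T)) := ((MemLp.coord X hEy j).const_mul _).integrable (by norm_num)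
  have i3 : Integrable (fun s => lam j * inner ℝ (X j) (u s))
      (volume.restrict (Ioo 0 T)) :=
    ((MemLp.coord X hu.memL2H10.memLp j).const_mul _).integrable (by norm_num)
  have hsq : √(lam j + γ) ≠ 0 := (Real.sqrt_pos.mpr (by linarith [hS.one_le j])).ne'
  have hfun : (fun s => √(lam j + γ) * inner ℝ (X j) (invSqrt X hS.one_le (F s) - E s (y s))
      - lam j * inner ℝ (X j) (u s)) = fun s =>
      √(lam j + γ) * inner ℝ (X j) (invSqrt X hS.one_le (F s))
        - (lam j * inner ℝ (X j) (u s) + √(lam j + γ) * inner ℝ (X j) (E s (y s))) := by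
    ext s; rw [inner_sub_right]; ring
  rw [hfun]
  refine ⟨intervalIntegrable_of_integrable ⟨hS.T_pos.le, le_rfl⟩ (i1.sub (i3.add i2)),
    fun t ht => ?_⟩
  -- Testing with the time-independent eigenfunction X_j gives the integrated equation of the j-th
  -- mode.
  have hw := hu.weak _ _ _ (isTestFunction_const (T := T) (X j) (hX.hasGrad j)) t ht
  have eA : (∫ τ in (0 : ℝ)..t, (L₀.form (u τ) (G τ) (X j) (hX.grad j)
      + ∫ x in Ω, e x τ * u τ x * X j x)) = ∫ τ in (0 : ℝ)..t, (lam j * inner ℝ (X j) (u τ)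
        + √(lam j + γ) * inner ℝ (X j) (E τ (y τ))) := by
    refine intervalIntegral.integral_congr_ae (ae_uIoc_of_ae ht ?_)
    filter_upwards [hyu, hEe, hu.memL2H10.hasGrad] with s h1 h2 h3
    -- Since X_j is the image of √(λ_j+γ)X_j under (L₀+γ)^(-1/2), the potential term ∫ e u X_j
    -- becomes √(λ_j+γ)(E y, X_j).
    have h4 := h2 (y s) (√(lam j + γ) • X j)
    rw [invSqrt_eq_of_coord hS.one_le h1.1, map_smul, ← invSqrt_basis, inner_smul_right] at h4
    rw [← h4, L₀.form_symm hΩ, hX.form_eq j h3, real_inner_comm (X j) (E s (y s))]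
  have eB : (∫ τ in (0 : ℝ)..t, ∫ x in Ω, f x τ * X j x) = ∫ τ in (0 : ℝ)..t,
      √(lam j + γ) * inner ℝ (X j) (invSqrt X hS.one_le (F τ)) := by
    refine intervalIntegral.integral_congr_ae (ae_uIoc_of_ae ht ?_)
    filter_upwards [hFf] with s h1
    rw [integral_slice h1, inner_invSqrt, mul_inv_cancel_left₀ hsq, real_inner_comm]
  rw [eA, eB] at hw
  simp only [inner_zero_right, intervalIntegral.integral_zero, sub_zero] at hw
  have i4 := i3.add i2
  simp only [Pi.add_def] at i4
  rw [intervalIntegral.integral_sub (intervalIntegrable_of_integrable ht i1)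
    (intervalIntegrable_of_integrable ht i4), real_inner_comm, real_inner_comm (u 0)]
  linarith

theorem IsTestFunction.hasPrimitive (hT : 0 ≤ T) {φ φt : ℝ → L2 Ω} {Gφ : ℝ → L2vec Ω}
    (hφ : IsTestFunction Ω T φ φt Gφ) (j : ℕ) :
    HasPrimitive T (fun t => inner ℝ (X j) (φ t)) (fun t => inner ℝ (X j) (φt t)) := by
  have hi : Integrable φt (volume.restrict (Ioo 0 T)) := hφ.memLp_deriv.integrable (by norm_num)
  have hj : Integrable (fun t => inner ℝ (X j) (φt t)) (volume.restrict (Ioo 0 T)) :=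
    (MemLp.coord X hφ.memLp_deriv j).integrable (by norm_num)
  refine ⟨intervalIntegrable_of_integrable ⟨hT, le_rfl⟩ hj, fun t ht => ?_⟩
  rw [hφ.eq_integral t ht, inner_add_right]
  congr 1
  exact ((innerSL ℝ (X j)).intervalIntegral_comp_comm
    (intervalIntegrable_of_integrable ht hi)).symm

/-- The system of modes implies the weak formulation. -/
theorem weak_of_modal (hΩ : IsC2Domain Ω) (hX : IsEigenbasis L₀ lam X)
    (hS : SpectralGap lam γ T K) {e f : Space n → ℝ → ℝ} {E : ℝ → L2 Ω →L[ℝ] L2 Ω}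
    (hE : IsSmallFamily X γ T K E) (hEe : Represents X hS.one_le T e E) {F : ℝ → L2 Ω}
    (hF : MemLp F 2 (volume.restrict (Ioo 0 T)))
    (hFf : ∀ᵐ t ∂volume.restrict (Ioo 0 T), F t =ᵐ[volume.restrict Ω] fun x => f x t)
    {u y : ℝ → L2 Ω} {G : ℝ → L2vec Ω} (hu : MemL2H10 Ω T u G) (hy : MemLp y 2 (weighted γ T))
    (hm : IsModalFamily X lam γ T (fun t => invSqrt X hS.one_le (F t) - E t (y t)) y
        (fun j t => inner ℝ (X j) (u t)))
    {φ φt : ℝ → L2 Ω} {Gφ : ℝ → L2vec Ω} (hφ : IsTestFunction Ω T φ φt Gφ) {t : ℝ}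
    (ht : t ∈ Icc 0 T) :
    inner ℝ (u t) (φ t) - (∫ τ in (0 : ℝ)..t, inner ℝ (u τ) (φt τ))
      + (∫ τ in (0 : ℝ)..t, (L₀.form (u τ) (G τ) (φ τ) (Gφ τ)
          + ∫ x in Ω, e x τ * u τ x * φ τ x))
    = inner ℝ (u 0) (φ 0) + ∫ τ in (0 : ℝ)..t, ∫ x in Ω, f x τ * φ τ x := by
  have hγ := hS.gamma_nonneg
  have hT := hS.T_pos.le
  obtain ⟨w, hw, hwφ⟩ := exists_scaled hΩ hX hS.one_le hφ.memL2H10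
  have hEy := (memLp_weighted_iff hγ).mp (hE.memLp hγ hy)
  rw [memLp_weighted_iff hγ] at hy
  have hle : volume.restrict (Ioo 0 t) ≤ volume.restrict (Ioo 0 T) :=
    Measure.restrict_mono (Ioo_subset_Ioo_right ht.2) le_rfl
  have hint : ∀ g : ℝ → ℝ, ∫ τ in (0 : ℝ)..t, g τ = ∫ τ in Ioo 0 t, g τ := fun g => by
    rw [intervalIntegral.integral_of_le ht.1, integral_Ioc_eq_integral_Ioo]
  have sums : ∀ {a b : ℝ → L2 Ω}, MemLp a 2 (volume.restrict (Ioo 0 T)) →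
      MemLp b 2 (volume.restrict (Ioo 0 T)) →
      HasSum (fun j => ∫ τ in (0 : ℝ)..t, inner ℝ (X j) (a τ) * inner ℝ (X j) (b τ))
        (∫ τ in (0 : ℝ)..t, inner ℝ (a τ) (b τ)) := fun ha hb => by
    simp only [hint]
    exact hasSum_integral_coord_mul X (ha.mono_measure hle) (hb.mono_measure hle)
  have ii : ∀ {a b : ℝ → L2 Ω}, MemLp a 2 (volume.restrict (Ioo 0 T)) →
      MemLp b 2 (volume.restrict (Ioo 0 T)) →
      IntervalIntegrable (fun τ => inner ℝ (a τ) (b τ)) volume 0 t := fun ha hb =>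
    intervalIntegrable_of_integrable ht (integrable_inner ha hb)
  have ij : ∀ {a b : ℝ → L2 Ω}, MemLp a 2 (volume.restrict (Ioo 0 T)) →
      MemLp b 2 (volume.restrict (Ioo 0 T)) → ∀ j,
      IntervalIntegrable (fun τ => inner ℝ (X j) (a τ) * inner ℝ (X j) (b τ)) volume 0 t :=
    fun ha hb j => intervalIntegrable_of_integrable ht
      ((MemLp.coord X ha j).integrable_mul (MemLp.coord X hb j))
  have hφm := hφ.memL2H10.memLp
  have hdm := hφ.memLp_deriv
  -- The product rule for u_j φ_j, with w = (L₀+γ)^(1/2) φ. Writing λ_j u_j φ_j = y_j w_j − γ u_j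
  -- φ_j leaves only products of square integrable functions, which can be summed over j by
  -- Parseval.
  have modes : ∀ j, inner ℝ (X j) (u t) * inner ℝ (X j) (φ t)
      - inner ℝ (X j) (u 0) * inner ℝ (X j) (φ 0)
      = (∫ τ in (0 : ℝ)..t, inner ℝ (X j) (u τ) * inner ℝ (X j) (φt τ))
        + (∫ τ in (0 : ℝ)..t, inner ℝ (X j) (F τ) * inner ℝ (X j) (φ τ))
        - (∫ τ in (0 : ℝ)..t, inner ℝ (X j) (E τ (y τ)) * inner ℝ (X j) (w τ))
        - (∫ τ in (0 : ℝ)..t, inner ℝ (X j) (y τ) * inner ℝ (X j) (w τ))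
        + γ * ∫ τ in (0 : ℝ)..t, inner ℝ (X j) (u τ) * inner ℝ (X j) (φ τ) := by
    intro j
    have h1 := ((hm.mode j).mul hT (hφ.hasPrimitive (X := X) hT j)).eq_integral t ht
    have hμ : 0 < lam j + γ := by linarith [hS.one_le j]
    have hsq : √(lam j + γ) ≠ 0 := (Real.sqrt_pos.mpr hμ).ne'
    rw [← intervalIntegral.integral_const_mul, ← intervalIntegral.integral_add
      (ij hu.memLp hdm j) (ij hF hφm j), ← intervalIntegral.integral_sub
      ((ij hu.memLp hdm j).add (ij hF hφm j)) (ij hEy hw j), ← intervalIntegral.integral_sub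
      (((ij hu.memLp hdm j).add (ij hF hφm j)).sub (ij hEy hw j)) (ij hy hw j),
      ← intervalIntegral.integral_add
      ((((ij hu.memLp hdm j).add (ij hF hφm j)).sub (ij hEy hw j)).sub (ij hy hw j))
      ((ij hu.memLp hφm j).const_mul γ), sub_eq_iff_eq_add', h1]
    congr 1
    refine intervalIntegral.integral_congr_ae (ae_uIoc_of_ae ht ?_)
    filter_upwards [hm.coord, hwφ] with s h2 h3
    rw [inner_sub_right, inner_invSqrt, mul_sub, mul_inv_cancel_left₀ hsq, h3.1 j, h2 j]
    have h4 : √(lam j + γ) * inner ℝ (X j) (u s) * (√(lam j + γ) * inner ℝ (X j) (φ s))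
        = (lam j + γ) * (inner ℝ (X j) (u s) * inner ℝ (X j) (φ s)) := by
      rw [← Real.mul_self_sqrt hμ.le]; ring_nf
      rw [Real.sq_sqrt (by positivity)]
    rw [h4]; ring
  have total : inner ℝ (u t) (φ t) - inner ℝ (u 0) (φ 0)
      = (∫ τ in (0 : ℝ)..t, inner ℝ (u τ) (φt τ)) + (∫ τ in (0 : ℝ)..t, inner ℝ (F τ) (φ τ))
        - (∫ τ in (0 : ℝ)..t, inner ℝ (E τ (y τ)) (w τ)) - (∫ τ in (0 : ℝ)..t, inner ℝ (y τ) (w τ))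
        + γ * ∫ τ in (0 : ℝ)..t, inner ℝ (u τ) (φ τ) := by
    have hs : ∀ v v' : L2 Ω, HasSum (fun j => inner ℝ (X j) v * inner ℝ (X j) v')
        (inner ℝ v v') := fun v v' =>
      (X.hasSum_inner_mul_inner v v').congr_fun fun j => by rw [real_inner_comm v]
    refine HasSum.unique ((hs _ _).sub (hs _ _)) ?_
    exact (((((sums hu.memLp hdm).add (sums hF hφm)).sub (sums hEy hw)).sub
      (sums hy hw)).add ((sums hu.memLp hφm).mul_left γ)).congr_fun modes
  have eA : (∫ τ in (0 : ℝ)..t, (L₀.form (u τ) (G τ) (φ τ) (Gφ τ)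
      + ∫ x in Ω, e x τ * u τ x * φ τ x))
      = (∫ τ in (0 : ℝ)..t, inner ℝ (y τ) (w τ)) - γ * (∫ τ in (0 : ℝ)..t, inner ℝ (u τ) (φ τ))
        + ∫ τ in (0 : ℝ)..t, inner ℝ (E τ (y τ)) (w τ) := by
    rw [← intervalIntegral.integral_const_mul, ← intervalIntegral.integral_sub (ii hy hw)
      ((ii hu.memLp hφm).const_mul γ), ← intervalIntegral.integral_add
      ((ii hy hw).sub ((ii hu.memLp hφm).const_mul γ)) (ii hEy hw)]
    refine intervalIntegral.integral_congr_ae (ae_uIoc_of_ae ht ?_)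
    filter_upwards [hm.coord, hwφ, hEe, hu.hasGrad, hφ.memL2H10.hasGrad] with s h2 h3 h4 h5 h6
    have h7 := h4 (y s) (w s)
    rw [invSqrt_eq_of_coord hS.one_le h2, invSqrt_eq_of_coord hS.one_le h3.1] at h7
    rw [h7]
    congr 1
    refine (hX.hasSum_form hΩ h5 h6).unique ?_
    refine ((X.hasSum_inner_mul_inner (y s) (w s)).sub
      ((X.hasSum_inner_mul_inner (u s) (φ s)).mul_left γ)).congr_fun fun j => ?_
    have hμ : 0 < lam j + γ := by linarith [hS.one_le j]
    rw [real_inner_comm (X j) (y s), real_inner_comm (X j) (u s), h2 j, h3.1 j]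
    have h8 := Real.mul_self_sqrt hμ.le
    linear_combination (-(inner ℝ (X j) (u s) * inner ℝ (X j) (φ s))) * h8
  have eB : (∫ τ in (0 : ℝ)..t, ∫ x in Ω, f x τ * φ τ x) = ∫ τ in (0 : ℝ)..t,
      inner ℝ (F τ) (φ τ) := by
    refine intervalIntegral.integral_congr_ae (ae_uIoc_of_ae ht ?_)
    filter_upwards [hFf] with s h1
    rw [integral_slice h1]
  rw [eA, eB]
  linarith

/-- A solution of the system of modes gives a weak solution. -/
theorem IsModalFamily.exists_weakSolution (hΩ : IsC2Domain Ω) (hX : IsEigenbasis L₀ lam X)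
    (hκ : IsGarding L₀ κ) (hκγ : κ + 1 ≤ γ)
    (hS : SpectralGap lam γ T K) {e f : Space n → ℝ → ℝ} {E : ℝ → L2 Ω →L[ℝ] L2 Ω}
    (hE : IsSmallFamily X γ T K E) (hEe : Represents X hS.one_le T e E) {F : ℝ → L2 Ω}
    (hF : MemLp F 2 (volume.restrict (Ioo 0 T)))
    (hFf : ∀ᵐ t ∂volume.restrict (Ioo 0 T), F t =ᵐ[volume.restrict Ω] fun x => f x t)
    {y : ℝ → L2 Ω} {c : ℕ → ℝ → ℝ} (hy : MemLp y 2 (weighted γ T))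
    (hm : IsModalFamily X lam γ T (fun t => invSqrt X hS.one_le (F t) - E t (y t)) y c)
    (hper : ∀ j, K ≤ j → c j 0 = c j T) :
    ∃ (u : ℝ → L2 Ω) (G : ℝ → L2vec Ω), IsWeakSolution L₀ T e f u G ∧
      ∀ t ∈ Icc 0 T, ∀ j, inner ℝ (X j) (u t) = c j t := by
  classical
  have hγ := hS.gamma_nonneg
  have hell := L₀.ell_pos
  have hh : MemLp (fun t => invSqrt X hS.one_le (F t) - E t (y t)) 2 (weighted γ T) :=
    ((memLp_weighted_iff hγ).mpr (memLp_invSqrt (X := X) hS.one_le hF)).sub (hE.memLp hγ hy)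
  have hsum := (hasSum_modeBound (K := K) (X := X) (u := c) hh).summable.mul_left
    (Real.exp (2 * γ * T))
  have hle : ∀ t ∈ Icc 0 T, ∀ j, c j t ^ 2 ≤ Real.exp (2 * γ * T) * modeBound X γ T K
      (fun t => invSqrt X hS.one_le (F t) - E t (y t)) c j :=
    fun t ht j => mode_sq_le hS hh (hm.mode j) (hper j) ht
  have hsq : ∀ t ∈ Icc 0 T, Summable fun j => c j t ^ 2 := fun t ht =>
    hsum.of_nonneg_of_le (fun j => sq_nonneg _) (hle t ht)
  let u : ℝ → L2 Ω := fun t => if h : Summable (fun j => c j t ^ 2) then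
    (exists_coord_eq X h).choose else 0
  have hu : ∀ t ∈ Icc 0 T, ∀ j, inner ℝ (X j) (u t) = c j t := fun t ht => by
    simp only [u, dif_pos (hsq t ht)]
    exact (exists_coord_eq X (hsq t ht)).choose_spec
  have hcont : ContinuousOn u (Icc 0 T) := by
    intro t₀ ht₀
    -- The mode bounds dominate this series uniformly in t, and its sum is ‖u(t) − u(t₀)‖².
    have h1 : ContinuousOn (fun t => ∑' j, (c j t - c j t₀) ^ 2) (Icc 0 T) := by
      refine continuousOn_tsum (fun j => ((hm.mode j).continuousOn.sub continuousOn_const).pow 2)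
        (hsum.mul_left 4) fun j t ht => ?_
      rw [Real.norm_of_nonneg (sq_nonneg _)]
      have h2 := hle t ht j
      have h3 := hle t₀ ht₀ j
      nlinarith [sq_nonneg (c j t + c j t₀)]
    have h2 : ∀ t ∈ Icc 0 T, ∑' j, (c j t - c j t₀) ^ 2 = ‖u t - u t₀‖ ^ 2 := fun t ht => by
      rw [← (hasSum_sq_coord X (u t - u t₀)).tsum_eq]
      refine tsum_congr fun j => ?_
      rw [inner_sub_right, hu t ht, hu t₀ ht₀]
    have h3 := h1 t₀ ht₀
    rw [ContinuousWithinAt, h2 t₀ ht₀, sub_self, norm_zero, zero_pow two_ne_zero] at h3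
    have h4 := (h3.congr' (eventually_mem_nhdsWithin.mono h2)).sqrt
    simp only [Real.sqrt_zero, Real.sqrt_sq (norm_nonneg _)] at h4
    exact tendsto_iff_norm_sub_tendsto_zero.mpr h4
  have hum : MemLp u 2 (volume.restrict (Ioo 0 T)) := memLp_continuousOn hcont
  have hcoord : ∀ᵐ t ∂volume.restrict (Ioo 0 T), ∀ j,
      inner ℝ (X j) (y t) = √(lam j + γ) * inner ℝ (X j) (u t) := by
    filter_upwards [hm.coord, ae_restrict_mem measurableSet_Ioo] with t h1 h2 j
    rw [h1, hu t (Ioo_subset_Icc_self h2)]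
  have hgrad : ∀ᵐ t ∂volume.restrict (Ioo 0 T), ∃ h, HasGrad Ω (u t) h := by
    filter_upwards [hcoord] with t h1
    have := exists_grad_invSqrt hΩ hX hκ hκγ hS.one_le (y t)
    rw [invSqrt_eq_of_coord hS.one_le h1] at this
    exact ⟨_, this.choose_spec.1⟩
  let G : ℝ → L2vec Ω := fun t => if h : ∃ h, HasGrad Ω (u t) h then h.choose else 0
  have hG : ∀ᵐ t ∂volume.restrict (Ioo 0 T), HasGrad Ω (u t) (G t) := by
    filter_upwards [hgrad] with t h1
    simp only [G, dif_pos h1]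
    exact h1.choose_spec
  have hGm : AEStronglyMeasurable G (volume.restrict (Ioo 0 T)) := by
    refine aestronglyMeasurable_of_tendsto_ae (u := Filter.atTop)
      (f := fun N t => ∑ j ∈ Finset.range N, inner ℝ (X j) (u t) • hX.grad j)
      (fun N => Finset.aestronglyMeasurable_fun_sum _ fun j _ =>
        (MemLp.coord X hum j).1.smul_const _) ?_
    filter_upwards [hG] with t h1
    exact ((hX.hasSum_expansion hΩ h1).mapL (ContinuousLinearMap.snd ℝ _ _)).tendsto_sum_nat
  have hGL : MemLp G 2 (volume.restrict (Ioo 0 T)) := by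
    refine (((memLp_weighted_iff hγ).mp hy).norm.const_mul √(2 / L₀.ell)).mono hGm ?_
    filter_upwards [hG, hcoord] with t h1 h2
    rw [Real.norm_of_nonneg (by positivity)]
    refine (sq_le_sq₀ (norm_nonneg _) (by positivity)).mp ?_
    rw [mul_pow, Real.sq_sqrt (by positivity)]
    obtain ⟨h, hh1, hh2⟩ := exists_grad_invSqrt hΩ hX hκ hκγ hS.one_le (y t)
    rw [invSqrt_eq_of_coord hS.one_le h2] at hh1 hh2
    rw [← hh1.unique hΩ h1]
    have h3 := hκ.2 (u t) h
    calc ‖h‖ ^ 2 = 2 / L₀.ell * (L₀.ell / 2 * ‖h‖ ^ 2) := by field_simp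
      _ ≤ 2 / L₀.ell * ‖y t‖ ^ 2 := by
        gcongr
        rw [← hh2]
        nlinarith [sq_nonneg ‖u t‖]
  have hmem : MemL2H10 Ω T u G := ⟨hum, hGL, hG⟩
  have hm' : IsModalFamily X lam γ T (fun t => invSqrt X hS.one_le (F t) - E t (y t)) y
      (fun j t => inner ℝ (X j) (u t)) := by
    refine ⟨hcoord, fun j => ⟨?_, fun t ht => ?_⟩⟩
    · refine (hm.mode j).integrable.congr fun s hs => ?_
      rw [uIoc_of_le hS.T_pos.le] at hs
      simp only [hu s (Ioc_subset_Icc_self hs)]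
    · simp only [hu t ht, hu 0 ⟨le_rfl, hS.T_pos.le⟩]
      rw [(hm.mode j).eq_integral t ht]
      congr 1
      refine intervalIntegral.integral_congr fun s hs => ?_
      rw [uIcc_of_le ht.1] at hs
      simp only [hu s ⟨hs.1, hs.2.trans ht.2⟩]
  exact ⟨u, G, ⟨hcont, hmem, fun φ φt Gφ hφ t ht =>
    weak_of_modal hΩ hX hS hE hEe hF hFf hmem hy hm' hφ ht⟩, hu⟩

end ApproxPeriodic

/-! ### Uniqueness, energy estimate and choice of constants. -/

namespace ApproxPeriodic

variable {n : ℕ} {Ω : Set (Space n)} {T : ℝ} {L₀ : EllipticOperator Ω} {lam : ℕ → ℝ}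
  {X : HilbertBasis ℕ ℝ (L2 Ω)} {γ κ : ℝ} {K : ℕ}

theorem IsModalFamily.norm_sq_le (hS : SpectralGap lam γ T K) {h y : ℝ → L2 Ω}
    {c : ℕ → ℝ → ℝ} (hh : MemLp h 2 (weighted γ T)) (hm : IsModalFamily X lam γ T h y c)
    (hper : ∀ j, K ≤ j → c j 0 = c j T) {t : ℝ} (ht : t ∈ Icc 0 T) {x : L2 Ω}
    (hx : ∀ j, inner ℝ (X j) x = c j t) :
    ‖x‖ ^ 2 ≤ Real.exp (2 * γ * T) * totalBound X γ T K h c :=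
  hasSum_le (fun j => by rw [hx j]; exact mode_sq_le hS hh (hm.mode j) (hper j) ht)
    (hasSum_sq_coord X x) ((hasSum_modeBound (K := K) (X := X) (u := c) hh).mul_left _)

/-- By linearity the difference solves the system with F = 0, zero low data and periodic high modes;
the a priori bound then vanishes. -/
theorem isModalFamily_eqOn (hS : SpectralGap lam γ T K) {E : ℝ → L2 Ω →L[ℝ] L2 Ω}
    (hE : IsSmallFamily X γ T K E) {F : ℝ → L2 Ω} {y y' u u' : ℝ → L2 Ω}
    (hy : MemLp y 2 (weighted γ T)) (hy' : MemLp y' 2 (weighted γ T))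
    (hm : IsModalFamily X lam γ T (fun t => F t - E t (y t)) y (fun j t => inner ℝ (X j) (u t)))
    (hm' : IsModalFamily X lam γ T (fun t => F t - E t (y' t)) y'
      (fun j t => inner ℝ (X j) (u' t)))
    (hinit : ∀ j, j < K → inner ℝ (X j) (u 0) = inner ℝ (X j) (u' 0))
    (hper : ∀ j, K ≤ j → inner ℝ (X j) (u 0) = inner ℝ (X j) (u T))
    (hper' : ∀ j, K ≤ j → inner ℝ (X j) (u' 0) = inner ℝ (X j) (u' T)) :
    EqOn u u' (Icc 0 T) := by
  have hγ := hS.gamma_nonneg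
  have hd := hm.sub hm'
  have hfun : (fun t => F t - E t (y t) - (F t - E t (y' t)))
      = fun t => (fun _ => (0 : L2 Ω)) t - E t (y t - y' t) := by
    funext t; simp only [map_sub, zero_sub]; abel
  rw [hfun] at hd
  have hz : MemLp (fun _ : ℝ => (0 : L2 Ω)) 2 (weighted γ T) := MemLp.zero'
  have hyd : MemLp (fun t => y t - y' t) 2 (weighted γ T) := hy.sub hy'
  have hp : ∀ j, K ≤ j → inner ℝ (X j) (u 0) - inner ℝ (X j) (u' 0)
      = inner ℝ (X j) (u T) - inner ℝ (X j) (u' T) := fun j hj => by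
    rw [hper j hj, hper' j hj]
  have htot := hd.totalBound_le hS hE hz hyd hp
  have h0 : ∑ j ∈ Finset.range K, (inner ℝ (X j) (u 0) - inner ℝ (X j) (u' 0)) ^ 2 = 0 :=
    Finset.sum_eq_zero fun j hj => by rw [hinit j (Finset.mem_range.mp hj)]; simp
  simp only [h0, map_zero, norm_zero, ne_eq, OfNat.ofNat_ne_zero, not_false_eq_true, zero_pow,
    integral_zero, mul_zero, add_zero] at htot
  have hh : MemLp (fun t => (fun _ => (0 : L2 Ω)) t - E t (y t - y' t)) 2 (weighted γ T) :=
    hz.sub (hE.memLp hγ hyd)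
  intro t ht
  have h1 : ‖u t - u' t‖ ^ 2 ≤ 0 :=
    (hd.norm_sq_le hS hh hp ht fun j => inner_sub_right _ _ _).trans
      (mul_nonpos_of_nonneg_of_nonpos (Real.exp_pos _).le htot)
  exact sub_eq_zero.mp (norm_eq_zero.mp
    (pow_eq_zero_iff two_ne_zero |>.mp (le_antisymm h1 (sq_nonneg _))))

/-- The energy estimate for approximately periodic weak solutions. -/
theorem IsWeakSolution.energy_le (hΩ : IsC2Domain Ω) (hX : IsEigenbasis L₀ lam X)
    (hκ : IsGarding L₀ κ) (hκγ : κ + 1 ≤ γ)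
    (hS : SpectralGap lam γ T K) {e f : Space n → ℝ → ℝ} {E : ℝ → L2 Ω →L[ℝ] L2 Ω}
    (hE : IsSmallFamily X γ T K E) (hEe : Represents X hS.one_le T e E) {F : ℝ → L2 Ω}
    (hF : MemLp F 2 (volume.restrict (Ioo 0 T)))
    (hFf : ∀ᵐ t ∂volume.restrict (Ioo 0 T), F t =ᵐ[volume.restrict Ω] fun x => f x t)
    {u : ℝ → L2 Ω} {G : ℝ → L2vec Ω} (hu : IsWeakSolution L₀ T e f u G)
    (hper : ∀ j, K ≤ j → inner ℝ (X j) (u 0) = inner ℝ (X j) (u T)) :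
    (⨆ t : Icc (0 : ℝ) T, ‖u t‖ ^ 2) + (∫ t in (0 : ℝ)..T, ‖G t‖ ^ 2)
      ≤ Real.exp (2 * γ * T) * (1 + 2 / L₀.ell) * (4 + 32 * Real.exp (2 * γ * T))
        * ((∑ j ∈ Finset.range K, inner ℝ (X j) (u 0) ^ 2) + ∫ t in Ioo 0 T, ‖F t‖ ^ 2) := by
  have hγ := hS.gamma_nonneg
  have hell := L₀.ell_pos
  have hT := hS.T_pos.le
  have : Nonempty (Icc (0 : ℝ) T) := ⟨⟨0, le_rfl, hT⟩⟩
  obtain ⟨y, hy, hyn, hm⟩ := hu.exists_modal hΩ hX hS hE hEe hF hFf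
  have hFI := memLp_invSqrt (X := X) hS.one_le hF
  have hFw := (memLp_weighted_iff hγ).mpr hFI
  have hh : MemLp (fun t => invSqrt X hS.one_le (F t) - E t (y t)) 2 (weighted γ T) :=
    hFw.sub (hE.memLp hγ hy)
  have htot := hm.totalBound_le hS hE hFw hy hper
  set A := ∑ j ∈ Finset.range K, inner ℝ (X j) (u 0) ^ 2
  set B := ∫ t in Ioo 0 T, ‖F t‖ ^ 2
  set ρ := Real.exp (2 * γ * T)
  set R := totalBound X γ T K (fun t => invSqrt X hS.one_le (F t) - E t (y t))
    (fun j t => inner ℝ (X j) (u t))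
  have hρ : 0 < ρ := Real.exp_pos _
  have hA : 0 ≤ A := by positivity
  have hB : 0 ≤ B := integral_nonneg fun t => by positivity
  have iF : Integrable (fun t => ‖F t‖ ^ 2) (volume.restrict (Ioo 0 T)) := hF.norm.integrable_sq
  have iFw : Integrable (fun t => ‖F t‖ ^ 2) (weighted γ T) :=
    ((memLp_weighted_iff hγ).mpr hF).norm.integrable_sq
  have hFB : ∫ t, ‖F t‖ ^ 2 ∂weighted γ T ≤ B :=
    integral_mono_measure (weighted_le hγ) (Filter.Eventually.of_forall fun t => by positivity) iF
  have hF1 : ∫ t, ‖invSqrt X hS.one_le (F t)‖ ^ 2 ∂weighted γ T ≤ B := by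
    refine le_trans (integral_mono hFw.norm.integrable_sq iFw fun t => ?_) hFB
    have := norm_invSqrt_le (X := X) hS.one_le (F t)
    dsimp only
    gcongr
  have hF2 : ∫ t, ‖highModes X K (invSqrt X hS.one_le (F t))‖ ^ 2 ∂weighted γ T ≤ B := by
    refine le_trans (integral_mono ((highModes X K).comp_memLp' hFw).norm.integrable_sq iFw
      fun t => ?_) hFB
    have := (norm_highModes_le X K _).trans (norm_invSqrt_le (X := X) hS.one_le (F t))
    dsimp only [Function.comp]
    gcongr
  have hR : R ≤ (4 + 32 * ρ) * (A + B) := by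
    have h1 : 8 * ρ * ∫ t, ‖highModes X K (invSqrt X hS.one_le (F t))‖ ^ 2 ∂weighted γ T
        ≤ 8 * ρ * B := by gcongr
    nlinarith [mul_nonneg hρ.le hA]
  have hsup : (⨆ t : Icc (0 : ℝ) T, ‖u t‖ ^ 2) ≤ ρ * R :=
    ciSup_le fun t => hm.norm_sq_le hS hh hper t.2 fun _ => rfl
  have hy2 := hm.integral_le hS hh hy hper
  have iy : Integrable (fun t => ‖y t‖ ^ 2) (weighted γ T) := hy.norm.integrable_sq
  have iy' : Integrable (fun t => ‖y t‖ ^ 2) (volume.restrict (Ioo 0 T)) :=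
    ((memLp_weighted_iff hγ).mp hy).norm.integrable_sq
  have hy3 := integral_le_weighted (T := T) hγ iy fun t => by positivity
  -- ‖y‖² is the energy of u, so Gårding gives ‖G‖² ≤ (2/ell)‖y‖²; the factor ρ removes the weight.
  have hG : ∫ t in (0 : ℝ)..T, ‖G t‖ ^ 2 ≤ 2 / L₀.ell * (ρ * R) := by
    rw [intervalIntegral.integral_of_le hT, integral_Ioc_eq_integral_Ioo]
    calc ∫ t in Ioo 0 T, ‖G t‖ ^ 2 ≤ ∫ t in Ioo 0 T, 2 / L₀.ell * ‖y t‖ ^ 2 := by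
          refine integral_mono_ae hu.memL2H10.memLp_grad.norm.integrable_sq
            (iy'.const_mul _) ?_
          filter_upwards [hyn] with t h1
          rw [h1]
          have h2 := hκ.2 (u t) (G t)
          calc ‖G t‖ ^ 2 = 2 / L₀.ell * (L₀.ell / 2 * ‖G t‖ ^ 2) := by field_simp
            _ ≤ _ := by
              gcongr
              nlinarith [sq_nonneg ‖u t‖]
      _ = 2 / L₀.ell * ∫ t in Ioo 0 T, ‖y t‖ ^ 2 := integral_const_mul _ _
      _ ≤ 2 / L₀.ell * (ρ * R) := by
          gcongr
          exact hy3.trans (by gcongr)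
  calc _ ≤ ρ * R + 2 / L₀.ell * (ρ * R) := add_le_add hsup hG
    _ = ρ * (1 + 2 / L₀.ell) * R := by ring
    _ ≤ ρ * (1 + 2 / L₀.ell) * ((4 + 32 * ρ) * (A + B)) := by gcongr
    _ = _ := by ring

theorem spectralGap_of_lt (hX : IsEigenbasis L₀ lam X) (hκ : IsGarding L₀ κ) (hκγ : κ + 1 ≤ γ)
    (hT : 0 < T) {Λ : ℝ} (h1 : γ ≤ Λ) (h2 : 0 ≤ Λ) (h3 : Real.log 2 / T ≤ Λ)
    (hK : ∀ j, K ≤ j → Λ < lam j) : SpectralGap lam γ T K where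
  gamma_nonneg := by linarith [hκ.1]
  T_pos := hT
  one_le j := by linarith [hX.neg_le hκ j]
  gamma_le j hj := h1.trans (hK j hj).le
  lam_pos j hj := h2.trans_lt (hK j hj)
  exp_le j hj := by
    have h4 : Real.log 2 ≤ lam j * T := by
      rw [div_le_iff₀ hT] at h3
      nlinarith [hK j hj]
    have h5 : Real.exp (-lam j * T) ≤ Real.exp (-Real.log 2) :=
      Real.exp_le_exp.mpr (by linarith)
    rw [Real.exp_neg, Real.exp_log (by norm_num)] at h5
    simpa using h5

end ApproxPeriodic

theorem theorem1p2 (n : ℕ) (hn : 1 ≤ n) (Ω : Set (Space n)) (hΩ : IsC2Domain Ω)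
    (T : ℝ) (hT : 0 < T) (L₀ : EllipticOperator Ω)
    (q : ℝ≥0∞) (hq : ((n : ℝ≥0∞) + 2) / 2 < q) (M : ℝ≥0) :
    ∃ (K₀ : ℕ) (C : ℝ),
      ∀ (lam : ℕ → ℝ) (X : HilbertBasis ℕ ℝ (L2 Ω)), IsEigenbasis L₀ lam X →
      ∀ e ∈ errorClass Ω T q M, ∀ f : Space n → ℝ → ℝ, MemL2Q Ω T f →
      ∀ K : ℕ, K₀ ≤ K → ∀ a : Fin K → ℝ,
        (∃ (u : ℝ → L2 Ω) (G : ℝ → L2vec Ω), IsApproxPeriodicSolution L₀ T X e f K a u G) ∧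
        (∀ (u v : ℝ → L2 Ω) (G H : ℝ → L2vec Ω),
          IsApproxPeriodicSolution L₀ T X e f K a u G →
          IsApproxPeriodicSolution L₀ T X e f K a v H → EqOn u v (Icc 0 T)) ∧
        (∀ (u : ℝ → L2 Ω) (G : ℝ → L2vec Ω), IsApproxPeriodicSolution L₀ T X e f K a u G →
          (⨆ t : Icc (0 : ℝ) T, ‖u t‖ ^ 2) + (∫ t in (0 : ℝ)..T, ‖G t‖ ^ 2)
            ≤ C * ((∑ j, a j ^ 2)
              + ∫ p : Space n × ℝ, f p.1 p.2 ^ 2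
                  ∂((volume.restrict Ω).prod (volume.restrict (Ioo 0 T))))) := by
  obtain ⟨κ, hκ⟩ := L₀.exists_garding hΩ
  obtain ⟨Γ₁, hΓ₁⟩ := exists_form_bound hn hΩ L₀ hq M (a := 1 / 4) (by norm_num)
  set γ := max (κ + 1) Γ₁
  have hκγ : κ + 1 ≤ γ := le_max_left _ _
  have hP : PotentialBound L₀ q M (1 / 4) γ := hΓ₁.mono (by norm_num) (le_max_right _ _)
  -- The order of choices avoids circularity: this bound depends on γ, which is already fixed, and
  -- Γ₂ influences only K₀. The denominator 64 is such that 8 exp(2γT) · a/2 = 1/32 ≤ 1/16.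
  obtain ⟨Γ₂, hP'⟩ := exists_form_bound hn hΩ L₀ hq M
    (a := Real.exp (-(2 * γ * T)) / 64) (by positivity)
  obtain ⟨K₀, hK₀⟩ := exists_uniform_index hn hΩ L₀ (max (max γ Γ₂) (max 0 (Real.log 2 / T)))
  refine ⟨K₀, Real.exp (2 * γ * T) * (1 + 2 / L₀.ell) * (4 + 32 * Real.exp (2 * γ * T)),
    fun lam X hX e he f hf K hK a => ?_⟩
  have hlarge : ∀ j, K ≤ j → max (max γ Γ₂) (max 0 (Real.log 2 / T)) < lam j :=
    fun j hj => hK₀ lam X hX j (hK.trans hj)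
  have hS : SpectralGap lam γ T K := spectralGap_of_lt hX hκ hκγ hT
    ((le_max_left _ _).trans (le_max_left _ _)) ((le_max_left _ _).trans (le_max_right _ _))
    ((le_max_right _ _).trans (le_max_right _ _)) hlarge
  have hΓ₂ : ∀ j, K ≤ j → Γ₂ ≤ lam j := fun j hj =>
    ((le_max_right _ _).trans (le_max_left _ _)).trans (hlarge j hj).le
  obtain ⟨E, hE, hEe⟩ := exists_potentialFamily hΩ hX hκ hκγ hS.one_le hP hP' hΓ₂ he
  obtain ⟨F, hF, hFf, hFn⟩ := exists_slices X hf
  have hFw := (memLp_weighted_iff hS.gamma_nonneg).mpr (memLp_invSqrt (X := X) hS.one_le hF)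
  have init : ∀ {u G}, IsApproxPeriodicSolution L₀ T X e f K a u G →
      ∀ (j : ℕ) (hj : j < K), inner ℝ (X j) (u 0) = a ⟨j, hj⟩ := fun hu j hj => by
    rw [real_inner_comm]; exact hu.initial ⟨j, hj⟩
  have per : ∀ {u G}, IsApproxPeriodicSolution L₀ T X e f K a u G →
      ∀ j, K ≤ j → inner ℝ (X j) (u 0) = inner ℝ (X j) (u T) := fun hu j hj => by
    rw [real_inner_comm, hu.periodic j hj, real_inner_comm]
  refine ⟨?_, fun u v G H hu hv => ?_, fun u G hu => ?_⟩
  · obtain ⟨y, c, hy, hm, hca, hcp⟩ := exists_modalFamily_perturbed hS hE hFw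
      (fun j => if h : j < K then a ⟨j, h⟩ else 0)
    obtain ⟨u, G, hu, huc⟩ := hm.exists_weakSolution hΩ hX hκ hκγ hS hE hEe hF hFf hy hcp
    refine ⟨u, G, hu, fun j => ?_, fun j hj => ?_⟩
    · rw [real_inner_comm, huc 0 ⟨le_rfl, hT.le⟩, hca j j.2, dif_pos j.2]
    · rw [real_inner_comm, real_inner_comm (X j) (u T), huc 0 ⟨le_rfl, hT.le⟩,
        huc T ⟨hT.le, le_rfl⟩, hcp j hj]
  · obtain ⟨y, hy, -, hm⟩ := hu.weakSolution.exists_modal hΩ hX hS hE hEe hF hFf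
    obtain ⟨y', hy', -, hm'⟩ := hv.weakSolution.exists_modal hΩ hX hS hE hEe hF hFf
    exact isModalFamily_eqOn hS hE hy hy' hm hm'
      (fun j hj => by rw [init hu j hj, init hv j hj]) (per hu) (per hv)
  · have h1 := hu.weakSolution.energy_le hΩ hX hκ hκγ hS hE hEe hF hFf (per hu)
    have h2 : ∑ j ∈ Finset.range K, inner ℝ (X j) (u 0) ^ 2 = ∑ j, a j ^ 2 := by
      rw [Finset.sum_range]
      exact Finset.sum_congr rfl fun j _ => by rw [init hu j j.2]
    rwa [h2, hFn] at h1
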